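/- **Setting.** Logarithms are in base $2$. Let $\mathsf S,\mathsf I,\mathsf C\ge 0$ and $\theta_{\mathsf p},\theta_{\mathsf c}\in\mathbb R$. The *symmetric Gaussian causal cognitive interference channel* (symmetric GCCIC) has, at each time $i$, complex inputs $X_{\mathsf p,i},X_{\mathsf c,i}$ and outputs $$T_{\mathsf f,i}=\sqrt{\mathsf C}\,X_{\mathsf p,i}+Z_{\mathsf f,i},\qquad Y_{\mathsf p,i}=\sqrt{\mathsf S}\,X_{\mathsf p,i}+\sqrt{\mathsf I}\,e^{\mathrm j\theta_{\mathsf c}}X_{\mathsf c,i}+Z_{\mathsf p,i},\qquad Y_{\mathsf c,i}=\sqrt{\mathsf I}\,e^{\mathrm j\theta_{\mathsf p}}X_{\mathsf p,i}+\sqrt{\mathsf S}\,X_{\mathsf c,i}+Z_{\mathsf c,i},$$ where all the noises $Z_{\mathsf p,i},Z_{\mathsf c,i},Z_{\mathsf f,i}$ are mutually independent (also over time), circularly symmetric complex Gaussian with zero mean and unit variance. For block length $N$, independent messages $W_{\mathsf p},W_{\mathsf c}$, independent of the noises, are uniform on the integers in $[1:2^{NR_{\mathsf p}}]$ and $[1:2^{NR_{\mathsf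 c}}]$; $X_{\mathsf p,i}$ is a function of $W_{\mathsf p}$, while $X_{\mathsf c,i}$ is a function of $W_{\mathsf c}$ and of the past feedback $T_{\mathsf f,1},\dots,T_{\mathsf f,i-1}$; the average power constraints are $\frac1N\sum_{i=1}^N\mathbb E|X_{u,i}|^2\le 1$ for $u\in\{\mathsf p,\mathsf c\}$; the receiver $u$ estimates $W_u$ from $Y_{u,1},\dots,Y_{u,N}$. The capacity region is the closed convex hull of all pairs $(R_{\mathsf p},R_{\mathsf c})$ with $R_{\mathsf p},R_{\mathsf c}\ge0$ for which there are codes, one for each $N$, with $\max_{u}\mathbb P[\widehat W_u\ne W_u]\to0$ as $N\to\infty$. **Lemma.** Every pair $(R_{\mathsf p},R_{\mathsf c})$ in the capacity region of the symmetric GCCIC satisfies $$\begin{aligned} R_{\mathsf p}&\le\log(1+\mathsf C+\mathsf S),\\ R_{\mathsf p}&\le\log\big(1+(\sqrt{\mathsf S}+\sqrt{\mathsf I})^2\big),\\ R_{\mathsf c}&\le\log(1+\mathsf S),\\ R_{\mathsf p}+R_{\mathsf c}&\le\Sigma:=\log\Big(1+\frac{\mathsf S}{1+\mathsf I}\Big)+\log\big(1+(\sqrt{\mathsf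 S}+\sqrt{\mathsf I})^2\big),\\ R_{\mathsf p}+R_{\mathsf c}&\le\Sigma':=\log\Big(1+\frac{\mathsf S+\mathsf C}{1+\mathsf I}\Big)+\log\big(1+(\sqrt{\mathsf S}+\sqrt{\mathsf I})^2\big),\\ R_{\mathsf p}+R_{\mathsf c}&\le\Sigma''+2\log 2,\qquad \Sigma'':=\log\Big(1+\mathsf C+\mathsf I+\frac{\mathsf S}{1+\mathsf I}\Big)+\log\Big(1+\mathsf I+\mathsf S\,\frac{1+\mathsf C}{1+\mathsf C+\mathsf I}\Big),\\ 2R_{\mathsf p}+R_{\mathsf c}&\le\Sigma+\Delta_1+\log 2,\qquad \Delta_1:=\log\Big(1+\frac{\mathsf C}{1+\mathsf I+\mathsf S}\Big)+\log\Big(1+\mathsf I+\mathsf S\,\frac{1+\mathsf C}{1+\mathsf I+\mathsf C}\Big),\\ R_{\mathsf p}+2R_{\mathsf c}&\le\Sigma+\Delta_2+\log 2,\qquad \Delta_2:=\log\Big(1+\mathsf C+\mathsf I+\frac{\mathsf S}{1+\mathsf I}\Big). \end{aligned}$$ Moreover $\Sigma'\ge\Sigma$; if $\mathsf C\ge\mathsf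 I$, then $\Sigma''\ge\log\big(1+2\mathsf I+\frac{\mathsf S}{1+\mathsf I}\big)+\log\big(1+\mathsf I+\frac{\mathsf S}{2}\big)$; in all cases $\log\big(1+2\mathsf I+\frac{\mathsf S}{1+\mathsf I}\big)+\log\big(1+\mathsf I+\frac{\mathsf S}{2}\big)\ge\Sigma-2\log 2$; if $\mathsf C\ge\mathsf I$, then $\Delta_1\ge\log\big(1+\mathsf I+\frac{\mathsf S}{2}\big)$; and if $\mathsf C\ge\mathsf S$, then $\Delta_2\ge\log(1+\mathsf S)$. -/

import Mathlib

open MeasureTheory ProbabilityTheory Filter Topology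

/-- The circularly symmetric complex Gaussian law with mean zero and unit variance: real and
imaginary parts are independent real Gaussians of variance `1/2`. -/
noncomputable def stdComplexGaussian : Measure ℂ :=
  ((gaussianReal 0 (1 / 2)).prod (gaussianReal 0 (1 / 2))).map
    (fun p : ℝ × ℝ => (⟨p.1, p.2⟩ : ℂ))

instance : IsProbabilityMeasure stdComplexGaussian :=
  Measure.isProbabilityMeasure_map
    (Complex.measurableEquivRealProd.symm.measurable.aemeasurable)

/-- Parameters of a Gaussian causal cognitive interference channel: powers of the direct links,
of the interfering links (`inrP` is the one from the primary transmitter to the cognitive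
receiver, `inrC` the one from the cognitive transmitter to the primary receiver) and of the
cooperation link, and the phases of the two interfering links. -/
structure GCCIC where
  snrP : ℝ
  snrC : ℝ
  inrP : ℝ
  inrC : ℝ
  coop : ℝ
  thetaP : ℝ
  thetaC : ℝ

/-- The symmetric channel: equal direct links, equal interfering links, arbitrary phases. -/
def GCCIC.symmetric (S I C θp θc : ℝ) : GCCIC where
  snrP := S
  snrC := S
  inrP := I
  inrC := I
  coop := C
  thetaP := θp
  thetaC := θc

/-- A block code of length `N` with `Mp` primary and `Mc` cognitive messages. At time `i` the
cognitive encoder sees its own message and the feedback symbols received strictly before `i`. -/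
structure CCICCode (N Mp Mc : ℕ) where
  encP : Fin N → Fin Mp → ℂ
  encC : (i : Fin N) → Fin Mc → (Fin (i : ℕ) → ℂ) → ℂ
  measurable_encC : ∀ i w, Measurable (encC i w)
  decP : (Fin N → ℂ) → Fin Mp
  measurable_decP : Measurable decP
  decC : (Fin N → ℂ) → Fin Mc
  measurable_decC : Measurable decC

/-- What is random in one use of a code: the two messages and the three noise sequences, at the
primary receiver, at the cognitive receiver and at the cognitive transmitter. -/
abbrev CCICOutcome (N Mp Mc : ℕ) : Type :=
  Fin Mp × Fin Mc × (Fin N → ℂ) × (Fin N → ℂ) × (Fin N → ℂ)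

namespace CCICOutcome

variable {N Mp Mc : ℕ} (ω : CCICOutcome N Mp Mc)

/-- The primary message. -/
def wp : Fin Mp := ω.1

/-- The cognitive message. -/
def wc : Fin Mc := ω.2.1

/-- The noise at the primary receiver. -/
def zp : Fin N → ℂ := ω.2.2.1

/-- The noise at the cognitive receiver. -/
def zc : Fin N → ℂ := ω.2.2.2.1

/-- The noise at the cognitive transmitter. -/
def zf : Fin N → ℂ := ω.2.2.2.2

end CCICOutcome

/-- The messages are uniform, the noises are i.i.d. circularly symmetric standard Gaussian, and
the two messages and the three noise sequences are mutually independent. -/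
noncomputable def ccicLaw (N Mp Mc : ℕ) : Measure (CCICOutcome N Mp Mc) :=
  (uniformOn (Set.univ : Set (Fin Mp))).prod
    ((uniformOn (Set.univ : Set (Fin Mc))).prod
      ((Measure.pi fun _ : Fin N => stdComplexGaussian).prod
        ((Measure.pi fun _ : Fin N => stdComplexGaussian).prod
          (Measure.pi fun _ : Fin N => stdComplexGaussian))))

namespace GCCIC

variable (ch : GCCIC) {N Mp Mc : ℕ} (c : CCICCode N Mp Mc)

/-- Channel input of the primary transmitter at time `i`. -/
def xP (ω : CCICOutcome N Mp Mc) (i : Fin N) : ℂ := c.encP i (CCICOutcome.wp ω)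

/-- The feedback signal `T_f = √C X_p + Z_f` received by the cognitive transmitter. -/
noncomputable def tF (ω : CCICOutcome N Mp Mc) (i : Fin N) : ℂ :=
  (Real.sqrt ch.coop : ℂ) * xP c ω i + CCICOutcome.zf ω i

/-- Channel input of the cognitive transmitter at time `i`. -/
noncomputable def xC (ω : CCICOutcome N Mp Mc) (i : Fin N) : ℂ :=
  c.encC i (CCICOutcome.wc ω) fun j => ch.tF c ω (j.castLE i.isLt.le)

/-- `T_p = √INR_p e^{j θ_p} X_p + Z_c`. -/
noncomputable def tP (ω : CCICOutcome N Mp Mc) (i : Fin N) : ℂ :=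
  (Real.sqrt ch.inrP : ℂ) * Complex.exp (ch.thetaP * Complex.I) * xP c ω i + CCICOutcome.zc ω i

/-- `T_c = √INR_c e^{j θ_c} X_c + Z_p`. -/
noncomputable def tC (ω : CCICOutcome N Mp Mc) (i : Fin N) : ℂ :=
  (Real.sqrt ch.inrC : ℂ) * Complex.exp (ch.thetaC * Complex.I) * ch.xC c ω i + CCICOutcome.zp ω i

/-- Output at the primary receiver. -/
noncomputable def yP (ω : CCICOutcome N Mp Mc) (i : Fin N) : ℂ :=
  (Real.sqrt ch.snrP : ℂ) * xP c ω i + ch.tC c ω i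

/-- Output at the cognitive receiver. -/
noncomputable def yC (ω : CCICOutcome N Mp Mc) (i : Fin N) : ℂ :=
  ch.tP c ω i + (Real.sqrt ch.snrC : ℂ) * ch.xC c ω i

/-- Unit average power at both transmitters: `(1/N) ∑ᵢ E|Xᵢ|² ≤ 1`, the expectation being over
messages and noises. -/
def PowerConstraint : Prop :=
  ∑ i : Fin N, ∫⁻ ω, ‖xP c ω i‖ₑ ^ 2 ∂(ccicLaw N Mp Mc) ≤ N ∧
  ∑ i : Fin N, ∫⁻ ω, ‖ch.xC c ω i‖ₑ ^ 2 ∂(ccicLaw N Mp Mc) ≤ N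

/-- Probability that the primary receiver decodes a wrong message. -/
noncomputable def errP : ENNReal :=
  ccicLaw N Mp Mc {ω | c.decP (ch.yP c ω) ≠ CCICOutcome.wp ω}

/-- Probability that the cognitive receiver decodes a wrong message. -/
noncomputable def errC : ENNReal :=
  ccicLaw N Mp Mc {ω | c.decC (ch.yC c ω) ≠ CCICOutcome.wc ω}

/-- The number of messages, i.e. of integers in `[1 : 2 ^ (N R)]`. -/
noncomputable def numMessages (N : ℕ) (R : ℝ) : ℕ := ⌊(2 : ℝ) ^ ((N : ℝ) * R)⌋₊

/-- The pair of rates `R = (R_p, R_c)`, in bits per channel use, is achievable. -/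
def Achievable (R : ℝ × ℝ) : Prop :=
  0 ≤ R.1 ∧ 0 ≤ R.2 ∧
    ∃ code : (N : ℕ) → CCICCode N (numMessages N R.1) (numMessages N R.2),
      (∀ N, ch.PowerConstraint (code N)) ∧
      Tendsto (fun N => max (ch.errP (code N)) (ch.errC (code N))) atTop (𝓝 0)

/-- The capacity region: the convex closure of the achievable rate pairs. -/
def capacityRegion : Set (ℝ × ℝ) := closure (convexHull ℝ {R | ch.Achievable R})

end GCCIC

namespace SymOuter

/-- The non-cooperative sum-rate bound. -/
noncomputable def sumBound (S I : ℝ) : ℝ :=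
  Real.logb 2 (1 + S / (1 + I)) + Real.logb 2 (1 + (Real.sqrt S + Real.sqrt I) ^ 2)

/-- The second sum-rate bound. -/
noncomputable def sumBoundCoop (S I C : ℝ) : ℝ :=
  Real.logb 2 (1 + (S + C) / (1 + I)) + Real.logb 2 (1 + (Real.sqrt S + Real.sqrt I) ^ 2)

/-- The third sum-rate bound, without its additive constant. -/
noncomputable def sumBoundISD (S I C : ℝ) : ℝ :=
  Real.logb 2 (1 + C + I + S / (1 + I)) +
    Real.logb 2 (1 + I + S * ((1 + C) / (1 + C + I)))

/-- The cooperation-dependent term of the bound on `2 R_p + R_c`. -/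
noncomputable def deltaP (S I C : ℝ) : ℝ :=
  Real.logb 2 (1 + C / (1 + I + S)) + Real.logb 2 (1 + I + S * ((1 + C) / (1 + I + C)))

/-- The cooperation-dependent term of the bound on `R_p + 2 R_c`. -/
noncomputable def deltaC (S I C : ℝ) : ℝ :=
  Real.logb 2 (1 + C + I + S / (1 + I))

/-- The outer bound region for the symmetric channel. -/
noncomputable def region (S I C : ℝ) : Set (ℝ × ℝ) :=
  {R | R.1 ≤ Real.logb 2 (1 + C + S) ∧
    R.1 ≤ Real.logb 2 (1 + (Real.sqrt S + Real.sqrt I) ^ 2) ∧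
    R.2 ≤ Real.logb 2 (1 + S) ∧
    R.1 + R.2 ≤ sumBound S I ∧
    R.1 + R.2 ≤ sumBoundCoop S I C ∧
    R.1 + R.2 ≤ sumBoundISD S I C + 2 * Real.logb 2 2 ∧
    2 * R.1 + R.2 ≤ sumBound S I + deltaP S I C + Real.logb 2 2 ∧
    R.1 + 2 * R.2 ≤ sumBound S I + deltaC S I C + Real.logb 2 2}

end SymOuter

/-! The proof is a converse of genie-aided type, with every mutual information replaced by a
pointwise likelihood-ratio inequality, so that no differential entropy of an unknown law is ever
formed. For a decoder with `M` messages let `g` be `M` where it is right and `1` where it is wrong.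
Then `log g` has mean `(1 - err) log M`, while averaging `g` over the messages at a fixed output
gives at most `2`. If `p` is a conditional density of the signals and `q` a test density, `log x ≤ x
- 1` gives `log g ≤ g q / p - log q + log p` (`log_le_ratio`). Once the model density is averaged
over the other message and the auxiliary signals, `g q / p` leaves `g` times a density of the output
that does not depend on the decoded message; its mean is therefore at most `2` (`isTest_of_primary`,
`isTest_of_cognitive`). Hence `(1 - err) log M ≤ 2 + E[-log q] + E[log p]`, and the constant
disappears after division by the block length.

The other two terms are of two kinds. A Gaussian `q` costs at most `N log s + N (log π + 1)` as soon
as its argument has mean energy at most `N s` (`meanLe_neg_log_vgauss`), and a noise kernel `p`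
gives back `N (log π + 1)` (`meanLe_log_noise`). Mixture densities of unknown form (`mixC`, the
cognitive interference given the feedback; `condP`, the primary interference given the feedback;
`causalP`, its causally conditioned version) occur with one sign in a bound for one receiver and
with the other sign in a bound for the other receiver. The bounds are added in combinations where
these terms cancel pointwise. The remaining Gaussian arguments are errors of linear estimates of an
output from the side information, which produces the explicit logarithms.

Causality enters through `causalP_mul_causalF`: the joint density of feedback and primary
interference factors into two products of one-step predictions. Given the cognitive message and
output, the primary interference is a strictly causal function of the feedback, so the factor
`causalF` has total mass one along that trajectory (`lintegral_causalF`). Independence of present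
noise and inputs is used only through sign flips of single noise samples
(`lintegral_normSq_add_of_flip`). Finally, each linear bound on codes passes to the capacity region
because a half-plane is closed and convex (`capacityRegion_le`). -/

open scoped ENNReal

/-! ### Products of causal kernels -/

section Causal

variable {ι α : Type*} [LinearOrder ι] [MeasurableSpace α]
  {μ : Measure α} [SigmaFinite μ]

/-- Integrating a product of kernels, the `i`-th of which depends on the coordinates up to `i`
only, one coordinate after the other. -/
theorem lmarginal_prod_of_causal {k : ι → (ι → α) → ℝ≥0∞} {m : ι → ℝ≥0∞}
    (hk : ∀ i, Measurable (k i))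
    (hcausal : ∀ i j, i < j → ∀ t s, k i (Function.update t j s) = k i t)
    (hint : ∀ i t, ∫⁻ s, k i (Function.update t i s) ∂μ = m i) (S : Finset ι) (t : ι → α) :
    (∫⋯∫⁻_S, (fun t => ∏ i ∈ S, k i t) ∂fun _ => μ) t = ∏ i ∈ S, m i := by
  -- The largest index is integrated out first: no other kernel of the product sees that coordinate,
  -- so the inner integral touches `k a` alone and gives the constant `m a`.
  induction S using Finset.induction_on_max generalizing t with
  | empty => simp
  | insert a S hmax ih =>
    have ha : a ∉ S := fun h => lt_irrefl _ (hmax a h)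
    have hmeas : ∀ T : Finset ι, Measurable fun t : ι → α => ∏ i ∈ T, k i t :=
      fun T => Finset.measurable_prod _ fun i _ => hk i
    rw [lmarginal_insert' _ (hmeas _) ha]
    have : (fun x : ι → α => ∫⁻ s, ∏ i ∈ insert a S, k i (Function.update x a s) ∂μ)
        = fun x => m a * ∏ i ∈ S, k i x := by
      funext x
      have h1 : ∀ s, ∏ i ∈ insert a S, k i (Function.update x a s)
          = k a (Function.update x a s) * ∏ i ∈ S, k i x := by
        intro s
        rw [Finset.prod_insert ha]
        congr 1
        exact Finset.prod_congr rfl fun i hi => hcausal i a (hmax i hi) x s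
      simp_rw [h1]
      have h2 : Measurable fun s => k a (Function.update x a s) := (hk a).comp (measurable_update x)
      rw [lintegral_mul_const _ h2, hint]
    rw [this, Finset.prod_insert ha, ← ih t]
    simp only [lmarginal]
    have h3 : Measurable fun y : S → α => ∏ i ∈ S, k i (Function.updateFinset t S y) :=
      (hmeas S).comp measurable_updateFinset
    rw [lintegral_const_mul _ h3]

theorem lintegral_prod_of_causal [Fintype ι] [Nonempty α] {k : ι → (ι → α) → ℝ≥0∞} {m : ι → ℝ≥0∞}
    (hk : ∀ i, Measurable (k i))
    (hcausal : ∀ i j, i < j → ∀ t s, k i (Function.update t j s) = k i t)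
    (hint : ∀ i t, ∫⁻ s, k i (Function.update t i s) ∂μ = m i) :
    ∫⁻ t, ∏ i, k i t ∂Measure.pi (fun _ => μ) = ∏ i, m i := by
  obtain ⟨t⟩ : Nonempty (ι → α) := inferInstance
  rw [lintegral_eq_lmarginal_univ t]
  exact lmarginal_prod_of_causal hk hcausal hint Finset.univ t

theorem lintegral_pi_prod [Fintype ι] [Nonempty α] {f : ι → α → ℝ≥0∞} (hf : ∀ i, Measurable (f i)) :
    ∫⁻ t, ∏ i, f i (t i) ∂Measure.pi (fun _ : ι => μ) = ∏ i, ∫⁻ s, f i s ∂μ := by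
  refine lintegral_prod_of_causal (k := fun i t => f i (t i))
    (fun i => (hf i).comp (measurable_pi_apply i)) ?_ ?_
  · intro i j hij t s
    simp [Function.update_of_ne hij.ne]
  · intro i t
    simp

theorem pi_withDensity [Fintype ι] [Nonempty α] {f : α → ℝ≥0∞} (hf : Measurable f)
    [SigmaFinite (μ.withDensity f)] :
    Measure.pi (fun _ : ι => μ.withDensity f)
      = (Measure.pi fun _ : ι => μ).withDensity fun t => ∏ i, f (t i) := by
  refine (Measure.pi_eq fun s hs => ?_)
  rw [withDensity_apply _ (MeasurableSet.univ_pi hs),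
    ← lintegral_indicator (MeasurableSet.univ_pi hs)]
  have : ∀ t : ι → α, (Set.univ.pi s).indicator (fun t => ∏ i, f (t i)) t
      = ∏ i, (s i).indicator f (t i) := by
    intro t
    by_cases h : t ∈ Set.univ.pi s
    · rw [Set.indicator_of_mem h]
      exact Finset.prod_congr rfl fun i _ => (Set.indicator_of_mem (h i trivial) f).symm
    · rw [Set.indicator_of_notMem h]
      simp only [Set.mem_pi, Set.mem_univ, true_implies, not_forall] at h
      obtain ⟨i, hi⟩ := h
      exact (Finset.prod_eq_zero (Finset.mem_univ i) (Set.indicator_of_notMem hi f)).symm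
  simp_rw [this]
  rw [lintegral_pi_prod fun i => hf.indicator (hs i)]
  exact Finset.prod_congr rfl fun i _ => by
    rw [lintegral_indicator (hs i), withDensity_apply _ (hs i)]

end Causal

/-! ### Complex Gaussian densities -/

/-- Density of the circularly symmetric complex Gaussian law of variance `s`. -/
noncomputable def cgaussPDF (s : ℝ) (z : ℂ) : ℝ := (Real.pi * s)⁻¹ * Real.exp (-(‖z‖ ^ 2 / s))

theorem cgaussPDF_pos {s : ℝ} (hs : 0 < s) (z : ℂ) : 0 < cgaussPDF s z := by
  unfold cgaussPDF; positivity

@[fun_prop]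
theorem measurable_cgaussPDF (s : ℝ) : Measurable (cgaussPDF s) := by
  unfold cgaussPDF; fun_prop

theorem cgaussPDF_mk {s : ℝ} (hs : 0 < s) (x y : ℝ) :
    cgaussPDF s ⟨x, y⟩ = gaussianPDFReal 0 (s / 2).toNNReal x *
      gaussianPDFReal 0 (s / 2).toNNReal y := by
  have h2 : ((s / 2).toNNReal : ℝ) = s / 2 := Real.coe_toNNReal _ (by positivity)
  have hn : ‖(⟨x, y⟩ : ℂ)‖ ^ 2 = x ^ 2 + y ^ 2 := by
    rw [← Complex.normSq_eq_norm_sq, Complex.normSq_mk]; ring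
  have hp : 0 < Real.pi * s := by positivity
  have hr : 2 * Real.pi * (s / 2) = Real.pi * s := by ring
  simp only [cgaussPDF, gaussianPDFReal, h2, hn, hr, sub_zero]
  rw [mul_mul_mul_comm, ← Real.exp_add, ← mul_inv, Real.mul_self_sqrt hp.le]
  congr 2
  field_simp
  ring

theorem lintegral_complex {f : ℂ → ℝ≥0∞} (hf : Measurable f) :
    ∫⁻ z, f z = ∫⁻ x : ℝ, ∫⁻ y : ℝ, f ⟨x, y⟩ := by
  have h := (Complex.volume_preserving_equiv_real_prod.symm).lintegral_comp hf
  rw [← h, Measure.volume_eq_prod, lintegral_prod _ (by fun_prop)]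
  rfl

theorem lintegral_cgaussPDF {s : ℝ} (hs : 0 < s) :
    ∫⁻ z, ENNReal.ofReal (cgaussPDF s z) = 1 := by
  rw [lintegral_complex (by fun_prop)]
  have hv : (s / 2).toNNReal ≠ 0 := by simpa using hs
  simp_rw [cgaussPDF_mk hs, ENNReal.ofReal_mul (gaussianPDFReal_nonneg _ _ _)]
  have h1 := lintegral_gaussianPDFReal_eq_one 0 hv
  have h2 : ∀ x : ℝ, ∫⁻ y : ℝ, ENNReal.ofReal (gaussianPDFReal 0 (s / 2).toNNReal x) *
      ENNReal.ofReal (gaussianPDFReal 0 (s / 2).toNNReal y) =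
      ENNReal.ofReal (gaussianPDFReal 0 (s / 2).toNNReal x) := by
    intro x
    rw [lintegral_const_mul _ (by fun_prop), h1, mul_one]
  simp_rw [h2, h1]

theorem stdComplexGaussian_eq_withDensity :
    stdComplexGaussian = volume.withDensity fun z => ENNReal.ofReal (cgaussPDF 1 z) := by
  have hm : Measurable fun p : ℝ × ℝ => (⟨p.1, p.2⟩ : ℂ) :=
    Complex.measurableEquivRealProd.symm.measurable
  have hv : ((1 : ℝ) / 2).toNNReal = 1 / 2 := by
    rw [← NNReal.coe_inj, Real.coe_toNNReal _ (by positivity)]; norm_num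
  have hv0 : ((1 : NNReal) / 2) ≠ 0 := by norm_num
  ext A hA
  rw [stdComplexGaussian, Measure.map_apply hm hA, withDensity_apply _ hA,
    ← lintegral_indicator hA, lintegral_complex (Measurable.indicator (by fun_prop) hA),
    gaussianReal_of_var_ne_zero _ hv0, prod_withDensity (by fun_prop) (by fun_prop),
    withDensity_apply _ (hm hA), ← lintegral_indicator (hm hA),
    lintegral_prod _ (Measurable.aemeasurable (Measurable.indicator (by fun_prop) (hm hA)))]
  refine lintegral_congr fun x => lintegral_congr fun y => ?_
  by_cases h : (⟨x, y⟩ : ℂ) ∈ A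
  · rw [Set.indicator_of_mem (by exact h), Set.indicator_of_mem h, cgaussPDF_mk one_pos,
      ENNReal.ofReal_mul (gaussianPDFReal_nonneg _ _ _), hv]
    rfl
  · rw [Set.indicator_of_notMem (by exact h), Set.indicator_of_notMem h]

/-- Squared Euclidean norm of a complex vector. -/
noncomputable def energy {N : ℕ} (v : Fin N → ℂ) : ℝ := ∑ i, ‖v i‖ ^ 2

@[fun_prop]
theorem measurable_energy {N : ℕ} : Measurable (energy (N := N)) := by
  unfold energy; fun_prop

/-- Density of a vector of independent complex Gaussians of variance `s`. -/
noncomputable def vgauss {N : ℕ} (s : ℝ) (v : Fin N → ℂ) : ℝ := ∏ i, cgaussPDF s (v i)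

theorem vgauss_pos {N : ℕ} {s : ℝ} (hs : 0 < s) (v : Fin N → ℂ) : 0 < vgauss s v :=
  Finset.prod_pos fun _ _ => cgaussPDF_pos hs _

@[fun_prop]
theorem measurable_vgauss {N : ℕ} (s : ℝ) : Measurable (vgauss (N := N) s) := by
  unfold vgauss; fun_prop

theorem log_vgauss {N : ℕ} {s : ℝ} (hs : 0 < s) (v : Fin N → ℂ) :
    Real.log (vgauss s v) = -(N * (Real.log Real.pi + Real.log s)) - energy v / s := by
  have h : ∀ i, Real.log (cgaussPDF s (v i))
      = -(Real.log Real.pi + Real.log s) - ‖v i‖ ^ 2 / s := by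
    intro i
    rw [cgaussPDF, Real.log_mul (by positivity) (by positivity), Real.log_inv, Real.log_exp,
      Real.log_mul Real.pi_ne_zero hs.ne']
    ring
  rw [vgauss, Real.log_prod (fun _ _ => (cgaussPDF_pos hs _).ne')]
  simp_rw [h]
  rw [Finset.sum_sub_distrib, energy, Finset.sum_div]
  simp only [Finset.sum_const, Finset.card_univ, Fintype.card_fin, nsmul_eq_mul, mul_neg]

theorem ofReal_vgauss {N : ℕ} {s : ℝ} (hs : 0 < s) (v : Fin N → ℂ) :
    ENNReal.ofReal (vgauss s v) = ∏ i, ENNReal.ofReal (cgaussPDF s (v i)) :=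
  ENNReal.ofReal_prod_of_nonneg fun _ _ => (cgaussPDF_pos hs _).le

theorem lintegral_vgauss {N : ℕ} {s : ℝ} (hs : 0 < s) :
    ∫⁻ v : Fin N → ℂ, ENNReal.ofReal (vgauss s v) = 1 := by
  simp_rw [ofReal_vgauss hs]
  rw [volume_pi, lintegral_pi_prod (f := fun _ z => ENNReal.ofReal (cgaussPDF s z))
    (fun _ => by fun_prop)]
  simp [lintegral_cgaussPDF hs]

theorem lintegral_vgauss_sub {N : ℕ} {s : ℝ} (hs : 0 < s) (c : Fin N → ℂ) :
    ∫⁻ v : Fin N → ℂ, ENNReal.ofReal (vgauss s (v - c)) = 1 := by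
  rw [lintegral_sub_right_eq_self (fun v : Fin N → ℂ => ENNReal.ofReal (vgauss s v)) c,
    lintegral_vgauss hs]

theorem pi_stdComplexGaussian (N : ℕ) :
    (Measure.pi fun _ : Fin N => stdComplexGaussian)
      = volume.withDensity fun v => ENNReal.ofReal (vgauss 1 v) := by
  have : SigmaFinite (volume.withDensity fun z : ℂ => ENNReal.ofReal (cgaussPDF 1 z)) := by
    rw [← stdComplexGaussian_eq_withDensity]; infer_instance
  rw [stdComplexGaussian_eq_withDensity, pi_withDensity (by fun_prop)]
  simp_rw [ofReal_vgauss one_pos]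
  rfl

/-- The shift `c` is free. Choosing it to be the noiseless part of a signal turns an average over
noise into an integral against the density of the signal. -/
theorem lintegral_pi_stdComplexGaussian {N : ℕ} {f : (Fin N → ℂ) → ℝ≥0∞} (hf : Measurable f)
    (c : Fin N → ℂ) :
    ∫⁻ z, f z ∂(Measure.pi fun _ : Fin N => stdComplexGaussian)
      = ∫⁻ t, f (t - c) * ENNReal.ofReal (vgauss 1 (t - c)) := by
  rw [pi_stdComplexGaussian, lintegral_withDensity_eq_lintegral_mul _ (by fun_prop) hf,
    lintegral_sub_right_eq_self (fun z : Fin N → ℂ => f z * ENNReal.ofReal (vgauss 1 z)) c]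
  simp only [Pi.mul_apply, mul_comm]

/-! ### Iterated integrals -/

section Iterated

variable {α β γ : Type*} [MeasureSpace α] [MeasureSpace β] [MeasureSpace γ]
  [SFinite (volume : Measure β)] [SFinite (volume : Measure γ)]

theorem lintegral_triple {f : α × β × γ → ℝ≥0∞} (hf : Measurable f) :
    ∫⁻ p, f p = ∫⁻ a, ∫⁻ b, ∫⁻ c, f (a, b, c) := by
  rw [Measure.volume_eq_prod, lintegral_prod _ hf.aemeasurable]
  refine lintegral_congr fun a => ?_
  rw [Measure.volume_eq_prod, lintegral_prod _ (by fun_prop)]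

end Iterated

theorem lintegral_rotate {α β γ : Type*} [MeasurableSpace α] [MeasurableSpace β]
    [MeasurableSpace γ] {μ : Measure α} {ν : Measure β} {ρ : Measure γ} [SFinite μ] [SFinite ν]
    [SFinite ρ] {f : α → β → γ → ℝ≥0∞}
    (hf : Measurable fun p : α × β × γ => f p.1 p.2.1 p.2.2) :
    ∫⁻ a, ∫⁻ b, ∫⁻ c, f a b c ∂ρ ∂ν ∂μ = ∫⁻ c, ∫⁻ a, ∫⁻ b, f a b c ∂ν ∂μ ∂ρ := by
  have h1 : ∀ a, ∫⁻ b, ∫⁻ c, f a b c ∂ρ ∂ν = ∫⁻ c, ∫⁻ b, f a b c ∂ν ∂ρ := fun a =>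
    lintegral_lintegral_swap (f := fun b c => f a b c)
      (Measurable.aemeasurable (hf.comp (by fun_prop : Measurable fun q : β × γ => (a, q.1, q.2))))
  simp_rw [h1]
  refine lintegral_lintegral_swap (f := fun a c => ∫⁻ b, f a b c ∂ν) (Measurable.aemeasurable ?_)
  exact Measurable.lintegral_prod_right' (f := fun q : (α × γ) × β => f q.1.1 q.2 q.1.2)
    (hf.comp (by fun_prop : Measurable fun q : (α × γ) × β => (q.1.1, q.2, q.1.2)))

theorem lintegral_swap_inner {α β γ : Type*} [MeasurableSpace α] [MeasurableSpace β]
    [MeasurableSpace γ] {μ : Measure α} {ν : Measure β} {ρ : Measure γ} [SFinite μ] [SFinite ν]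
    [SFinite ρ] {f : α → β → γ → ℝ≥0∞}
    (hf : Measurable fun p : α × β × γ => f p.1 p.2.1 p.2.2) :
    ∫⁻ a, ∫⁻ b, ∫⁻ c, f a b c ∂ρ ∂ν ∂μ = ∫⁻ a, ∫⁻ c, ∫⁻ b, f a b c ∂ν ∂ρ ∂μ :=
  lintegral_congr fun a => lintegral_lintegral_swap (f := fun b c => f a b c)
    (Measurable.aemeasurable (hf.comp (by fun_prop : Measurable fun q : β × γ => (a, q.1, q.2))))

theorem lintegral_uniformOn_univ {M : ℕ} (f : Fin M → ℝ≥0∞) :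
    ∫⁻ w, f w ∂(uniformOn (Set.univ : Set (Fin M))) = (M : ℝ≥0∞)⁻¹ * ∑ w, f w := by
  rw [uniformOn, ProbabilityTheory.cond, Measure.restrict_univ, lintegral_smul_measure,
    lintegral_count,
    tsum_fintype]
  simp [Measure.count_apply_finite _ Set.finite_univ]

theorem measurable_of_outcome {N Mp Mc : ℕ} {β : Type*} [MeasurableSpace β]
    {f : CCICOutcome N Mp Mc → β}
    (hf : ∀ wp wc, Measurable fun z : (Fin N → ℂ) × (Fin N → ℂ) × (Fin N → ℂ) => f (wp, wc, z)) :
    Measurable f :=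
  measurable_from_prod_countable_right fun wp => measurable_from_prod_countable_right fun wc =>
    hf wp wc

theorem isProbabilityMeasure_ccicLaw {N Mp Mc : ℕ} (hMp : 0 < Mp) (hMc : 0 < Mc) :
    IsProbabilityMeasure (ccicLaw N Mp Mc) := by
  have : Nonempty (Fin Mp) := ⟨⟨0, hMp⟩⟩
  have : Nonempty (Fin Mc) := ⟨⟨0, hMc⟩⟩
  unfold ccicLaw; infer_instance

/-- The noise at the primary receiver is placed innermost and the feedback noise outermost, because
the cognitive interference is the primary receiver's noise shifted by a function of the feedback. -/
theorem lintegral_ccicLaw {N Mp Mc : ℕ} {f : CCICOutcome N Mp Mc → ℝ≥0∞} (hf : Measurable f) :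
    ∫⁻ ω, f ω ∂(ccicLaw N Mp Mc) = (Mp : ℝ≥0∞)⁻¹ * ∑ wp, (Mc : ℝ≥0∞)⁻¹ * ∑ wc,
      ∫⁻ zf, ∫⁻ zc, ∫⁻ zp, f (wp, wc, zp, zc, zf) ∂(Measure.pi fun _ => stdComplexGaussian)
        ∂(Measure.pi fun _ => stdComplexGaussian) ∂(Measure.pi fun _ => stdComplexGaussian) := by
  rw [ccicLaw, lintegral_prod _ hf.aemeasurable, lintegral_uniformOn_univ]
  congr 1
  refine Finset.sum_congr rfl fun wp _ => ?_
  rw [lintegral_prod _ (by fun_prop), lintegral_uniformOn_univ]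
  congr 1
  refine Finset.sum_congr rfl fun wc _ => ?_
  rw [lintegral_prod _ (by fun_prop)]
  rw [lintegral_congr fun zp => lintegral_prod _ (by fun_prop)]
  rw [lintegral_rotate (f := fun zp zc zf => f (wp, wc, zp, zc, zf)) (by fun_prop),
    lintegral_swap_inner (f := fun zf zp zc => f (wp, wc, zp, zc, zf)) (by fun_prop)]

/-! ### The channel seen through the interference and feedback signals -/

/-- Codewords, decoders and gains of a causal cognitive interference channel; `cog w t` is the
cognitive codeword for message `w` and feedback sequence `t`. -/
structure CausalModel (N Mp Mc : ℕ) where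
  prim : Fin Mp → Fin N → ℂ
  cog : Fin Mc → (Fin N → ℂ) → Fin N → ℂ
  measurable_cog : ∀ w, Measurable (cog w)
  causal_cog : ∀ w i j, i ≤ j → ∀ t z, cog w (Function.update t j z) i = cog w t i
  decP : (Fin N → ℂ) → Fin Mp
  measurable_decP : Measurable decP
  decC : (Fin N → ℂ) → Fin Mc
  measurable_decC : Measurable decC
  direct : ℂ
  crossP : ℂ
  crossC : ℂ
  feedback : ℂ

attribute [fun_prop] CausalModel.measurable_cog CausalModel.measurable_decP
  CausalModel.measurable_decC

/-- The weight `M` for a correct decision, and `1` for a wrong one. -/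
noncomputable def guessWeight {M : ℕ} {β : Type*} (d : β → Fin M) (w : Fin M) (y : β) : ℝ :=
  if d y = w then M else 1

section guessWeight

variable {M : ℕ} {β : Type*} (d : β → Fin M)

theorem guessWeight_pos (w : Fin M) (y : β) : 0 < guessWeight d w y := by
  unfold guessWeight
  split_ifs
  · exact_mod_cast w.pos
  · exact one_pos

@[fun_prop]
theorem measurable_guessWeight [MeasurableSpace β] {d : β → Fin M} (hd : Measurable d)
    (w : Fin M) : Measurable (guessWeight d w) :=
  Measurable.ite (hd (measurableSet_singleton w)) measurable_const measurable_const

/-- Only the decoded message has weight `M`; all the others together add at most `M`. -/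
theorem sum_guessWeight_le (y : β) : (M : ℝ)⁻¹ * ∑ w, guessWeight d w y ≤ 2 := by
  have hM : (0 : ℝ) < M := by exact_mod_cast (d y).pos
  have h : ∑ w, guessWeight d w y ≤ ∑ w : Fin M, ((if d y = w then (M : ℝ) else 0) + 1) := by
    refine Finset.sum_le_sum fun w _ => ?_
    unfold guessWeight
    split_ifs <;> simp
  rw [inv_mul_le_iff₀ hM]
  refine h.trans ?_
  rw [Finset.sum_add_distrib, Finset.sum_ite_eq]
  simp
  linarith

theorem sum_ofReal_guessWeight_le (y : β) :
    (M : ℝ≥0∞)⁻¹ * ∑ w, ENNReal.ofReal (guessWeight d w y) ≤ 2 := by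
  have hM : (0 : ℝ) < M := by exact_mod_cast (d y).pos
  rw [← ENNReal.ofReal_sum_of_nonneg fun w _ => (guessWeight_pos d w y).le,
    ← ENNReal.ofReal_natCast, ← ENNReal.ofReal_inv_of_pos hM,
    ← ENNReal.ofReal_mul (by positivity)]
  simpa using ENNReal.ofReal_le_ofReal (sum_guessWeight_le d y)

theorem log_guessWeight (w : Fin M) (y : β) :
    Real.log (guessWeight d w y) = if d y = w then Real.log M else 0 := by
  unfold guessWeight; split_ifs <;> simp

end guessWeight

/-- Real functions of the two messages, the feedback, and the two interference signals. -/
abbrev Signals (N Mp Mc : ℕ) : Type :=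
  Fin Mp → Fin Mc → (Fin N → ℂ) → (Fin N → ℂ) → (Fin N → ℂ) → ℝ

/-- Joint measurability in the signals. -/
def Signals.Meas {N Mp Mc : ℕ} (F : Signals N Mp Mc) : Prop :=
  ∀ wp wc, Measurable fun p : (Fin N → ℂ) × (Fin N → ℂ) × (Fin N → ℂ) => F wp wc p.1 p.2.1 p.2.2

/-- Pointwise nonnegativity. -/
def Signals.Nonneg {N Mp Mc : ℕ} (F : Signals N Mp Mc) : Prop :=
  ∀ wp wc tf tp tc, 0 ≤ F wp wc tf tp tc

namespace CausalModel

variable {N Mp Mc : ℕ} (m : CausalModel N Mp Mc)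

/-- Joint density of the feedback `tf`, the interference `tp` of the primary user and the
interference `tc` of the cognitive user, given the messages. -/
noncomputable def dens (wp : Fin Mp) (wc : Fin Mc) (tf tp tc : Fin N → ℂ) : ℝ :=
  vgauss 1 (tf - m.feedback • m.prim wp) * vgauss 1 (tp - m.crossP • m.prim wp) *
    vgauss 1 (tc - m.crossC • m.cog wc tf)

theorem dens_pos (wp : Fin Mp) (wc : Fin Mc) (tf tp tc : Fin N → ℂ) :
    0 < m.dens wp wc tf tp tc :=
  mul_pos (mul_pos (vgauss_pos one_pos _) (vgauss_pos one_pos _)) (vgauss_pos one_pos _)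

/-- The average of `F` over messages and signals. -/
noncomputable def mean (F : Signals N Mp Mc) : ℝ≥0∞ :=
  (Mp : ℝ≥0∞)⁻¹ * ∑ wp, (Mc : ℝ≥0∞)⁻¹ * ∑ wc,
    ∫⁻ p : (Fin N → ℂ) × (Fin N → ℂ) × (Fin N → ℂ),
      ENNReal.ofReal (F wp wc p.1 p.2.1 p.2.2 * m.dens wp wc p.1 p.2.1 p.2.2)

/-- Output of the primary receiver. -/
noncomputable def outP (wp : Fin Mp) (tc : Fin N → ℂ) : Fin N → ℂ := m.direct • m.prim wp + tc

/-- Output of the cognitive receiver. -/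
noncomputable def outC (wc : Fin Mc) (tf tp : Fin N → ℂ) : Fin N → ℂ :=
  tp + m.direct • m.cog wc tf

@[fun_prop]
theorem measurable_dens (wp : Fin Mp) (wc : Fin Mc) :
    Measurable fun p : (Fin N → ℂ) × (Fin N → ℂ) × (Fin N → ℂ) =>
      m.dens wp wc p.1 p.2.1 p.2.2 := by
  have := m.measurable_cog wc
  unfold dens; fun_prop

theorem avg_cog_lintegral {F : Signals N Mp Mc}
    (hF : F.Meas) (hF0 : F.Nonneg) (wp : Fin Mp) (hMc : 0 < Mc) :
    (Mc : ℝ≥0∞)⁻¹ * ∑ wc, ∫⁻ p : (Fin N → ℂ) × (Fin N → ℂ) × (Fin N → ℂ),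
      ENNReal.ofReal (F wp wc p.1 p.2.1 p.2.2 * m.dens wp wc p.1 p.2.1 p.2.2) =
    ∫⁻ p : (Fin N → ℂ) × (Fin N → ℂ) × (Fin N → ℂ), ENNReal.ofReal ((Mc : ℝ)⁻¹ * ∑ wc,
      F wp wc p.1 p.2.1 p.2.2 * m.dens wp wc p.1 p.2.1 p.2.2) := by
  have hM : (0 : ℝ) < Mc := by exact_mod_cast hMc
  rw [← lintegral_finsetSum _ fun wc _ => by have := hF wp wc; fun_prop,
    ← lintegral_const_mul _ (Finset.measurable_sum _ fun wc _ => by have := hF wp wc; fun_prop)]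
  refine lintegral_congr fun p => ?_
  rw [ENNReal.ofReal_mul (by positivity), ENNReal.ofReal_inv_of_pos hM, ENNReal.ofReal_natCast,
    ENNReal.ofReal_sum_of_nonneg fun wc _ => mul_nonneg (hF0 _ _ _ _ _) (m.dens_pos _ _ _ _ _).le]

theorem avg_prim_lintegral {F : Signals N Mp Mc}
    (hF : F.Meas) (hF0 : F.Nonneg) (wc : Fin Mc) (hMp : 0 < Mp) :
    (Mp : ℝ≥0∞)⁻¹ * ∑ wp, ∫⁻ p : (Fin N → ℂ) × (Fin N → ℂ) × (Fin N → ℂ),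
      ENNReal.ofReal (F wp wc p.1 p.2.1 p.2.2 * m.dens wp wc p.1 p.2.1 p.2.2) =
    ∫⁻ p : (Fin N → ℂ) × (Fin N → ℂ) × (Fin N → ℂ), ENNReal.ofReal ((Mp : ℝ)⁻¹ * ∑ wp,
      F wp wc p.1 p.2.1 p.2.2 * m.dens wp wc p.1 p.2.1 p.2.2) := by
  have hM : (0 : ℝ) < Mp := by exact_mod_cast hMp
  rw [← lintegral_finsetSum _ fun wp _ => by have := hF wp wc; fun_prop,
    ← lintegral_const_mul _ (Finset.measurable_sum _ fun wp _ => by have := hF wp wc; fun_prop)]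
  refine lintegral_congr fun p => ?_
  rw [ENNReal.ofReal_mul (by positivity), ENNReal.ofReal_inv_of_pos hM, ENNReal.ofReal_natCast,
    ENNReal.ofReal_sum_of_nonneg fun wp _ => mul_nonneg (hF0 _ _ _ _ _) (m.dens_pos _ _ _ _ _).le]

/-- Since `j` does not depend on the message, the sum over messages falls on the weights alone and
is bounded at each output before integrating. -/
theorem avg_guessWeight_lintegral_le {M : ℕ} {d : (Fin N → ℂ) → Fin M} (hd : Measurable d)
    {j : (Fin N → ℂ) → ℝ≥0∞} (hj : Measurable j) (hj1 : ∫⁻ y, j y ≤ 1) :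
    (M : ℝ≥0∞)⁻¹ * ∑ w, ∫⁻ y, ENNReal.ofReal (guessWeight d w y) * j y ≤ 2 := by
  rw [← lintegral_finsetSum _ fun w _ => by fun_prop,
    ← lintegral_const_mul _ (Finset.measurable_sum _ fun w _ => by fun_prop)]
  calc _ ≤ ∫⁻ y, 2 * j y := by
        refine lintegral_mono fun y => ?_
        rw [← Finset.sum_mul, ← mul_assoc]
        gcongr
        exact sum_ofReal_guessWeight_le d y
    _ ≤ 2 := by
        rw [lintegral_const_mul _ hj]
        simpa using mul_le_mul_right hj1 2

/-- A nonnegative measurable function of mean at most `2`. -/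
def IsTest (F : Signals N Mp Mc) : Prop := F.Meas ∧ F.Nonneg ∧ m.mean F ≤ 2

/-- The change-of-measure bound for the decoder of the primary receiver. -/
theorem isTest_of_primary {F : Signals N Mp Mc} (hF : F.Meas) (hF0 : F.Nonneg)
    (hMc : 0 < Mc) {J : Fin Mp → (Fin N → ℂ) → (Fin N → ℂ) → (Fin N → ℂ) → ℝ}
    (hJ : ∀ wp, Measurable fun p : (Fin N → ℂ) × (Fin N → ℂ) × (Fin N → ℂ) =>
      J wp p.1 p.2.1 p.2.2)
    (hFJ : ∀ wp tf tp tc, (Mc : ℝ)⁻¹ * ∑ wc, F wp wc tf tp tc * m.dens wp wc tf tp tc ≤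
      guessWeight m.decP wp (m.outP wp tc) * J wp (m.outP wp tc) tf tp)
    {j : (Fin N → ℂ) → ℝ≥0∞} (hj : Measurable j)
    (hJj : ∀ wp y, ∫⁻ tf, ∫⁻ tp, ENNReal.ofReal (J wp y tf tp) ≤ j y) (hj1 : ∫⁻ y, j y ≤ 1) :
    m.IsTest F := by
  refine ⟨hF, hF0, le_trans ?_ (avg_guessWeight_lintegral_le m.measurable_decP hj hj1)⟩
  rw [mean]
  gcongr with wp _
  rw [avg_cog_lintegral m hF hF0 wp hMc]
  have hJw := hJ wp
  have hout : Measurable (m.outP wp) := by unfold outP; fun_prop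
  have hd := m.measurable_decP
  have hgJ : Measurable fun p : (Fin N → ℂ) × (Fin N → ℂ) × (Fin N → ℂ) =>
      ENNReal.ofReal (guessWeight m.decP wp p.2.2 * J wp p.2.2 p.1 p.2.1) := by
    have := hJw.comp (by fun_prop :
      Measurable fun p : (Fin N → ℂ) × (Fin N → ℂ) × (Fin N → ℂ) => (p.2.2, p.1, p.2.1))
    simp only [Function.comp_def] at this
    fun_prop
  calc _ ≤ ∫⁻ p : (Fin N → ℂ) × (Fin N → ℂ) × (Fin N → ℂ),
        ENNReal.ofReal (guessWeight m.decP wp (m.outP wp p.2.2) *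
          J wp (m.outP wp p.2.2) p.1 p.2.1) :=
        lintegral_mono fun p => ENNReal.ofReal_le_ofReal (hFJ wp _ _ _)
    _ = ∫⁻ tf, ∫⁻ tp, ∫⁻ tc, ENNReal.ofReal (guessWeight m.decP wp (m.outP wp tc) *
          J wp (m.outP wp tc) tf tp) :=
        lintegral_triple (hgJ.comp (by fun_prop :
          Measurable fun p : (Fin N → ℂ) × (Fin N → ℂ) × (Fin N → ℂ) =>
            (p.1, p.2.1, m.outP wp p.2.2)))
    -- For a fixed primary message the output is a translate of `tc`.
    _ = ∫⁻ tf, ∫⁻ tp, ∫⁻ y, ENNReal.ofReal (guessWeight m.decP wp y * J wp y tf tp) :=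
        lintegral_congr fun tf => lintegral_congr fun tp =>
          lintegral_add_left_eq_self (fun y => ENNReal.ofReal (guessWeight m.decP wp y *
            J wp y tf tp)) (m.direct • m.prim wp)
    _ = ∫⁻ y, ∫⁻ tf, ∫⁻ tp, ENNReal.ofReal (guessWeight m.decP wp y * J wp y tf tp) :=
        lintegral_rotate (f := fun tf tp y => ENNReal.ofReal (guessWeight m.decP wp y *
            J wp y tf tp)) hgJ
    _ ≤ _ := by
        refine lintegral_mono fun y => ?_
        simp_rw [ENNReal.ofReal_mul (guessWeight_pos m.decP wp y).le]
        have h1 : ∀ tf, Measurable fun tp => ENNReal.ofReal (J wp y tf tp) := fun tf => by fun_prop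
        simp_rw [lintegral_const_mul _ (h1 _)]
        rw [lintegral_const_mul' _ _ ENNReal.ofReal_ne_top]
        gcongr
        exact hJj wp y

/-- The change-of-measure bound for the decoder of the cognitive receiver. -/
theorem isTest_of_cognitive {F : Signals N Mp Mc} (hF : F.Meas) (hF0 : F.Nonneg)
    (hMp : 0 < Mp) {J : Fin Mc → (Fin N → ℂ) → (Fin N → ℂ) → (Fin N → ℂ) → ℝ}
    (hJ : ∀ wc, Measurable fun p : (Fin N → ℂ) × (Fin N → ℂ) × (Fin N → ℂ) =>
      J wc p.1 p.2.1 p.2.2)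
    (hFJ : ∀ wc tf tp tc, (Mp : ℝ)⁻¹ * ∑ wp, F wp wc tf tp tc * m.dens wp wc tf tp tc ≤
      guessWeight m.decC wc (m.outC wc tf tp) * J wc (m.outC wc tf tp) tf tc)
    {j : (Fin N → ℂ) → ℝ≥0∞} (hj : Measurable j)
    (hJj : ∀ wc y, ∫⁻ tf, ∫⁻ tc, ENNReal.ofReal (J wc y tf tc) ≤ j y) (hj1 : ∫⁻ y, j y ≤ 1) :
    m.IsTest F := by
  refine ⟨hF, hF0, le_trans ?_ (avg_guessWeight_lintegral_le m.measurable_decC hj hj1)⟩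
  have hswap : m.mean F = (Mc : ℝ≥0∞)⁻¹ * ∑ wc, (Mp : ℝ≥0∞)⁻¹ * ∑ wp,
      ∫⁻ p : (Fin N → ℂ) × (Fin N → ℂ) × (Fin N → ℂ),
        ENNReal.ofReal (F wp wc p.1 p.2.1 p.2.2 * m.dens wp wc p.1 p.2.1 p.2.2) := by
    simp_rw [mean, ← Finset.mul_sum]
    rw [Finset.sum_comm, ← mul_assoc, ← mul_assoc, mul_comm (Mp : ℝ≥0∞)⁻¹]
  rw [hswap]
  gcongr with wc _
  rw [avg_prim_lintegral m hF hF0 wc hMp]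
  have hJw := hJ wc
  have hcog := m.measurable_cog wc
  have hd := m.measurable_decC
  have hgJ : Measurable fun p : (Fin N → ℂ) × (Fin N → ℂ) × (Fin N → ℂ) =>
      ENNReal.ofReal (guessWeight m.decC wc p.2.2 * J wc p.2.2 p.1 p.2.1) := by
    have := hJw.comp (by fun_prop :
      Measurable fun p : (Fin N → ℂ) × (Fin N → ℂ) × (Fin N → ℂ) => (p.2.2, p.1, p.2.1))
    simp only [Function.comp_def] at this
    fun_prop
  have hgJ' : Measurable fun p : (Fin N → ℂ) × (Fin N → ℂ) × (Fin N → ℂ) =>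
      ENNReal.ofReal (guessWeight m.decC wc (m.outC wc p.1 p.2.1) *
          J wc (m.outC wc p.1 p.2.1) p.1 p.2.2) :=
    hgJ.comp (by unfold outC; fun_prop :
      Measurable fun p : (Fin N → ℂ) × (Fin N → ℂ) × (Fin N → ℂ) =>
            (p.1, p.2.2, m.outC wc p.1 p.2.1))
  calc _ ≤ ∫⁻ p : (Fin N → ℂ) × (Fin N → ℂ) × (Fin N → ℂ),
        ENNReal.ofReal (guessWeight m.decC wc (m.outC wc p.1 p.2.1) *
          J wc (m.outC wc p.1 p.2.1) p.1 p.2.2) :=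
        lintegral_mono fun p => ENNReal.ofReal_le_ofReal (hFJ wc _ _ _)
    _ = ∫⁻ tf, ∫⁻ tp, ∫⁻ tc, ENNReal.ofReal (guessWeight m.decC wc (m.outC wc tf tp) *
          J wc (m.outC wc tf tp) tf tc) := lintegral_triple hgJ'
    -- The output is `tp` translated by a vector depending on `tf`, so `tp` has to be the innermost
    -- variable before translation invariance can be used.
    _ = ∫⁻ tf, ∫⁻ tc, ∫⁻ tp, ENNReal.ofReal (guessWeight m.decC wc (m.outC wc tf tp) *
          J wc (m.outC wc tf tp) tf tc) :=
        lintegral_swap_inner (f := fun tf tp tc => ENNReal.ofReal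
          (guessWeight m.decC wc (m.outC wc tf tp) * J wc (m.outC wc tf tp) tf tc)) hgJ'
    _ = ∫⁻ tf, ∫⁻ tc, ∫⁻ y, ENNReal.ofReal (guessWeight m.decC wc y * J wc y tf tc) :=
        lintegral_congr fun tf => lintegral_congr fun tc =>
          lintegral_add_right_eq_self (fun y => ENNReal.ofReal (guessWeight m.decC wc y *
            J wc y tf tc)) (m.direct • m.cog wc tf)
    _ = ∫⁻ y, ∫⁻ tf, ∫⁻ tc, ENNReal.ofReal (guessWeight m.decC wc y * J wc y tf tc) :=
        lintegral_rotate (f := fun tf tc y => ENNReal.ofReal (guessWeight m.decC wc y *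
            J wc y tf tc)) hgJ
    _ ≤ _ := by
        refine lintegral_mono fun y => ?_
        simp_rw [ENNReal.ofReal_mul (guessWeight_pos m.decC wc y).le]
        have h1 : ∀ tf, Measurable fun tc => ENNReal.ofReal (J wc y tf tc) := fun tf => by fun_prop
        simp_rw [lintegral_const_mul _ (h1 _)]
        rw [lintegral_const_mul' _ _ ENNReal.ofReal_ne_top]
        gcongr
        exact hJj wc y

end CausalModel

/-! ### Second moments -/

/-- The flip gives `A + Z` and `A - Z` the same second moment, and the parallelogram law does the
rest. This replaces an orthogonality argument and needs no integrability. -/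
theorem lintegral_normSq_add_of_flip {Ω : Type*} [MeasurableSpace Ω] {μ : Measure Ω} {T : Ω → Ω}
    (hT : MeasurePreserving T μ μ) {A Z : Ω → ℂ} (hA : Measurable A) (hZ : Measurable Z)
    (hAT : ∀ ω, A (T ω) = A ω) (hZT : ∀ ω, Z (T ω) = -Z ω) :
    ∫⁻ ω, ENNReal.ofReal (‖A ω + Z ω‖ ^ 2) ∂μ =
      ∫⁻ ω, ENNReal.ofReal (‖A ω‖ ^ 2) ∂μ + ∫⁻ ω, ENNReal.ofReal (‖Z ω‖ ^ 2) ∂μ := by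
  have h1 : ∫⁻ ω, ENNReal.ofReal (‖A ω - Z ω‖ ^ 2) ∂μ
      = ∫⁻ ω, ENNReal.ofReal (‖A ω + Z ω‖ ^ 2) ∂μ := by
    rw [← hT.lintegral_comp (by fun_prop)]
    simp_rw [hAT, hZT, sub_neg_eq_add]
  have h2 : ∀ ω, ENNReal.ofReal (‖A ω + Z ω‖ ^ 2) + ENNReal.ofReal (‖A ω - Z ω‖ ^ 2)
      = 2 * (ENNReal.ofReal (‖A ω‖ ^ 2) + ENNReal.ofReal (‖Z ω‖ ^ 2)) := by
    intro ω
    rw [← ENNReal.ofReal_add (by positivity) (by positivity),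
      ← ENNReal.ofReal_add (by positivity) (by positivity), ← ENNReal.ofReal_ofNat,
      ← ENNReal.ofReal_mul (by positivity)]
    congr 1
    have := parallelogram_law_with_norm ℝ (A ω) (Z ω)
    nlinarith
  have h3 : 2 * ∫⁻ ω, ENNReal.ofReal (‖A ω + Z ω‖ ^ 2) ∂μ =
      2 * (∫⁻ ω, ENNReal.ofReal (‖A ω‖ ^ 2) ∂μ + ∫⁻ ω, ENNReal.ofReal (‖Z ω‖ ^ 2) ∂μ) := by
    rw [← lintegral_add_left (by fun_prop),
      ← lintegral_const_mul (f := fun ω => ENNReal.ofReal (‖A ω‖ ^ 2) + ENNReal.ofReal (‖Z ω‖ ^ 2))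
        _ (by fun_prop), two_mul]
    nth_rewrite 2 [← h1]
    rw [← lintegral_add_left (by fun_prop)]
    exact lintegral_congr h2
  exact (ENNReal.mul_right_inj (by norm_num) (by norm_num)).1 h3

theorem lintegral_sq_gaussianReal (v : NNReal) :
    ∫⁻ x, ENNReal.ofReal (x ^ 2) ∂(gaussianReal 0 v) = v := by
  have h := (memLp_id_gaussianReal (μ := 0) (v := v) 2).integrable_sq
  have hv : ∫ x, x ^ 2 ∂(gaussianReal 0 v) = v := by
    have h1 := variance_id_gaussianReal (μ := 0) (v := v)
    rw [variance_eq_integral (by fun_prop)] at h1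
    simpa using h1
  simp only [id] at h
  rw [← ofReal_integral_eq_lintegral_ofReal h (ae_of_all _ fun x => sq_nonneg x), hv]
  simp

theorem lintegral_normSq_stdComplexGaussian :
    ∫⁻ z, ENNReal.ofReal (‖z‖ ^ 2) ∂stdComplexGaussian = 1 := by
  have hm : Measurable fun p : ℝ × ℝ => (⟨p.1, p.2⟩ : ℂ) :=
    Complex.measurableEquivRealProd.symm.measurable
  have hn : ∀ p : ℝ × ℝ, ENNReal.ofReal (‖(⟨p.1, p.2⟩ : ℂ)‖ ^ 2)
      = ENNReal.ofReal (p.1 ^ 2) + ENNReal.ofReal (p.2 ^ 2) := fun p => by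
    rw [← Complex.normSq_eq_norm_sq, Complex.normSq_mk,
      ← ENNReal.ofReal_add (by positivity) (by positivity), sq, sq]
  rw [stdComplexGaussian, lintegral_map (by fun_prop) hm]
  simp_rw [hn]
  rw [lintegral_add_left (by fun_prop),
    measurePreserving_fst.lintegral_comp (f := fun x : ℝ => ENNReal.ofReal (x ^ 2)) (by fun_prop),
    measurePreserving_snd.lintegral_comp (f := fun x : ℝ => ENNReal.ofReal (x ^ 2)) (by fun_prop),
    lintegral_sq_gaussianReal]
  rw [← ENNReal.coe_add, add_halves, ENNReal.coe_one]

theorem measurePreserving_neg_stdComplexGaussian :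
    MeasurePreserving (fun z : ℂ => -z) stdComplexGaussian stdComplexGaussian := by
  refine ⟨measurable_neg, ?_⟩
  ext A hA
  rw [Measure.map_apply measurable_neg hA, stdComplexGaussian_eq_withDensity,
    withDensity_apply _ (measurable_neg hA), withDensity_apply _ hA,
    ← lintegral_indicator (measurable_neg hA), ← lintegral_indicator hA,
    ← lintegral_neg_eq_self (μ := (volume : Measure ℂ))]
  refine lintegral_congr fun z => ?_
  by_cases h : z ∈ A
  · rw [Set.indicator_of_mem (by simpa using h), Set.indicator_of_mem h, cgaussPDF, cgaussPDF,
      norm_neg]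
  · rw [Set.indicator_of_notMem (by simpa using h), Set.indicator_of_notMem h]

/-- Change of the sign of one coordinate. -/
def negCoord {N : ℕ} (i : Fin N) (z : Fin N → ℂ) : Fin N → ℂ :=
  fun j => (if j = i then fun s => -s else id) (z j)

theorem negCoord_self {N : ℕ} (i : Fin N) (z : Fin N → ℂ) : negCoord i z i = -z i := by
  simp [negCoord]

theorem negCoord_of_ne {N : ℕ} {i j : Fin N} (h : j ≠ i) (z : Fin N → ℂ) :
    negCoord i z j = z j := by
  simp [negCoord, h]

theorem measurePreserving_negCoord {N : ℕ} (i : Fin N) :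
    MeasurePreserving (negCoord i) (Measure.pi fun _ : Fin N => stdComplexGaussian)
      (Measure.pi fun _ : Fin N => stdComplexGaussian) := by
  refine measurePreserving_pi (fun _ => stdComplexGaussian) (fun _ => stdComplexGaussian)
    (f := fun j => if j = i then fun s => -s else id) fun j => ?_
  split_ifs
  · exact measurePreserving_neg_stdComplexGaussian
  · exact MeasurePreserving.id _

/-! ### Sign flips of single noise samples -/

namespace CCICOutcome

variable {N Mp Mc : ℕ}

/-- Change of the sign of one noise sample at the primary receiver. -/
def negZp (i : Fin N) (ω : CCICOutcome N Mp Mc) : CCICOutcome N Mp Mc :=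
  (ω.1, ω.2.1, negCoord i ω.2.2.1, ω.2.2.2)

/-- Change of the sign of one noise sample at the cognitive receiver. -/
def negZc (i : Fin N) (ω : CCICOutcome N Mp Mc) : CCICOutcome N Mp Mc :=
  (ω.1, ω.2.1, ω.2.2.1, negCoord i ω.2.2.2.1, ω.2.2.2.2)

/-- Change of the sign of one noise sample at the cognitive transmitter. -/
def negZf (i : Fin N) (ω : CCICOutcome N Mp Mc) : CCICOutcome N Mp Mc :=
  (ω.1, ω.2.1, ω.2.2.1, ω.2.2.2.1, negCoord i ω.2.2.2.2)

theorem measurePreserving_negZp (i : Fin N) :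
    MeasurePreserving (negZp i) (ccicLaw N Mp Mc) (ccicLaw N Mp Mc) :=
  (MeasurePreserving.id _).prod ((MeasurePreserving.id _).prod
    ((measurePreserving_negCoord i).prod (MeasurePreserving.id _)))

theorem measurePreserving_negZc (i : Fin N) :
    MeasurePreserving (negZc i) (ccicLaw N Mp Mc) (ccicLaw N Mp Mc) :=
  (MeasurePreserving.id _).prod ((MeasurePreserving.id _).prod
    ((MeasurePreserving.id _).prod ((measurePreserving_negCoord i).prod (MeasurePreserving.id _))))

theorem measurePreserving_negZf (i : Fin N) :
    MeasurePreserving (negZf i) (ccicLaw N Mp Mc) (ccicLaw N Mp Mc) :=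
  (MeasurePreserving.id _).prod ((MeasurePreserving.id _).prod
    ((MeasurePreserving.id _).prod ((MeasurePreserving.id _).prod (measurePreserving_negCoord i))))

@[fun_prop]
theorem measurable_zp : Measurable (zp (N := N) (Mp := Mp) (Mc := Mc)) := by unfold zp; fun_prop

@[fun_prop]
theorem measurable_zc : Measurable (zc (N := N) (Mp := Mp) (Mc := Mc)) := by unfold zc; fun_prop

@[fun_prop]
theorem measurable_zf : Measurable (zf (N := N) (Mp := Mp) (Mc := Mc)) := by unfold zf; fun_prop

theorem lintegral_eval (i : Fin N) :
    ∫⁻ z, ENNReal.ofReal (‖z i‖ ^ 2) ∂(Measure.pi fun _ : Fin N => stdComplexGaussian) = 1 := by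
  rw [(measurePreserving_eval (fun _ : Fin N => stdComplexGaussian) i).lintegral_comp
    (f := fun z => ENNReal.ofReal (‖z‖ ^ 2)) (by fun_prop), lintegral_normSq_stdComplexGaussian]

theorem lintegral_normSq_zp (hMp : 0 < Mp) (hMc : 0 < Mc) (i : Fin N) :
    ∫⁻ ω, ENNReal.ofReal (‖zp ω i‖ ^ 2) ∂(ccicLaw N Mp Mc) = 1 := by
  have : Nonempty (Fin Mp) := ⟨⟨0, hMp⟩⟩
  have : Nonempty (Fin Mc) := ⟨⟨0, hMc⟩⟩
  have h : MeasurePreserving zp (ccicLaw N Mp Mc) (Measure.pi fun _ => stdComplexGaussian) :=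
    measurePreserving_fst.comp (measurePreserving_snd.comp measurePreserving_snd)
  rw [h.lintegral_comp (f := fun z => ENNReal.ofReal (‖z i‖ ^ 2)) (by fun_prop), lintegral_eval]

theorem lintegral_normSq_zc (hMp : 0 < Mp) (hMc : 0 < Mc) (i : Fin N) :
    ∫⁻ ω, ENNReal.ofReal (‖zc ω i‖ ^ 2) ∂(ccicLaw N Mp Mc) = 1 := by
  have : Nonempty (Fin Mp) := ⟨⟨0, hMp⟩⟩
  have : Nonempty (Fin Mc) := ⟨⟨0, hMc⟩⟩
  have h : MeasurePreserving zc (ccicLaw N Mp Mc) (Measure.pi fun _ => stdComplexGaussian) :=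
    measurePreserving_fst.comp (measurePreserving_snd.comp
      (measurePreserving_snd.comp measurePreserving_snd))
  rw [h.lintegral_comp (f := fun z => ENNReal.ofReal (‖z i‖ ^ 2)) (by fun_prop), lintegral_eval]

theorem lintegral_normSq_zf (hMp : 0 < Mp) (hMc : 0 < Mc) (i : Fin N) :
    ∫⁻ ω, ENNReal.ofReal (‖zf ω i‖ ^ 2) ∂(ccicLaw N Mp Mc) = 1 := by
  have : Nonempty (Fin Mp) := ⟨⟨0, hMp⟩⟩
  have : Nonempty (Fin Mc) := ⟨⟨0, hMc⟩⟩
  have h : MeasurePreserving zf (ccicLaw N Mp Mc) (Measure.pi fun _ => stdComplexGaussian) :=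
    measurePreserving_snd.comp (measurePreserving_snd.comp
      (measurePreserving_snd.comp measurePreserving_snd))
  rw [h.lintegral_comp (f := fun z => ENNReal.ofReal (‖z i‖ ^ 2)) (by fun_prop), lintegral_eval]

end CCICOutcome

/-! ### Energy of linear combinations of inputs and noises -/

namespace GCCIC

open CCICOutcome

variable (ch : GCCIC) {N Mp Mc : ℕ} (c : CCICCode N Mp Mc)

theorem measurable_xP (i : Fin N) : Measurable fun ω : CCICOutcome N Mp Mc => xP c ω i :=
  (measurable_of_countable fun w => c.encP i w).comp measurable_fst

theorem measurable_xC (i : Fin N) : Measurable fun ω : CCICOutcome N Mp Mc => ch.xC c ω i := by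
  refine measurable_of_outcome fun wp wc => (c.measurable_encC i wc).comp ?_
  refine measurable_pi_lambda _ fun j => ?_
  simp only [tF, xP, CCICOutcome.wp, CCICOutcome.zf]
  fun_prop

/-- A linear combination of the two inputs and the three noises. -/
noncomputable def combo (k h a b d : ℂ) (ω : CCICOutcome N Mp Mc) (i : Fin N) : ℂ :=
  k * xP c ω i + h * ch.xC c ω i + a * zp ω i + b * zc ω i + d * zf ω i

theorem measurable_combo (k h a b d : ℂ) : Measurable (ch.combo c k h a b d) := by
  refine measurable_pi_lambda _ fun i => ?_
  have h1 := measurable_xP c i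
  have h2 := ch.measurable_xC c i
  unfold combo
  fun_prop

variable {c}

/-- Cauchy–Schwarz with weights `‖k‖` and `‖h‖`. The two inputs may be correlated through the
feedback, so the cross term must be kept; with these weights, unit powers give exactly `(‖k‖ + ‖h‖)
^ 2`. -/
theorem norm_combination_sq_le (k h x y : ℂ) :
    ‖k * x + h * y‖ ^ 2 ≤ (‖k‖ + ‖h‖) * (‖k‖ * ‖x‖ ^ 2 + ‖h‖ * ‖y‖ ^ 2) := by
  have h1 : ‖k * x + h * y‖ ≤ ‖k‖ * ‖x‖ + ‖h‖ * ‖y‖ := by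
    simpa using norm_add_le (k * x) (h * y)
  have h2 : ‖k * x + h * y‖ ^ 2 ≤ (‖k‖ * ‖x‖ + ‖h‖ * ‖y‖) ^ 2 := by gcongr
  have h3 := mul_nonneg (mul_nonneg (norm_nonneg k) (norm_nonneg h)) (sq_nonneg (‖x‖ - ‖y‖))
  nlinarith

theorem sum_lintegral_inputs_le (hc : ch.PowerConstraint c) (k h : ℂ) :
    ∑ i, ∫⁻ ω, ENNReal.ofReal (‖k * xP c ω i + h * ch.xC c ω i‖ ^ 2) ∂(ccicLaw N Mp Mc) ≤
      ENNReal.ofReal (N * (‖k‖ + ‖h‖) ^ 2) := by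
  have hk := norm_nonneg k
  have hh := norm_nonneg h
  have h1 : ∀ i, ∫⁻ ω, ENNReal.ofReal (‖k * xP c ω i + h * ch.xC c ω i‖ ^ 2) ∂(ccicLaw N Mp Mc) ≤
      ENNReal.ofReal ((‖k‖ + ‖h‖) * ‖k‖) * ∫⁻ ω, ‖xP c ω i‖ₑ ^ 2 ∂(ccicLaw N Mp Mc) +
      ENNReal.ofReal ((‖k‖ + ‖h‖) * ‖h‖) * ∫⁻ ω, ‖ch.xC c ω i‖ₑ ^ 2 ∂(ccicLaw N Mp Mc) := by
    intro i
    have m1 := measurable_xP c i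
    have m2 := ch.measurable_xC c i
    rw [← lintegral_const_mul _ (by fun_prop), ← lintegral_const_mul _ (by fun_prop),
      ← lintegral_add_left (by fun_prop)]
    refine lintegral_mono fun ω => ?_
    simp only [← ofReal_norm]
    rw [← ENNReal.ofReal_pow (norm_nonneg _), ← ENNReal.ofReal_pow (norm_nonneg _),
      ← ENNReal.ofReal_mul (by positivity), ← ENNReal.ofReal_mul (by positivity),
      ← ENNReal.ofReal_add (by positivity) (by positivity)]
    refine ENNReal.ofReal_le_ofReal ((norm_combination_sq_le k h _ _).trans_eq ?_)
    ring
  calc _ ≤ _ := Finset.sum_le_sum fun i _ => h1 i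
    _ ≤ ENNReal.ofReal ((‖k‖ + ‖h‖) * ‖k‖) * N + ENNReal.ofReal ((‖k‖ + ‖h‖) * ‖h‖) * N := by
        rw [Finset.sum_add_distrib, ← Finset.mul_sum, ← Finset.mul_sum]
        gcongr
        · exact hc.1
        · exact hc.2
    _ = _ := by
        rw [← ENNReal.ofReal_natCast N, ← ENNReal.ofReal_mul (by positivity),
          ← ENNReal.ofReal_mul (by positivity),
            ← ENNReal.ofReal_add (by positivity) (by positivity)]
        congr 1; ring

theorem lintegral_combo (hMp : 0 < Mp) (hMc : 0 < Mc) (k h a b d : ℂ) (i : Fin N) :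
    ∫⁻ ω, ENNReal.ofReal (‖ch.combo c k h a b d ω i‖ ^ 2) ∂(ccicLaw N Mp Mc) =
      ∫⁻ ω, ENNReal.ofReal (‖k * xP c ω i + h * ch.xC c ω i‖ ^ 2) ∂(ccicLaw N Mp Mc) +
        ENNReal.ofReal (‖a‖ ^ 2) + ENNReal.ofReal (‖b‖ ^ 2) + ENNReal.ofReal (‖d‖ ^ 2) := by
  have m1 := measurable_xP c i
  have m2 := ch.measurable_xC c i
  have hscale : ∀ (e : ℂ) (Z : CCICOutcome N Mp Mc → ℂ), Measurable Z →
      ∫⁻ ω, ENNReal.ofReal (‖Z ω‖ ^ 2) ∂(ccicLaw N Mp Mc) = 1 →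
      ∫⁻ ω, ENNReal.ofReal (‖e * Z ω‖ ^ 2) ∂(ccicLaw N Mp Mc) = ENNReal.ofReal (‖e‖ ^ 2) := by
    intro e Z hZ hZ1
    simp_rw [norm_mul, mul_pow, ENNReal.ofReal_mul (sq_nonneg ‖e‖)]
    rw [lintegral_const_mul _ (by fun_prop), hZ1, mul_one]
  -- The cognitive input at time `i` sees feedback with indices strictly below `i`, so flipping the
  -- `i`-th feedback noise does not move it.
  have hcF : ∀ ω, ch.xC c (negZf i ω) i = ch.xC c ω i := by
    intro ω
    simp only [xC, tF, xP, CCICOutcome.wp, CCICOutcome.wc, CCICOutcome.zf, negZf]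
    congr 1
    funext j
    rw [negCoord_of_ne]
    intro hj
    have := congrArg Fin.val hj
    simp at this
    omega
  simp only [combo]
  rw [lintegral_normSq_add_of_flip (measurePreserving_negZf i)
      (A := fun ω => k * xP c ω i + h * ch.xC c ω i + a * zp ω i + b * zc ω i)
      (Z := fun ω => d * zf ω i) (by fun_prop) (by fun_prop)
      (fun ω => by simp only [hcF]; rfl) (fun ω => by simp [zf, negZf, negCoord_self]),
    lintegral_normSq_add_of_flip (measurePreserving_negZc i)
      (A := fun ω => k * xP c ω i + h * ch.xC c ω i + a * zp ω i)
      (Z := fun ω => b * zc ω i) (by fun_prop) (by fun_prop)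
      (fun ω => rfl) (fun ω => by simp [zc, negZc, negCoord_self]),
    lintegral_normSq_add_of_flip (measurePreserving_negZp i)
      (A := fun ω => k * xP c ω i + h * ch.xC c ω i)
      (Z := fun ω => a * zp ω i) (by fun_prop) (by fun_prop)
      (fun ω => rfl) (fun ω => by simp [zp, negZp, negCoord_self]),
    hscale _ (fun ω => zf ω i) (by fun_prop) (lintegral_normSq_zf hMp hMc i),
    hscale _ (fun ω => zc ω i) (by fun_prop) (lintegral_normSq_zc hMp hMc i),
    hscale _ (fun ω => zp ω i) (by fun_prop) (lintegral_normSq_zp hMp hMc i)]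

theorem lintegral_energy_combo_le (hMp : 0 < Mp) (hMc : 0 < Mc) (hc : ch.PowerConstraint c)
    (k h a b d : ℂ) :
    ∫⁻ ω, ENNReal.ofReal (energy (ch.combo c k h a b d ω)) ∂(ccicLaw N Mp Mc) ≤
      ENNReal.ofReal (N * ((‖k‖ + ‖h‖) ^ 2 + ‖a‖ ^ 2 + ‖b‖ ^ 2 + ‖d‖ ^ 2)) := by
  have hm := ch.measurable_combo c k h a b d
  simp only [energy]
  simp_rw [ENNReal.ofReal_sum_of_nonneg fun _ _ => sq_nonneg _]
  rw [lintegral_finsetSum _ fun i _ => by fun_prop]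
  simp_rw [lintegral_combo ch hMp hMc]
  simp only [Finset.sum_add_distrib, Finset.sum_const, Finset.card_univ, Fintype.card_fin,
    nsmul_eq_mul]
  calc _ ≤ ENNReal.ofReal (N * (‖k‖ + ‖h‖) ^ 2) + N * ENNReal.ofReal (‖a‖ ^ 2) +
        N * ENNReal.ofReal (‖b‖ ^ 2) + N * ENNReal.ofReal (‖d‖ ^ 2) := by
        gcongr
        exact ch.sum_lintegral_inputs_le hc k h
    _ = _ := by
        rw [← ENNReal.ofReal_natCast N]
        simp only [← ENNReal.ofReal_mul (Nat.cast_nonneg N)]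
        rw [← ENNReal.ofReal_add (by positivity) (by positivity),
          ← ENNReal.ofReal_add (by positivity) (by positivity),
          ← ENNReal.ofReal_add (by positivity) (by positivity)]
        congr 1; ring

theorem energy_nonneg (v : Fin N → ℂ) : 0 ≤ energy v := Finset.sum_nonneg fun _ _ => sq_nonneg _

theorem integrable_energy_combo (hMp : 0 < Mp) (hMc : 0 < Mc) (hc : ch.PowerConstraint c)
    (k h a b d : ℂ) :
    Integrable (fun ω => energy (ch.combo c k h a b d ω)) (ccicLaw N Mp Mc) := by
  have hm := ch.measurable_combo c k h a b d
  refine ⟨(measurable_energy.comp hm).aestronglyMeasurable, ?_⟩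
  rw [hasFiniteIntegral_iff_ofReal (ae_of_all _ fun ω => energy_nonneg _)]
  exact (ch.lintegral_energy_combo_le hMp hMc hc k h a b d).trans_lt ENNReal.ofReal_lt_top

theorem integral_energy_combo_le (hMp : 0 < Mp) (hMc : 0 < Mc) (hc : ch.PowerConstraint c)
    (k h a b d : ℂ) :
    ∫ ω, energy (ch.combo c k h a b d ω) ∂(ccicLaw N Mp Mc) ≤
      N * ((‖k‖ + ‖h‖) ^ 2 + ‖a‖ ^ 2 + ‖b‖ ^ 2 + ‖d‖ ^ 2) := by
  have hm := ch.measurable_combo c k h a b d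
  rw [integral_eq_lintegral_of_nonneg_ae (ae_of_all _ fun ω => energy_nonneg _)
    (measurable_energy.comp hm).aestronglyMeasurable]
  exact ENNReal.toReal_le_of_le_ofReal (by positivity)
    (ch.lintegral_energy_combo_le hMp hMc hc k h a b d)

/-- The exact value is needed, not only an upper bound: in `meanLe_log_noise` this energy appears
with a minus sign. -/
theorem integral_energy_noise {Z : CCICOutcome N Mp Mc → Fin N → ℂ} (hZ : Measurable Z)
    (h : ∀ i, ∫⁻ ω, ENNReal.ofReal (‖Z ω i‖ ^ 2) ∂(ccicLaw N Mp Mc) = 1) :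
    ∫ ω, energy (Z ω) ∂(ccicLaw N Mp Mc) = N ∧
      Integrable (fun ω => energy (Z ω)) (ccicLaw N Mp Mc) := by
  have h1 : ∫⁻ ω, ENNReal.ofReal (energy (Z ω)) ∂(ccicLaw N Mp Mc) = N := by
    simp only [energy]
    simp_rw [ENNReal.ofReal_sum_of_nonneg fun _ _ => sq_nonneg _]
    rw [lintegral_finsetSum _ fun i _ => by fun_prop]
    simp_rw [h]
    simp
  constructor
  · rw [integral_eq_lintegral_of_nonneg_ae (ae_of_all _ fun ω => energy_nonneg _)
      (measurable_energy.comp hZ).aestronglyMeasurable, h1]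
    simp
  · refine ⟨(measurable_energy.comp hZ).aestronglyMeasurable, ?_⟩
    rw [hasFiniteIntegral_iff_ofReal (ae_of_all _ fun ω => energy_nonneg _), h1]
    exact ENNReal.natCast_lt_top N

end GCCIC

/-! ### Mixture densities -/

/-- The weights are not normalised, so that uniform averages over messages and posterior averages,
weighted by likelihoods of what has been observed, are both covered. -/
theorem lintegral_weighted_average {α ι : Type*} [MeasurableSpace α] {μ : Measure α}
    [Fintype ι] [Nonempty ι] {c : ι → ℝ} (hc : ∀ w, 0 < c w) {g : ι → α → ℝ}
    (hg : ∀ w, Measurable (g w)) (hg0 : ∀ w x, 0 ≤ g w x)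
    (hg1 : ∀ w, ∫⁻ x, ENNReal.ofReal (g w x) ∂μ = 1) :
    ∫⁻ x, ENNReal.ofReal ((∑ w, c w * g w x) / ∑ w, c w) ∂μ = 1 := by
  have hS : 0 < ∑ w, c w := Finset.sum_pos (fun w _ => hc w) Finset.univ_nonempty
  have h1 : ∀ x, ENNReal.ofReal ((∑ w, c w * g w x) / ∑ w, c w)
      = ∑ w, ENNReal.ofReal (c w / ∑ w, c w) * ENNReal.ofReal (g w x) := by
    intro x
    rw [Finset.sum_div, ENNReal.ofReal_sum_of_nonneg fun w _ =>
      div_nonneg (mul_nonneg (hc w).le (hg0 w x)) hS.le]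
    refine Finset.sum_congr rfl fun w _ => ?_
    rw [← ENNReal.ofReal_mul (div_nonneg (hc w).le hS.le)]
    congr 1; ring
  simp_rw [h1]
  rw [lintegral_finsetSum _ fun w _ => by fun_prop]
  simp_rw [lintegral_const_mul' _ _ ENNReal.ofReal_ne_top, hg1, mul_one]
  rw [← ENNReal.ofReal_sum_of_nonneg fun w _ => div_nonneg (hc w).le hS.le, ← Finset.sum_div,
    div_self hS.ne', ENNReal.ofReal_one]

theorem lintegral_cgaussPDF_sub (c : ℂ) :
    ∫⁻ z, ENNReal.ofReal (cgaussPDF 1 (z - c)) = 1 := by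
  rw [lintegral_sub_right_eq_self (fun z => ENNReal.ofReal (cgaussPDF 1 z)) c,
    lintegral_cgaussPDF one_pos]

namespace CausalModel

variable {N Mp Mc : ℕ} (m : CausalModel N Mp Mc)

/-- Density of the cognitive interference given the feedback and the cognitive message. -/
noncomputable def kerC (wc : Fin Mc) (tf tc : Fin N → ℂ) : ℝ :=
  vgauss 1 (tc - m.crossC • m.cog wc tf)

/-- Density of the primary interference given the primary message. -/
noncomputable def kerP (wp : Fin Mp) (tp : Fin N → ℂ) : ℝ := vgauss 1 (tp - m.crossP • m.prim wp)

/-- Density of the feedback given the primary message. -/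
noncomputable def kerF (wp : Fin Mp) (tf : Fin N → ℂ) : ℝ :=
  vgauss 1 (tf - m.feedback • m.prim wp)

theorem dens_eq (wp : Fin Mp) (wc : Fin Mc) (tf tp tc : Fin N → ℂ) :
    m.dens wp wc tf tp tc = m.kerF wp tf * m.kerP wp tp * m.kerC wc tf tc := rfl

theorem kerC_pos (wc : Fin Mc) (tf tc : Fin N → ℂ) : 0 < m.kerC wc tf tc := vgauss_pos one_pos _

theorem kerP_pos (wp : Fin Mp) (tp : Fin N → ℂ) : 0 < m.kerP wp tp := vgauss_pos one_pos _

theorem kerF_pos (wp : Fin Mp) (tf : Fin N → ℂ) : 0 < m.kerF wp tf := vgauss_pos one_pos _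

theorem lintegral_kerC (wc : Fin Mc) (tf : Fin N → ℂ) :
    ∫⁻ tc, ENNReal.ofReal (m.kerC wc tf tc) = 1 := lintegral_vgauss_sub one_pos _

theorem lintegral_kerP (wp : Fin Mp) : ∫⁻ tp, ENNReal.ofReal (m.kerP wp tp) = 1 :=
  lintegral_vgauss_sub one_pos _

theorem lintegral_kerF (wp : Fin Mp) : ∫⁻ tf, ENNReal.ofReal (m.kerF wp tf) = 1 :=
  lintegral_vgauss_sub one_pos _

section Measurability

variable {α : Type*} [MeasurableSpace α] {f g : α → Fin N → ℂ}

@[fun_prop]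
theorem measurable_kerC_comp (wc : Fin Mc) (hf : Measurable f) (hg : Measurable g) :
    Measurable fun a => m.kerC wc (f a) (g a) := by
  have := m.measurable_cog wc
  unfold kerC; fun_prop

@[fun_prop]
theorem measurable_kerP_comp (wp : Fin Mp) (hf : Measurable f) :
    Measurable fun a => m.kerP wp (f a) := by
  unfold kerP; fun_prop

@[fun_prop]
theorem measurable_kerF_comp (wp : Fin Mp) (hf : Measurable f) :
    Measurable fun a => m.kerF wp (f a) := by
  unfold kerF; fun_prop

end Measurability

/-- Density of the cognitive interference given the feedback. -/
noncomputable def mixC (tf tc : Fin N → ℂ) : ℝ := (∑ wc, m.kerC wc tf tc) / Mc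

/-- Density of the feedback. -/
noncomputable def mixF (tf : Fin N → ℂ) : ℝ := (∑ wp, m.kerF wp tf) / Mp

/-- Joint density of the feedback and the primary interference. -/
noncomputable def mixFP (tf tp : Fin N → ℂ) : ℝ := (∑ wp, m.kerF wp tf * m.kerP wp tp) / Mp

@[fun_prop]
theorem measurable_mixC_comp {α : Type*} [MeasurableSpace α] {f g : α → Fin N → ℂ}
    (hf : Measurable f) (hg : Measurable g) : Measurable fun a => m.mixC (f a) (g a) := by
  unfold mixC; fun_prop

@[fun_prop]
theorem measurable_mixF_comp {α : Type*} [MeasurableSpace α] {f : α → Fin N → ℂ}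
    (hf : Measurable f) : Measurable fun a => m.mixF (f a) := by
  unfold mixF; fun_prop

@[fun_prop]
theorem measurable_mixFP_comp {α : Type*} [MeasurableSpace α] {f g : α → Fin N → ℂ}
    (hf : Measurable f) (hg : Measurable g) : Measurable fun a => m.mixFP (f a) (g a) := by
  unfold mixFP; fun_prop

theorem mixC_pos (hMc : 0 < Mc) (tf tc : Fin N → ℂ) : 0 < m.mixC tf tc := by
  have : Nonempty (Fin Mc) := ⟨⟨0, hMc⟩⟩
  exact div_pos (Finset.sum_pos (fun w _ => m.kerC_pos w _ _) Finset.univ_nonempty)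
    (by exact_mod_cast hMc)

theorem mixF_pos (hMp : 0 < Mp) (tf : Fin N → ℂ) : 0 < m.mixF tf := by
  have : Nonempty (Fin Mp) := ⟨⟨0, hMp⟩⟩
  exact div_pos (Finset.sum_pos (fun w _ => m.kerF_pos w _) Finset.univ_nonempty)
    (by exact_mod_cast hMp)

theorem mixFP_pos (hMp : 0 < Mp) (tf tp : Fin N → ℂ) : 0 < m.mixFP tf tp := by
  have : Nonempty (Fin Mp) := ⟨⟨0, hMp⟩⟩
  exact div_pos (Finset.sum_pos (fun w _ => mul_pos (m.kerF_pos w _) (m.kerP_pos w _))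
    Finset.univ_nonempty) (by exact_mod_cast hMp)

theorem lintegral_mixC (hMc : 0 < Mc) (tf : Fin N → ℂ) :
    ∫⁻ tc, ENNReal.ofReal (m.mixC tf tc) = 1 := by
  have : Nonempty (Fin Mc) := ⟨⟨0, hMc⟩⟩
  have h := lintegral_weighted_average (c := fun _ : Fin Mc => 1) (fun _ => one_pos)
    (g := fun w tc => m.kerC w tf tc) (fun w => by fun_prop) (fun w _ => (m.kerC_pos w _ _).le)
    (fun w => m.lintegral_kerC w tf)
  simpa [mixC] using h

theorem lintegral_mixF (hMp : 0 < Mp) : ∫⁻ tf, ENNReal.ofReal (m.mixF tf) = 1 := by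
  have : Nonempty (Fin Mp) := ⟨⟨0, hMp⟩⟩
  have h := lintegral_weighted_average (c := fun _ : Fin Mp => 1) (fun _ => one_pos)
    (g := fun w tf => m.kerF w tf) (fun w => by fun_prop) (fun w _ => (m.kerF_pos w _).le)
    (fun w => m.lintegral_kerF w)
  simpa [mixF] using h

/-- Density of the primary interference given the feedback. -/
noncomputable def condP (tf tp : Fin N → ℂ) : ℝ := m.mixFP tf tp / m.mixF tf

theorem condP_pos (hMp : 0 < Mp) (tf tp : Fin N → ℂ) : 0 < m.condP tf tp :=
  div_pos (m.mixFP_pos hMp tf tp) (m.mixF_pos hMp tf)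

@[fun_prop]
theorem measurable_condP_comp {α : Type*} [MeasurableSpace α] {f g : α → Fin N → ℂ}
    (hf : Measurable f) (hg : Measurable g) : Measurable fun a => m.condP (f a) (g a) := by
  unfold condP; fun_prop

/-- In `tp` this is an average of the kernels `kerP`, weighted by the posterior of the primary
message given the feedback. -/
theorem lintegral_condP (hMp : 0 < Mp) (tf : Fin N → ℂ) :
    ∫⁻ tp, ENNReal.ofReal (m.condP tf tp) = 1 := by
  have : Nonempty (Fin Mp) := ⟨⟨0, hMp⟩⟩
  have hM : (Mp : ℝ) ≠ 0 := by exact_mod_cast hMp.ne'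
  have h := lintegral_weighted_average (c := fun w : Fin Mp => m.kerF w tf)
    (fun w => m.kerF_pos w tf)
    (g := fun w tp => m.kerP w tp) (fun w => by fun_prop) (fun w _ => (m.kerP_pos w _).le)
    (fun w => m.lintegral_kerP w)
  simpa [condP, mixFP, mixF, div_div_div_cancel_right₀ hM] using h

/-! ### Causal factorization of the joint density of feedback and primary interference -/

/-- Likelihood of `wp` given the first `n` samples of the feedback and primary interference. -/
noncomputable def like (n : ℕ) (wp : Fin Mp) (tf tp : Fin N → ℂ) : ℝ :=
  ∏ j : Fin N with j.val < n, cgaussPDF 1 (tf j - m.feedback * m.prim wp j) *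
    cgaussPDF 1 (tp j - m.crossP * m.prim wp j)

/-- Density of `tp i` given the past of both signals. -/
noncomputable def stepP (i : Fin N) (tf tp : Fin N → ℂ) : ℝ :=
  (∑ wp, m.like i wp tf tp * cgaussPDF 1 (tp i - m.crossP * m.prim wp i)) /
    ∑ wp, m.like i wp tf tp

/-- Density of `tf i` given the past of both signals and `tp i`. -/
noncomputable def stepF (i : Fin N) (tf tp : Fin N → ℂ) : ℝ :=
  (∑ wp, m.like i wp tf tp * cgaussPDF 1 (tp i - m.crossP * m.prim wp i) *
    cgaussPDF 1 (tf i - m.feedback * m.prim wp i)) /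
    ∑ wp, m.like i wp tf tp * cgaussPDF 1 (tp i - m.crossP * m.prim wp i)

theorem like_pos (n : ℕ) (wp : Fin Mp) (tf tp : Fin N → ℂ) : 0 < m.like n wp tf tp :=
  Finset.prod_pos fun _ _ => mul_pos (cgaussPDF_pos one_pos _) (cgaussPDF_pos one_pos _)

theorem like_mul_pos (i : Fin N) (wp : Fin Mp) (tf tp : Fin N → ℂ) :
    0 < m.like i wp tf tp * cgaussPDF 1 (tp i - m.crossP * m.prim wp i) :=
  mul_pos (m.like_pos _ _ _ _) (cgaussPDF_pos one_pos _)

theorem like_congr {n : ℕ} {wp : Fin Mp} {tf tp tf' tp' : Fin N → ℂ}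
    (hf : ∀ j : Fin N, j.val < n → tf j = tf' j) (hp : ∀ j : Fin N, j.val < n → tp j = tp' j) :
    m.like n wp tf tp = m.like n wp tf' tp' :=
  Finset.prod_congr rfl fun j hj => by
    rw [Finset.mem_filter] at hj
    rw [hf j hj.2, hp j hj.2]

/-- The factors stand in the order in which `stepP` and `stepF` predict: first `tp i`, then `tf i`.
-/
theorem like_succ (i : Fin N) (wp : Fin Mp) (tf tp : Fin N → ℂ) :
    m.like (i + 1) wp tf tp = m.like i wp tf tp *
      cgaussPDF 1 (tp i - m.crossP * m.prim wp i) *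
      cgaussPDF 1 (tf i - m.feedback * m.prim wp i) := by
  have h : (Finset.univ.filter fun j : Fin N => j.val < i + 1)
      = insert i (Finset.univ.filter fun j : Fin N => j.val < i) := by
    ext j
    simp only [Finset.mem_filter, Finset.mem_univ, true_and, Finset.mem_insert, Fin.ext_iff]
    omega
  rw [like, h, Finset.prod_insert (by simp), like]
  ring

theorem like_full (wp : Fin Mp) (tf tp : Fin N → ℂ) :
    m.like N wp tf tp = m.kerF wp tf * m.kerP wp tp := by
  simp [like, kerF, kerP, vgauss, Finset.prod_mul_distrib]

@[fun_prop]
theorem measurable_like_comp {α : Type*} [MeasurableSpace α] {f g : α → Fin N → ℂ}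
    (n : ℕ) (wp : Fin Mp) (hf : Measurable f) (hg : Measurable g) :
    Measurable fun a => m.like n wp (f a) (g a) := by
  unfold like; fun_prop

@[fun_prop]
theorem measurable_stepP_comp {α : Type*} [MeasurableSpace α] {f g : α → Fin N → ℂ}
    (i : Fin N) (hf : Measurable f) (hg : Measurable g) :
    Measurable fun a => m.stepP i (f a) (g a) := by
  unfold stepP; fun_prop

@[fun_prop]
theorem measurable_stepF_comp {α : Type*} [MeasurableSpace α] {f g : α → Fin N → ℂ}
    (i : Fin N) (hf : Measurable f) (hg : Measurable g) :
    Measurable fun a => m.stepF i (f a) (g a) := by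
  unfold stepF; fun_prop

/-- Causally conditioned density of the primary interference given the feedback. -/
noncomputable def causalP (tf tp : Fin N → ℂ) : ℝ := ∏ i, m.stepP i tf tp

/-- Causally conditioned density of the feedback given the primary interference. -/
noncomputable def causalF (tf tp : Fin N → ℂ) : ℝ := ∏ i, m.stepF i tf tp

@[fun_prop]
theorem measurable_causalP_comp {α : Type*} [MeasurableSpace α] {f g : α → Fin N → ℂ}
    (hf : Measurable f) (hg : Measurable g) : Measurable fun a => m.causalP (f a) (g a) := by
  unfold causalP; fun_prop

@[fun_prop]
theorem measurable_causalF_comp {α : Type*} [MeasurableSpace α] {f g : α → Fin N → ℂ}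
    (hf : Measurable f) (hg : Measurable g) : Measurable fun a => m.causalF (f a) (g a) := by
  unfold causalF; fun_prop

section Steps

theorem stepP_pos (hMp : 0 < Mp) (i : Fin N) (tf tp : Fin N → ℂ) : 0 < m.stepP i tf tp := by
  have : Nonempty (Fin Mp) := ⟨⟨0, hMp⟩⟩
  exact div_pos (Finset.sum_pos (fun w _ => m.like_mul_pos _ _ _ _) Finset.univ_nonempty)
    (Finset.sum_pos (fun w _ => m.like_pos _ _ _ _) Finset.univ_nonempty)

theorem stepF_pos (hMp : 0 < Mp) (i : Fin N) (tf tp : Fin N → ℂ) : 0 < m.stepF i tf tp := by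
  have : Nonempty (Fin Mp) := ⟨⟨0, hMp⟩⟩
  exact div_pos (Finset.sum_pos (fun w _ => mul_pos (m.like_mul_pos _ _ _ _)
    (cgaussPDF_pos one_pos _)) Finset.univ_nonempty)
    (Finset.sum_pos (fun w _ => m.like_mul_pos _ _ _ _) Finset.univ_nonempty)

theorem causalP_pos (hMp : 0 < Mp) (tf tp : Fin N → ℂ) : 0 < m.causalP tf tp :=
  Finset.prod_pos fun i _ => m.stepP_pos hMp i tf tp

theorem causalF_pos (hMp : 0 < Mp) (tf tp : Fin N → ℂ) : 0 < m.causalF tf tp :=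
  Finset.prod_pos fun i _ => m.stepF_pos hMp i tf tp

/-- At each time the two predictions multiply to the ratio of consecutive total likelihoods, so the
product telescopes, starting from empty likelihoods that sum to `Mp`. -/
theorem causalP_mul_causalF (hMp : 0 < Mp) (tf tp : Fin N → ℂ) :
    m.causalP tf tp * m.causalF tf tp = m.mixFP tf tp := by
  have : Nonempty (Fin Mp) := ⟨⟨0, hMp⟩⟩
  have hS : ∀ n, (∑ wp, m.like n wp tf tp) ≠ 0 := fun n =>
    (Finset.sum_pos (fun w _ => m.like_pos n w tf tp) Finset.univ_nonempty).ne'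
  rw [causalP, causalF, ← Finset.prod_mul_distrib]
  have h1 : ∀ i : Fin N, m.stepP i tf tp * m.stepF i tf tp =
      (fun n : ℕ => (∑ wp, m.like (n + 1) wp tf tp) / ∑ wp, m.like n wp tf tp) i := by
    intro i
    have h2 : (∑ wp, m.like i wp tf tp * cgaussPDF 1 (tp i - m.crossP * m.prim wp i)) ≠ 0 :=
      (Finset.sum_pos (fun w _ => m.like_mul_pos i w tf tp) Finset.univ_nonempty).ne'
    simp only [stepP, stepF, like_succ]
    rw [mul_comm]
    exact div_mul_div_cancel₀ h2
  rw [Finset.prod_congr rfl fun i _ => h1 i, Fin.prod_univ_eq_prod_range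
    (fun n : ℕ => (∑ wp, m.like (n + 1) wp tf tp) / ∑ wp, m.like n wp tf tp)]
  have h3 : ∀ n, ∏ k ∈ Finset.range n,
      ((∑ wp, m.like (k + 1) wp tf tp) / ∑ wp, m.like k wp tf tp)
      = (∑ wp, m.like n wp tf tp) / ∑ wp, m.like 0 wp tf tp := by
    intro n
    induction n with
    | zero => simp [div_self (hS 0)]
    | succ n ih => rw [Finset.prod_range_succ, ih]; have := hS n; have := hS 0; field_simp
  rw [h3, mixFP]
  simp_rw [like_full]
  simp [like]

/-- Along `tf = β • tp + v` the strict past of the feedback is determined by the strict past of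
`tp`. The `i`-th factor therefore still depends on coordinates up to `i` only, and in the `i`-th one
it is a posterior average of Gaussian densities. -/
theorem lintegral_causalP (hMp : 0 < Mp) (β : ℂ) (v : Fin N → ℂ) :
    ∫⁻ tp, ENNReal.ofReal (m.causalP (β • tp + v) tp) = 1 := by
  have : Nonempty (Fin Mp) := ⟨⟨0, hMp⟩⟩
  have h1 : ∀ tp : Fin N → ℂ, ENNReal.ofReal (m.causalP (β • tp + v) tp)
      = ∏ i, ENNReal.ofReal (m.stepP i (β • tp + v) tp) := fun tp =>
    ENNReal.ofReal_prod_of_nonneg fun i _ => (m.stepP_pos hMp i _ _).le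
  simp_rw [h1]
  rw [volume_pi, lintegral_prod_of_causal (m := fun _ => 1)
    (k := fun i (tp : Fin N → ℂ) => ENNReal.ofReal (m.stepP i (β • tp + v) tp))
    (fun i => by fun_prop)]
  · simp
  · intro i j hij t s
    have hl : ∀ wp, m.like i wp (β • Function.update t j s + v) (Function.update t j s)
        = m.like i wp (β • t + v) t := fun wp => by
      refine m.like_congr (fun l hl => ?_) (fun l hl => ?_)
      · simp [Function.update_of_ne (show l ≠ j by omega)]
      · exact Function.update_of_ne (by omega) _ _
    simp only [stepP, hl, Function.update_of_ne hij.ne]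
  · intro i t
    have hl : ∀ s wp, m.like i wp (β • Function.update t i s + v) (Function.update t i s)
        = m.like i wp (β • t + v) t := fun s wp => by
      refine m.like_congr (fun l hl => ?_) (fun l hl => ?_)
      · simp [Function.update_of_ne (show l ≠ i by omega)]
      · exact Function.update_of_ne (by omega) _ _
    simp only [stepP, hl, Function.update_self]
    exact lintegral_weighted_average (fun w => m.like_pos _ w _ _)
      (g := fun w s => cgaussPDF 1 (s - m.crossP * m.prim w i)) (fun w => by fun_prop)
      (fun w s => (cgaussPDF_pos one_pos _).le) (fun w => lintegral_cgaussPDF_sub _)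

/-- `stepF i` conditions on `tp i`, that is on `τ tf i`; by `hc` this is fixed by the feedback
strictly before `i`. Without that delay the `i`-th factor would not be a density in `tf i`. -/
theorem lintegral_causalF (hMp : 0 < Mp) {τ : (Fin N → ℂ) → Fin N → ℂ} (hτ : Measurable τ)
    (hc : ∀ i j, i ≤ j → ∀ t z, τ (Function.update t j z) i = τ t i) :
    ∫⁻ tf, ENNReal.ofReal (m.causalF tf (τ tf)) = 1 := by
  have : Nonempty (Fin Mp) := ⟨⟨0, hMp⟩⟩
  have h1 : ∀ tf : Fin N → ℂ, ENNReal.ofReal (m.causalF tf (τ tf))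
      = ∏ i, ENNReal.ofReal (m.stepF i tf (τ tf)) := fun tf =>
    ENNReal.ofReal_prod_of_nonneg fun i _ => (m.stepF_pos hMp i _ _).le
  simp_rw [h1]
  rw [volume_pi, lintegral_prod_of_causal (m := fun _ => 1)
    (k := fun i (tf : Fin N → ℂ) => ENNReal.ofReal (m.stepF i tf (τ tf)))
    (fun i => by fun_prop)]
  · simp
  · intro i j hij t s
    have hl : ∀ wp, m.like i wp (Function.update t j s) (τ (Function.update t j s))
        = m.like i wp t (τ t) := fun wp => by
      refine m.like_congr (fun l hl => ?_) (fun l hl => ?_)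
      · exact Function.update_of_ne (by omega) _ _
      · exact hc l j (by omega) t s
    simp only [stepF, hl, Function.update_of_ne hij.ne, hc i j hij.le]
  · intro i t
    have hl : ∀ s wp, m.like i wp (Function.update t i s) (τ (Function.update t i s))
        = m.like i wp t (τ t) := fun s wp => by
      refine m.like_congr (fun l hl => ?_) (fun l hl => ?_)
      · exact Function.update_of_ne (by omega) _ _
      · exact hc l i (by omega) t s
    simp only [stepF, hl, Function.update_self, hc i i le_rfl]
    exact lintegral_weighted_average (fun w => m.like_mul_pos i w t (τ t))
      (g := fun w s => cgaussPDF 1 (s - m.feedback * m.prim w i)) (fun w => by fun_prop)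
      (fun w s => (cgaussPDF_pos one_pos _).le) (fun w => lintegral_cgaussPDF_sub _)

end Steps

/-! ### Test densities of feedback and primary interference -/

theorem lintegral_vgauss_mul_condP (hMp : 0 < Mp) {s : ℝ} (hs : 0 < s) :
    ∫⁻ tf, ∫⁻ tp, ENNReal.ofReal (vgauss s tf * m.condP tf tp) = 1 := by
  simp_rw [ENNReal.ofReal_mul (vgauss_pos hs _).le,
    lintegral_const_mul' _ _ ENNReal.ofReal_ne_top, m.lintegral_condP hMp, mul_one]
  exact lintegral_vgauss hs

/-- A Gaussian law for the innovation `tf - β • tp` takes the place of `causalF`. With `v` as the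
new variable and held fixed, the integral over `tp` is the one in `lintegral_causalP`. -/
theorem lintegral_causalP_mul_vgauss (hMp : 0 < Mp) {s : ℝ} (hs : 0 < s) (β : ℂ) :
    ∫⁻ tf, ∫⁻ tp, ENNReal.ofReal (m.causalP tf tp * vgauss s (tf - β • tp)) = 1 := by
  rw [lintegral_lintegral_swap (Measurable.aemeasurable (by fun_prop))]
  have h1 : ∀ tp : Fin N → ℂ, ∫⁻ tf, ENNReal.ofReal (m.causalP tf tp * vgauss s (tf - β • tp))
      = ∫⁻ v, ENNReal.ofReal (m.causalP (β • tp + v) tp * vgauss s v) := by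
    intro tp
    rw [← lintegral_add_left_eq_self _ (β • tp)]
    simp
  simp_rw [h1]
  rw [lintegral_lintegral_swap (Measurable.aemeasurable (by fun_prop))]
  simp_rw [ENNReal.ofReal_mul' (vgauss_pos hs _).le,
    lintegral_mul_const' _ _ ENNReal.ofReal_ne_top, m.lintegral_causalP hMp, one_mul]
  exact lintegral_vgauss hs

end CausalModel

namespace CausalModel

variable {N Mp Mc : ℕ} (m : CausalModel N Mp Mc)

@[fun_prop]
theorem measurable_outP_comp {α : Type*} [MeasurableSpace α] {f : α → Fin N → ℂ} (wp : Fin Mp)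
    (hf : Measurable f) : Measurable fun a => m.outP wp (f a) := by
  unfold outP; fun_prop

@[fun_prop]
theorem measurable_outC_comp {α : Type*} [MeasurableSpace α] {f g : α → Fin N → ℂ} (wc : Fin Mc)
    (hf : Measurable f) (hg : Measurable g) : Measurable fun a => m.outC wc (f a) (g a) := by
  have := m.measurable_cog wc
  unfold outC; fun_prop

@[fun_prop]
theorem measurable_guessC_comp {α : Type*} [MeasurableSpace α] {f : α → Fin N → ℂ} (wc : Fin Mc)
    (hf : Measurable f) : Measurable fun a => guessWeight m.decC wc (f a) :=
  (measurable_guessWeight m.measurable_decC wc).comp hf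

theorem avg_const {M : ℕ} (hM : 0 < M) (r : ℝ) : (M : ℝ)⁻¹ * ∑ _w : Fin M, r = r := by
  have : (M : ℝ) ≠ 0 := by exact_mod_cast hM.ne'
  simp; field_simp

theorem lintegral_avg {α : Type*} [MeasurableSpace α] {μ : Measure α} {M : ℕ} (hM : 0 < M)
    {g : Fin M → α → ℝ} (hg : ∀ w, Measurable (g w)) (hg0 : ∀ w x, 0 ≤ g w x)
    (hg1 : ∀ w, ∫⁻ x, ENNReal.ofReal (g w x) ∂μ = 1) :
    ∫⁻ x, ENNReal.ofReal ((M : ℝ)⁻¹ * ∑ w, g w x) ∂μ = 1 := by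
  have : Nonempty (Fin M) := ⟨⟨0, hM⟩⟩
  have h := lintegral_weighted_average (c := fun _ : Fin M => 1) (fun _ => one_pos) hg hg0 hg1
  simpa [div_eq_inv_mul] using h

theorem measurable_lintegral_lintegral {f : (Fin N → ℂ) → (Fin N → ℂ) → (Fin N → ℂ) → ℝ≥0∞}
    (hf : Measurable fun p : ((Fin N → ℂ) × (Fin N → ℂ)) × (Fin N → ℂ) => f p.1.1 p.1.2 p.2) :
    Measurable fun y => ∫⁻ a, ∫⁻ b, f y a b :=
  Measurable.lintegral_prod_right' (f := fun q : (Fin N → ℂ) × (Fin N → ℂ) => ∫⁻ b, f q.1 q.2 b)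
    (Measurable.lintegral_prod_right' hf)

/-! ### Likelihood ratios for the decoder of the primary receiver -/

/-- `Q y tf tp` is a density in `y`, `D tf tp` a density: the primary decoder with side
information. -/
theorem lintegral_side_information {D : (Fin N → ℂ) → (Fin N → ℂ) → ℝ}
    (hD : Measurable fun p : (Fin N → ℂ) × (Fin N → ℂ) => D p.1 p.2) (hD0 : ∀ tf tp, 0 ≤ D tf tp)
    (hD1 : ∫⁻ tf, ∫⁻ tp, ENNReal.ofReal (D tf tp) ≤ 1)
    {Q : (Fin N → ℂ) → (Fin N → ℂ) → (Fin N → ℂ) → ℝ}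
    (hQ : Measurable fun p : (Fin N → ℂ) × (Fin N → ℂ) × (Fin N → ℂ) => Q p.1 p.2.1 p.2.2)
    (hQ1 : ∀ tf tp, ∫⁻ y, ENNReal.ofReal (Q y tf tp) ≤ 1) :
    ∫⁻ y, ∫⁻ tf, ∫⁻ tp, ENNReal.ofReal (D tf tp * Q y tf tp) ≤ 1 := by
  have hm : Measurable fun p : (Fin N → ℂ) × (Fin N → ℂ) × (Fin N → ℂ) =>
      ENNReal.ofReal (D p.1 p.2.1 * Q p.2.2 p.1 p.2.1) := by
    have h1 := hD.comp (by fun_prop :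
      Measurable fun p : (Fin N → ℂ) × (Fin N → ℂ) × (Fin N → ℂ) => (p.1, p.2.1))
    have h2 := hQ.comp (by fun_prop :
      Measurable fun p : (Fin N → ℂ) × (Fin N → ℂ) × (Fin N → ℂ) => (p.2.2, p.1, p.2.1))
    simp only [Function.comp_def] at h1 h2
    fun_prop
  rw [← lintegral_rotate (f := fun tf tp y => ENNReal.ofReal (D tf tp * Q y tf tp)) hm]
  refine le_trans (lintegral_mono fun tf => lintegral_mono fun tp => ?_) hD1
  simp_rw [ENNReal.ofReal_mul (hD0 tf tp)]
  rw [lintegral_const_mul' _ _ ENNReal.ofReal_ne_top]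
  exact mul_le_of_le_one_right' (hQ1 tf tp)

/-- Likelihood ratio of the primary message for the output and the feedback, given the cognitive
message. -/
noncomputable def ratioPF (s t : ℝ) (β : ℂ) : Signals N Mp Mc := fun wp wc tf _ tc =>
  guessWeight m.decP wp (m.outP wp tc) *
    (vgauss s tf * vgauss t (m.outP wp tc - m.crossC • m.cog wc tf - β • tf)) /
    (m.kerF wp tf * m.kerC wc tf tc)

theorem measurable_cog_comp {α : Type*} [MeasurableSpace α] {f : α → Fin N → ℂ} (wc : Fin Mc)
    (hf : Measurable f) : Measurable fun a => m.cog wc (f a) := (m.measurable_cog wc).comp hf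

attribute [fun_prop] measurable_cog_comp

/-- This is the bound on `I(W_p; Y_p, T_f | W_c)`. The kernels of feedback and cognitive
interference cancel against the denominator, `kerP` integrates to one, and the remaining average
over the cognitive message is free of `wp`. -/
theorem isTest_ratioPF {s t : ℝ} (hs : 0 < s) (ht : 0 < t) (β : ℂ) (hMc : 0 < Mc) :
    m.IsTest (m.ratioPF s t β) := by
  refine m.isTest_of_primary (fun wp wc => by unfold ratioPF; fun_prop)
    (fun wp wc tf tp tc => ?_) hMc
    (J := fun wp y tf tp => ((Mc : ℝ)⁻¹ * ∑ wc, vgauss s tf *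
      vgauss t (y - (m.crossC • m.cog wc tf + β • tf))) * m.kerP wp tp)
    (fun wp => by fun_prop) (fun wp tf tp tc => ?_)
    (j := fun y => ∫⁻ tf, ENNReal.ofReal ((Mc : ℝ)⁻¹ * ∑ wc, vgauss s tf *
      vgauss t (y - (m.crossC • m.cog wc tf + β • tf)))) ?_ (fun wp y => le_of_eq ?_) (le_of_eq ?_)
  · have := guessWeight_pos m.decP wp (m.outP wp tc)
    have := m.kerF_pos wp tf
    have := m.kerC_pos wc tf tc
    have := vgauss_pos hs tf
    have := vgauss_pos ht (m.outP wp tc - m.crossC • m.cog wc tf - β • tf)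
    unfold ratioPF; positivity
  · refine le_of_eq ?_
    simp_rw [ratioPF, dens_eq, Finset.mul_sum, Finset.sum_mul, Finset.mul_sum]
    refine Finset.sum_congr rfl fun wc _ => ?_
    have := (m.kerF_pos wp tf).ne'
    have := (m.kerC_pos wc tf tc).ne'
    rw [← sub_sub]
    field_simp
  · exact Measurable.lintegral_prod_right (by fun_prop)
  · refine lintegral_congr fun tf => ?_
    simp_rw [ENNReal.ofReal_mul' (m.kerP_pos wp _).le]
    rw [lintegral_const_mul' _ _ ENNReal.ofReal_ne_top, m.lintegral_kerP, mul_one]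
  · rw [lintegral_lintegral_swap (Measurable.aemeasurable (by fun_prop)), ← lintegral_vgauss hs]
    refine lintegral_congr fun tf => ?_
    have h : ∀ y, ENNReal.ofReal ((Mc : ℝ)⁻¹ * ∑ wc, vgauss s tf *
        vgauss t (y - (m.crossC • m.cog wc tf + β • tf))) = ENNReal.ofReal (vgauss s tf) *
        ENNReal.ofReal ((Mc : ℝ)⁻¹ * ∑ wc,
          vgauss t (y - (m.crossC • m.cog wc tf + β • tf))) := fun y => by
      rw [← ENNReal.ofReal_mul (vgauss_pos hs _).le, ← Finset.mul_sum]
      congr 1; ring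
    simp_rw [h]
    rw [lintegral_const_mul' _ _ ENNReal.ofReal_ne_top,
      lintegral_avg hMc (g := fun wc y => vgauss t (y - (m.crossC • m.cog wc tf + β • tf)))
        (fun w => by fun_prop) (fun w y => (vgauss_pos ht _).le)
        (fun w => lintegral_vgauss_sub ht _), mul_one]

/-- Likelihood ratio for the primary output alone, the noise density as numerator. -/
noncomputable def ratioPNoise (s : ℝ) : Signals N Mp Mc := fun wp wc tf _ tc =>
  guessWeight m.decP wp (m.outP wp tc) * vgauss s (m.outP wp tc) / m.kerC wc tf tc

/-- Likelihood ratio for the primary output alone, with the feedback as side information in the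
numerator. -/
noncomputable def ratioPMix (s : ℝ) : Signals N Mp Mc := fun wp _ tf _ tc =>
  guessWeight m.decP wp (m.outP wp tc) * vgauss s (m.outP wp tc) / m.mixC tf tc

/-- The kernels in `tf` and `tp` still depend on `wp`, but they integrate to one and leave the
density of the output alone. -/
theorem isTest_of_output {F : Signals N Mp Mc} (hF : F.Meas) (hF0 : F.Nonneg)
    (hMc : 0 < Mc) {s : ℝ} (hs : 0 < s)
    (h : ∀ wp tf tp tc, (Mc : ℝ)⁻¹ * ∑ wc, F wp wc tf tp tc * m.dens wp wc tf tp tc =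
      guessWeight m.decP wp (m.outP wp tc) * (vgauss s (m.outP wp tc) *
        (m.kerF wp tf * m.kerP wp tp))) :
    m.IsTest F := by
  refine m.isTest_of_primary hF hF0 hMc
    (J := fun wp y tf tp => vgauss s y * (m.kerF wp tf * m.kerP wp tp))
    (fun wp => by fun_prop) (fun wp tf tp tc => (h wp tf tp tc).le)
    (j := fun y => ENNReal.ofReal (vgauss s y)) (by fun_prop) (fun wp y => le_of_eq ?_)
    (lintegral_vgauss hs).le
  simp_rw [ENNReal.ofReal_mul (vgauss_pos hs _).le, ENNReal.ofReal_mul (m.kerF_pos wp _).le,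
    lintegral_const_mul' _ _ ENNReal.ofReal_ne_top, m.lintegral_kerP, mul_one]
  rw [m.lintegral_kerF, mul_one]

theorem isTest_ratioPNoise {s : ℝ} (hs : 0 < s) (hMc : 0 < Mc) : m.IsTest (m.ratioPNoise s) := by
  refine m.isTest_of_output (fun wp wc => by unfold ratioPNoise; fun_prop)
    (fun wp wc tf tp tc => ?_) hMc hs fun wp tf tp tc => ?_
  · have := guessWeight_pos m.decP wp (m.outP wp tc)
    have := m.kerC_pos wc tf tc
    have := vgauss_pos hs (m.outP wp tc)
    unfold ratioPNoise; positivity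
  · rw [← avg_const hMc (guessWeight _ _ _ * _)]
    congr 1
    refine Finset.sum_congr rfl fun wc _ => ?_
    have := (m.kerC_pos wc tf tc).ne'
    rw [ratioPNoise, dens_eq]
    field_simp

theorem isTest_ratioPMix {s : ℝ} (hs : 0 < s) (hMc : 0 < Mc) : m.IsTest (m.ratioPMix s) := by
  refine m.isTest_of_output (fun wp wc => by unfold ratioPMix; fun_prop)
    (fun wp wc tf tp tc => ?_) hMc hs fun wp tf tp tc => ?_
  · have := guessWeight_pos m.decP wp (m.outP wp tc)
    have := m.mixC_pos hMc tf tc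
    have := vgauss_pos hs (m.outP wp tc)
    unfold ratioPMix; positivity
  · simp_rw [ratioPMix, dens_eq, ← mul_assoc]
    rw [← Finset.mul_sum]
    -- The rest of the integrand is independent of `wc`, so averaging over the cognitive message
    -- produces exactly the mixture in the denominator.
    have hmix : ∑ wc, m.kerC wc tf tc = Mc * m.mixC tf tc := by
      have : (Mc : ℝ) ≠ 0 := by exact_mod_cast hMc.ne'
      rw [mixC]; field_simp
    rw [hmix]
    have := (m.mixC_pos hMc tf tc).ne'
    have : (Mc : ℝ) ≠ 0 := by exact_mod_cast hMc.ne'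
    field_simp

/-- Likelihood ratio of the primary message for the output, the feedback and the interference it
causes, given the cognitive message. -/
noncomputable def ratioPGiven (D : (Fin N → ℂ) → (Fin N → ℂ) → ℝ) (s : ℝ) (α β : ℂ) :
    Signals N Mp Mc := fun wp wc tf tp tc =>
  guessWeight m.decP wp (m.outP wp tc) *
    (D tf tp * vgauss s (m.outP wp tc - m.crossC • m.cog wc tf - α • tp - β • tf)) /
    (m.kerF wp tf * m.kerP wp tp * m.kerC wc tf tc)

/-- Likelihood ratio of the primary message for the output, the feedback and the interference it
causes. -/
noncomputable def ratioPJoint (D : (Fin N → ℂ) → (Fin N → ℂ) → ℝ) (s : ℝ) (α β : ℂ) :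
    Signals N Mp Mc := fun wp _ tf tp tc =>
  guessWeight m.decP wp (m.outP wp tc) * (D tf tp * vgauss s (m.outP wp tc - α • tp - β • tf)) /
    (m.kerF wp tf * m.kerP wp tp * m.mixC tf tc)

section Side

variable {D : (Fin N → ℂ) → (Fin N → ℂ) → ℝ}

/-- The law `D` of the side information is left free: `condP` times a Gaussian feedback and
`causalP` times a Gaussian innovation are both needed, depending on which cognitive bound is to
cancel the mixture. -/
theorem isTest_ratioPGiven
    (hD : Measurable fun p : (Fin N → ℂ) × (Fin N → ℂ) => D p.1 p.2) (hD0 : ∀ tf tp, 0 < D tf tp)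
    (hD1 : ∫⁻ tf, ∫⁻ tp, ENNReal.ofReal (D tf tp) ≤ 1) {s : ℝ} (hs : 0 < s) (α β : ℂ)
    (hMc : 0 < Mc) : m.IsTest (m.ratioPGiven D s α β) := by
  have hDf : ∀ {γ : Type} [MeasurableSpace γ] {f g : γ → Fin N → ℂ}, Measurable f → Measurable g →
    Measurable fun a => D (f a) (g a) := fun hf hg => hD.comp (hf.prodMk hg)
  refine m.isTest_of_primary (fun wp wc => ?_)
    (fun wp wc tf tp tc => ?_) hMc
    (J := fun _ y tf tp => D tf tp * ((Mc : ℝ)⁻¹ * ∑ wc,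
      vgauss s (y - (m.crossC • m.cog wc tf + α • tp + β • tf))))
    (fun wp => ?_) (fun wp tf tp tc => ?_)
    (j := fun y => ∫⁻ tf, ∫⁻ tp, ENNReal.ofReal (D tf tp * ((Mc : ℝ)⁻¹ * ∑ wc,
      vgauss s (y - (m.crossC • m.cog wc tf + α • tp + β • tf))))) ?_ (fun wp y => le_rfl) ?_
  · unfold ratioPGiven
    have := hDf (γ := (Fin N → ℂ) × (Fin N → ℂ) × (Fin N → ℂ)) measurable_fst measurable_snd.fst
    fun_prop
  · have := guessWeight_pos m.decP wp (m.outP wp tc)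
    have := m.kerF_pos wp tf
    have := m.kerP_pos wp tp
    have := m.kerC_pos wc tf tc
    have := hD0 tf tp
    have := vgauss_pos hs (m.outP wp tc - m.crossC • m.cog wc tf - α • tp - β • tf)
    unfold ratioPGiven; positivity
  · have := hDf (γ := (Fin N → ℂ) × (Fin N → ℂ) × (Fin N → ℂ)) measurable_snd.fst
      measurable_snd.snd
    fun_prop
  · refine le_of_eq ?_
    simp_rw [ratioPGiven, dens_eq, Finset.mul_sum]
    refine Finset.sum_congr rfl fun wc _ => ?_
    have := (m.kerF_pos wp tf).ne'
    have := (m.kerP_pos wp tp).ne'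
    have := (m.kerC_pos wc tf tc).ne'
    rw [← sub_sub, ← sub_sub]
    field_simp
  · refine measurable_lintegral_lintegral ?_
    have := hDf (γ := ((Fin N → ℂ) × (Fin N → ℂ)) × (Fin N → ℂ)) measurable_fst.snd measurable_snd
    fun_prop
  · refine lintegral_side_information hD (fun _ _ => (hD0 _ _).le) hD1 (by fun_prop)
      fun tf tp => le_of_eq ?_
    exact lintegral_avg hMc
      (g := fun wc y => vgauss s (y - (m.crossC • m.cog wc tf + α • tp + β • tf)))
        (fun w => by fun_prop) (fun w y => (vgauss_pos hs _).le)
        (fun w => lintegral_vgauss_sub hs _)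

/-- The cognitive message is averaged out instead of being given, so `mixC` replaces `kerC` and the
Gaussian in the output may not subtract the cognitive codeword. -/
theorem isTest_ratioPJoint
    (hD : Measurable fun p : (Fin N → ℂ) × (Fin N → ℂ) => D p.1 p.2) (hD0 : ∀ tf tp, 0 < D tf tp)
    (hD1 : ∫⁻ tf, ∫⁻ tp, ENNReal.ofReal (D tf tp) ≤ 1) {s : ℝ} (hs : 0 < s) (α β : ℂ)
    (hMc : 0 < Mc) : m.IsTest (m.ratioPJoint D s α β) := by
  have hDf : ∀ {γ : Type} [MeasurableSpace γ] {f g : γ → Fin N → ℂ}, Measurable f → Measurable g →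
    Measurable fun a => D (f a) (g a) := fun hf hg => hD.comp (hf.prodMk hg)
  refine m.isTest_of_primary (fun wp wc => ?_)
    (fun wp wc tf tp tc => ?_) hMc
    (J := fun _ y tf tp => D tf tp * vgauss s (y - (α • tp + β • tf)))
    (fun wp => ?_) (fun wp tf tp tc => ?_)
    (j := fun y => ∫⁻ tf, ∫⁻ tp, ENNReal.ofReal (D tf tp * vgauss s (y - (α • tp + β • tf))))
    ?_ (fun wp y => le_rfl) ?_
  · unfold ratioPJoint
    have := hDf (γ := (Fin N → ℂ) × (Fin N → ℂ) × (Fin N → ℂ)) measurable_fst measurable_snd.fst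
    fun_prop
  · have := guessWeight_pos m.decP wp (m.outP wp tc)
    have := m.kerF_pos wp tf
    have := m.kerP_pos wp tp
    have := m.mixC_pos hMc tf tc
    have := hD0 tf tp
    have := vgauss_pos hs (m.outP wp tc - α • tp - β • tf)
    unfold ratioPJoint; positivity
  · have := hDf (γ := (Fin N → ℂ) × (Fin N → ℂ) × (Fin N → ℂ)) measurable_snd.fst
      measurable_snd.snd
    fun_prop
  · refine le_of_eq ?_
    simp_rw [ratioPJoint, dens_eq, ← mul_assoc]
    rw [← Finset.mul_sum]
    have : (Mc : ℝ) ≠ 0 := by exact_mod_cast hMc.ne'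
    have hmix : ∑ wc, m.kerC wc tf tc = Mc * m.mixC tf tc := by
      rw [mixC]; field_simp
    rw [hmix]
    have := (m.mixC_pos hMc tf tc).ne'
    have := (m.kerF_pos wp tf).ne'
    have := (m.kerP_pos wp tp).ne'
    rw [← sub_sub]
    field_simp
  · refine measurable_lintegral_lintegral ?_
    have := hDf (γ := ((Fin N → ℂ) × (Fin N → ℂ)) × (Fin N → ℂ)) measurable_fst.snd measurable_snd
    fun_prop
  · exact lintegral_side_information hD (fun _ _ => (hD0 _ _).le) hD1 (by fun_prop)
      fun tf tp => (lintegral_vgauss_sub hs _).le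

end Side

/-! ### Likelihood ratios for the decoder of the cognitive receiver -/

/-- Likelihood ratio of the cognitive message for the output, given the primary message and the
feedback. -/
noncomputable def ratioCGiven (s : ℝ) : Signals N Mp Mc := fun wp wc tf tp _ =>
  guessWeight m.decC wc (m.outC wc tf tp) *
    vgauss s (m.outC wc tf tp - m.crossP • m.prim wp) / m.kerP wp tp

/-- Giving the primary message and the feedback to the cognitive receiver leaves, for each `tf`, the
mass of `mixF` times a posterior average of Gaussians in the output. -/
theorem isTest_ratioCGiven {s : ℝ} (hs : 0 < s) (hMp : 0 < Mp) : m.IsTest (m.ratioCGiven s) := by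
  refine m.isTest_of_cognitive (fun wp wc => by unfold ratioCGiven; fun_prop)
    (fun wp wc tf tp tc => ?_) hMp
    (J := fun wc y tf tc => ((Mp : ℝ)⁻¹ * ∑ wp, vgauss s (y - m.crossP • m.prim wp) *
      m.kerF wp tf) * m.kerC wc tf tc)
    (fun wc => by fun_prop) (fun wc tf tp tc => ?_)
    (j := fun y => ∫⁻ tf, ENNReal.ofReal ((Mp : ℝ)⁻¹ * ∑ wp,
      vgauss s (y - m.crossP • m.prim wp) * m.kerF wp tf)) ?_ (fun wc y => le_of_eq ?_)
    (le_of_eq ?_)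
  · have := guessWeight_pos m.decC wc (m.outC wc tf tp)
    have := m.kerP_pos wp tp
    have := vgauss_pos hs (m.outC wc tf tp - m.crossP • m.prim wp)
    unfold ratioCGiven; positivity
  · refine le_of_eq ?_
    simp_rw [ratioCGiven, dens_eq, Finset.mul_sum, Finset.sum_mul, Finset.mul_sum]
    refine Finset.sum_congr rfl fun wp _ => ?_
    have := (m.kerP_pos wp tp).ne'
    field_simp
  · exact Measurable.lintegral_prod_right (by fun_prop)
  · refine lintegral_congr fun tf => ?_
    simp_rw [ENNReal.ofReal_mul' (m.kerC_pos wc _ _).le]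
    rw [lintegral_const_mul' _ _ ENNReal.ofReal_ne_top, m.lintegral_kerC, mul_one]
  · rw [lintegral_lintegral_swap (Measurable.aemeasurable (by fun_prop)),
      ← m.lintegral_mixF hMp]
    refine lintegral_congr fun tf => ?_
    have : Nonempty (Fin Mp) := ⟨⟨0, hMp⟩⟩
    have hS : 0 < ∑ wp, m.kerF wp tf :=
      Finset.sum_pos (fun w _ => m.kerF_pos w _) Finset.univ_nonempty
    have hM : (Mp : ℝ) ≠ 0 := by exact_mod_cast hMp.ne'
    have h : ∀ y, ENNReal.ofReal ((Mp : ℝ)⁻¹ * ∑ wp, vgauss s (y - m.crossP • m.prim wp) *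
        m.kerF wp tf) = ENNReal.ofReal (m.mixF tf) *
        ENNReal.ofReal ((∑ wp, m.kerF wp tf * vgauss s (y - m.crossP • m.prim wp)) /
          ∑ wp, m.kerF wp tf) := fun y => by
      rw [← ENNReal.ofReal_mul (m.mixF_pos hMp _).le, mixF]
      simp_rw [mul_comm (m.kerF _ tf)]
      congr 1; field_simp
    simp_rw [h]
    rw [lintegral_const_mul' _ _ ENNReal.ofReal_ne_top,
      lintegral_weighted_average (fun w => m.kerF_pos w tf)
        (g := fun w y => vgauss s (y - m.crossP • m.prim w))
        (fun w => by fun_prop) (fun w y => (vgauss_pos hs _).le)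
        (fun w => lintegral_vgauss_sub hs _), mul_one]

/-- Likelihood ratio of the cognitive message for the output and the interference it causes, given
the primary message and the feedback. -/
noncomputable def ratioCSide (s : ℝ) (α : ℂ) : Signals N Mp Mc := fun wp wc tf tp tc =>
  guessWeight m.decC wc (m.outC wc tf tp) *
    (m.mixC tf tc * vgauss s (m.outC wc tf tp - m.crossP • m.prim wp - α • tc)) /
    (m.kerP wp tp * m.kerC wc tf tc)

/-- Likelihood ratio of the cognitive message for the output and the interference it causes, given
the feedback. -/
noncomputable def ratioCJoint (s : ℝ) (α β : ℂ) : Signals N Mp Mc := fun _ wc tf tp tc =>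
  guessWeight m.decC wc (m.outC wc tf tp) *
    (m.mixC tf tc * vgauss s (m.outC wc tf tp - α • tc - β • tf)) /
    (m.condP tf tp * m.kerC wc tf tc)

/-- Likelihood ratio of the cognitive message for the output, with the causally conditioned density
as numerator. -/
noncomputable def ratioCCausal (s : ℝ) : Signals N Mp Mc := fun _ wc tf tp _ =>
  guessWeight m.decC wc (m.outC wc tf tp) * vgauss s (m.outC wc tf tp) / m.causalP tf tp

/-- As in `isTest_ratioCGiven`, with `mixC` as test law for the extra observation `tc`; its negative
logarithm is what cancels a primary bound. -/
theorem isTest_ratioCSide {s : ℝ} (hs : 0 < s) (α : ℂ) (hMp : 0 < Mp) (hMc : 0 < Mc) :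
    m.IsTest (m.ratioCSide s α) := by
  refine m.isTest_of_cognitive (fun wp wc => by unfold ratioCSide; fun_prop)
    (fun wp wc tf tp tc => ?_) hMp
    (J := fun _ y tf tc => m.mixC tf tc * ((Mp : ℝ)⁻¹ * ∑ wp,
      m.kerF wp tf * vgauss s (y - (m.crossP • m.prim wp + α • tc))))
    (fun wc => by fun_prop) (fun wc tf tp tc => ?_)
    (j := fun y => ∫⁻ tf, ∫⁻ tc, ENNReal.ofReal (m.mixC tf tc * ((Mp : ℝ)⁻¹ * ∑ wp,
      m.kerF wp tf * vgauss s (y - (m.crossP • m.prim wp + α • tc))))) ?_ (fun wc y => le_rfl)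
    (le_of_eq ?_)
  · have := guessWeight_pos m.decC wc (m.outC wc tf tp)
    have := m.kerP_pos wp tp
    have := m.kerC_pos wc tf tc
    have := m.mixC_pos hMc tf tc
    have := vgauss_pos hs (m.outC wc tf tp - m.crossP • m.prim wp - α • tc)
    unfold ratioCSide; positivity
  · refine le_of_eq ?_
    simp_rw [ratioCSide, dens_eq, Finset.mul_sum]
    refine Finset.sum_congr rfl fun wp _ => ?_
    have := (m.kerP_pos wp tp).ne'
    have := (m.kerC_pos wc tf tc).ne'
    rw [← sub_sub]
    field_simp
  · exact measurable_lintegral_lintegral (by fun_prop)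
  · rw [← lintegral_rotate (f := fun tf tc y => ENNReal.ofReal (m.mixC tf tc * ((Mp : ℝ)⁻¹ *
      ∑ wp, m.kerF wp tf * vgauss s (y - (m.crossP • m.prim wp + α • tc))))) (by fun_prop),
      ← m.lintegral_mixF hMp]
    refine lintegral_congr fun tf => ?_
    have : Nonempty (Fin Mp) := ⟨⟨0, hMp⟩⟩
    have hS : 0 < ∑ wp, m.kerF wp tf :=
      Finset.sum_pos (fun w _ => m.kerF_pos w _) Finset.univ_nonempty
    have hM : (Mp : ℝ) ≠ 0 := by exact_mod_cast hMp.ne'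
    have h : ∀ tc y, ENNReal.ofReal (m.mixC tf tc * ((Mp : ℝ)⁻¹ *
        ∑ wp, m.kerF wp tf * vgauss s (y - (m.crossP • m.prim wp + α • tc)))) =
        ENNReal.ofReal (m.mixF tf) * (ENNReal.ofReal (m.mixC tf tc) *
        ENNReal.ofReal ((∑ wp, m.kerF wp tf * vgauss s (y - (m.crossP • m.prim wp + α • tc))) /
          ∑ wp, m.kerF wp tf)) := fun tc y => by
      rw [← ENNReal.ofReal_mul (m.mixC_pos hMc _ _).le, ← ENNReal.ofReal_mul (m.mixF_pos hMp _).le,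
        mixF]
      congr 1; field_simp
    simp_rw [h, lintegral_const_mul' _ _ ENNReal.ofReal_ne_top]
    have h2 : ∀ tc, ∫⁻ y, ENNReal.ofReal ((∑ wp, m.kerF wp tf *
        vgauss s (y - (m.crossP • m.prim wp + α • tc))) / ∑ wp, m.kerF wp tf) = 1 := fun tc =>
      lintegral_weighted_average (fun w => m.kerF_pos w tf)
        (g := fun w y => vgauss s (y - (m.crossP • m.prim w + α • tc)))
        (fun w => by fun_prop) (fun w y => (vgauss_pos hs _).le)
        (fun w => lintegral_vgauss_sub hs _)
    simp_rw [h2, mul_one]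
    rw [m.lintegral_mixC hMc, mul_one]

/-- Summing over the primary message gives `mixFP = mixF * condP` up to the factor `Mp`; the
denominator removes `condP`, and what remains is the true law `mixF` of the feedback. -/
theorem isTest_ratioCJoint {s : ℝ} (hs : 0 < s) (α β : ℂ) (hMp : 0 < Mp) (hMc : 0 < Mc) :
    m.IsTest (m.ratioCJoint s α β) := by
  refine m.isTest_of_cognitive (fun wp wc => by unfold ratioCJoint; fun_prop)
    (fun wp wc tf tp tc => ?_) hMp
    (J := fun _ y tf tc => (m.mixF tf * m.mixC tf tc) * vgauss s (y - (α • tc + β • tf)))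
    (fun wc => by fun_prop) (fun wc tf tp tc => ?_)
    (j := fun y => ∫⁻ tf, ∫⁻ tc, ENNReal.ofReal ((m.mixF tf * m.mixC tf tc) *
      vgauss s (y - (α • tc + β • tf)))) ?_ (fun wc y => le_rfl) ?_
  · have := guessWeight_pos m.decC wc (m.outC wc tf tp)
    have := m.condP_pos hMp tf tp
    have := m.kerC_pos wc tf tc
    have := m.mixC_pos hMc tf tc
    have := vgauss_pos hs (m.outC wc tf tp - α • tc - β • tf)
    unfold ratioCJoint; positivity
  · refine le_of_eq ?_
    have hM : (Mp : ℝ) ≠ 0 := by exact_mod_cast hMp.ne'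
    simp_rw [ratioCJoint, dens_eq]
    rw [← Finset.mul_sum, ← Finset.sum_mul]
    have hmix : ∑ wp, m.kerF wp tf * m.kerP wp tp = Mp * m.mixFP tf tp := by
      rw [mixFP]; field_simp
    have h1 := (m.mixFP_pos hMp tf tp).ne'
    have h2 := (m.mixF_pos hMp tf).ne'
    have := (m.kerC_pos wc tf tc).ne'
    rw [← sub_sub, hmix, condP]
    field_simp
  · exact measurable_lintegral_lintegral (by fun_prop)
  · refine lintegral_side_information (D := fun tf tc => m.mixF tf * m.mixC tf tc) (by fun_prop)
      (fun _ _ => (mul_pos (m.mixF_pos hMp _) (m.mixC_pos hMc _ _)).le) (le_of_eq ?_) (by fun_prop)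
      fun tf tc => (lintegral_vgauss_sub hs _).le
    simp_rw [ENNReal.ofReal_mul (m.mixF_pos hMp _).le,
      lintegral_const_mul' _ _ ENNReal.ofReal_ne_top, m.lintegral_mixC hMc, mul_one]
    exact m.lintegral_mixF hMp

/-- Dividing `mixFP` by `causalP` leaves `causalF`. For given output and cognitive message, `tp` is
the output minus the scaled cognitive codeword, a strictly causal function of `tf`, so
`lintegral_causalF` applies. This is the only test that uses the causality of the cognitive encoder.
-/
theorem isTest_ratioCCausal {s : ℝ} (hs : 0 < s) (hMp : 0 < Mp) :
    m.IsTest (m.ratioCCausal s) := by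
  refine m.isTest_of_cognitive (fun wp wc => by unfold ratioCCausal; fun_prop)
    (fun wp wc tf tp tc => ?_) hMp
    (J := fun wc y tf tc => vgauss s y * (m.causalF tf (y - m.direct • m.cog wc tf) *
      m.kerC wc tf tc))
    (fun wc => by fun_prop) (fun wc tf tp tc => ?_)
    (j := fun y => ENNReal.ofReal (vgauss s y)) (by fun_prop) (fun wc y => le_of_eq ?_)
    (lintegral_vgauss hs).le
  · have := guessWeight_pos m.decC wc (m.outC wc tf tp)
    have := m.causalP_pos hMp tf tp
    have := vgauss_pos hs (m.outC wc tf tp)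
    unfold ratioCCausal; positivity
  · refine le_of_eq ?_
    have hM : (Mp : ℝ) ≠ 0 := by exact_mod_cast hMp.ne'
    have htp : m.outC wc tf tp - m.direct • m.cog wc tf = tp := by simp [outC]
    simp_rw [ratioCCausal, dens_eq]
    rw [← Finset.mul_sum, ← Finset.sum_mul]
    have hmix : ∑ wp, m.kerF wp tf * m.kerP wp tp = Mp * m.mixFP tf tp := by
      rw [mixFP]; field_simp
    have h1 := (m.causalP_pos hMp tf tp).ne'
    rw [hmix, ← m.causalP_mul_causalF hMp, htp]
    field_simp
  · simp_rw [ENNReal.ofReal_mul (vgauss_pos hs _).le,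
      ENNReal.ofReal_mul (m.causalF_pos hMp _ _).le,
      lintegral_const_mul' _ _ ENNReal.ofReal_ne_top, m.lintegral_kerC, mul_one]
    rw [m.lintegral_causalF hMp (by fun_prop), mul_one]
    intro i k hik t z
    simp [m.causal_cog wc i k hik]

end CausalModel

/-! ### Upper bounds on means -/

/-- `f` is integrable with integral at most `a`. -/
def MeanLe {Ω : Type*} [MeasurableSpace Ω] (μ : Measure Ω) (f : Ω → ℝ) (a : ℝ) : Prop :=
  Integrable f μ ∧ ∫ ω, f ω ∂μ ≤ a

section MeanLe

variable {Ω : Type*} [MeasurableSpace Ω] {μ : Measure Ω} {f g : Ω → ℝ} {a b : ℝ}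

theorem MeanLe.add (hf : MeanLe μ f a) (hg : MeanLe μ g b) :
    MeanLe μ (fun ω => f ω + g ω) (a + b) :=
  ⟨hf.1.add hg.1, by rw [integral_add hf.1 hg.1]; exact add_le_add hf.2 hg.2⟩

theorem MeanLe.integral_le (hg : MeanLe μ g b) (hf : Integrable f μ) (hfg : ∀ ω, f ω ≤ g ω) :
    ∫ ω, f ω ∂μ ≤ b :=
  (integral_mono hf hg.1 hfg).trans hg.2

theorem meanLe_of_lintegral_le (hf : Measurable f) (hf0 : ∀ ω, 0 ≤ f ω) (ha : 0 ≤ a)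
    (h : ∫⁻ ω, ENNReal.ofReal (f ω) ∂μ ≤ ENNReal.ofReal a) : MeanLe μ f a := by
  refine ⟨⟨hf.aestronglyMeasurable, ?_⟩, ?_⟩
  · rw [hasFiniteIntegral_iff_ofReal (ae_of_all _ hf0)]
    exact h.trans_lt ENNReal.ofReal_lt_top
  · rw [integral_eq_lintegral_of_nonneg_ae (ae_of_all _ hf0) hf.aestronglyMeasurable]
    exact ENNReal.toReal_le_of_le_ofReal ha h

end MeanLe

/-- Change of variables from the noises to the signals, for causal shifts. -/
theorem lintegral_noise_eq {N : ℕ} {H : (Fin N → ℂ) → (Fin N → ℂ) → (Fin N → ℂ) → ℝ≥0∞}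
    (hH : Measurable fun p : (Fin N → ℂ) × (Fin N → ℂ) × (Fin N → ℂ) => H p.1 p.2.1 p.2.2)
    (a b : Fin N → ℂ) {g : (Fin N → ℂ) → Fin N → ℂ} (hg : Measurable g) :
    ∫⁻ zf, ∫⁻ zc, ∫⁻ zp, H (a + zf) (b + zc) (g (a + zf) + zp)
        ∂(Measure.pi fun _ => stdComplexGaussian) ∂(Measure.pi fun _ => stdComplexGaussian)
        ∂(Measure.pi fun _ => stdComplexGaussian) =
      ∫⁻ tf, ∫⁻ tp, ∫⁻ tc, H tf tp tc * (ENNReal.ofReal (vgauss 1 (tf - a)) *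
        ENNReal.ofReal (vgauss 1 (tp - b)) * ENNReal.ofReal (vgauss 1 (tc - g tf))) := by
  have h3 : ∀ tf tp, ∫⁻ zp, H tf tp (g tf + zp) ∂(Measure.pi fun _ => stdComplexGaussian) =
      ∫⁻ tc, H tf tp tc * ENNReal.ofReal (vgauss 1 (tc - g tf)) := fun tf tp => by
    rw [lintegral_pi_stdComplexGaussian (f := fun zp => H tf tp (g tf + zp))
      (hH.comp (by fun_prop : Measurable fun zp => (tf, tp, g tf + zp))) (g tf)]
    simp only [add_sub_cancel]
  have m3 : Measurable fun q : (Fin N → ℂ) × (Fin N → ℂ) =>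
      ∫⁻ tc, H q.1 q.2 tc * ENNReal.ofReal (vgauss 1 (tc - g q.1)) := by
    refine Measurable.lintegral_prod_right' (f := fun p : ((Fin N → ℂ) × (Fin N → ℂ)) ×
      (Fin N → ℂ) => H p.1.1 p.1.2 p.2 * ENNReal.ofReal (vgauss 1 (p.2 - g p.1.1))) ?_
    have := hH.comp (by fun_prop :
      Measurable fun p : ((Fin N → ℂ) × (Fin N → ℂ)) × (Fin N → ℂ) => (p.1.1, p.1.2, p.2))
    simp only [Function.comp_def] at this
    fun_prop
  simp_rw [h3]
  have h2 : ∀ tf, ∫⁻ zc, (∫⁻ tc, H tf (b + zc) tc * ENNReal.ofReal (vgauss 1 (tc - g tf)))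
      ∂(Measure.pi fun _ => stdComplexGaussian) =
      ∫⁻ tp, (∫⁻ tc, H tf tp tc * ENNReal.ofReal (vgauss 1 (tc - g tf))) *
        ENNReal.ofReal (vgauss 1 (tp - b)) := fun tf => by
    rw [lintegral_pi_stdComplexGaussian
      (f := fun zc => ∫⁻ tc, H tf (b + zc) tc * ENNReal.ofReal (vgauss 1 (tc - g tf)))
      (m3.comp (by fun_prop : Measurable fun zc => (tf, b + zc))) b]
    simp only [add_sub_cancel]
  simp_rw [h2]
  rw [lintegral_pi_stdComplexGaussian (f := fun zf => ∫⁻ tp, (∫⁻ tc, H (a + zf) tp tc *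
      ENNReal.ofReal (vgauss 1 (tc - g (a + zf)))) * ENNReal.ofReal (vgauss 1 (tp - b))) ?_ a]
  · simp only [add_sub_cancel, ← lintegral_mul_const' _ _ ENNReal.ofReal_ne_top]
    refine lintegral_congr fun tf => lintegral_congr fun tp => lintegral_congr fun tc => ?_
    ring
  · refine Measurable.lintegral_prod_right' (f := fun q : (Fin N → ℂ) × (Fin N → ℂ) =>
      (∫⁻ tc, H (a + q.1) q.2 tc * ENNReal.ofReal (vgauss 1 (tc - g (a + q.1)))) *
        ENNReal.ofReal (vgauss 1 (q.2 - b))) ?_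
    have := m3.comp (by fun_prop :
      Measurable fun q : (Fin N → ℂ) × (Fin N → ℂ) => (a + q.1, q.2))
    simp only [Function.comp_def] at this
    fun_prop

theorem CausalModel.lintegral_noise_dens {N Mp Mc : ℕ} (m : CausalModel N Mp Mc)
    {F : (Fin N → ℂ) → (Fin N → ℂ) → (Fin N → ℂ) → ℝ}
    (hF : Measurable fun p : (Fin N → ℂ) × (Fin N → ℂ) × (Fin N → ℂ) => F p.1 p.2.1 p.2.2)
    (hF0 : ∀ tf tp tc, 0 ≤ F tf tp tc) (wp : Fin Mp) (wc : Fin Mc) :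
    ∫⁻ zf, ∫⁻ zc, ∫⁻ zp, ENNReal.ofReal (F (m.feedback • m.prim wp + zf)
        (m.crossP • m.prim wp + zc) (m.crossC • m.cog wc (m.feedback • m.prim wp + zf) + zp))
        ∂(Measure.pi fun _ => stdComplexGaussian) ∂(Measure.pi fun _ => stdComplexGaussian)
        ∂(Measure.pi fun _ => stdComplexGaussian) =
      ∫⁻ p : (Fin N → ℂ) × (Fin N → ℂ) × (Fin N → ℂ),
        ENNReal.ofReal (F p.1 p.2.1 p.2.2 * m.dens wp wc p.1 p.2.1 p.2.2) := by
  have hcog := m.measurable_cog wc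
  rw [lintegral_triple (by fun_prop)]
  rw [lintegral_noise_eq (H := fun tf tp tc => ENNReal.ofReal (F tf tp tc)) hF.ennreal_ofReal
    (m.feedback • m.prim wp) (m.crossP • m.prim wp)
    (g := fun tf => m.crossC • m.cog wc tf) (by fun_prop)]
  have hv := fun v : Fin N → ℂ => (vgauss_pos one_pos v).le
  refine lintegral_congr fun tf => lintegral_congr fun tp => lintegral_congr fun tc => ?_
  rw [← ENNReal.ofReal_mul (hv _), ← ENNReal.ofReal_mul (mul_nonneg (hv _) (hv _)),
    ← ENNReal.ofReal_mul (hF0 _ _ _), CausalModel.dens]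

/-! ### The symmetric channel as a causal model -/

/-- Signals of a code over the symmetric channel. -/
noncomputable def symModel (S I C θp θc : ℝ) {N Mp Mc : ℕ} (c : CCICCode N Mp Mc) :
    CausalModel N Mp Mc where
  prim w i := c.encP i w
  cog w t i := c.encC i w fun j => t (j.castLE i.isLt.le)
  measurable_cog w := measurable_pi_lambda _ fun i => (c.measurable_encC i w).comp (by fun_prop)
  causal_cog w i j hij t z := by
    congr 1
    funext l
    refine Function.update_of_ne (fun h => ?_) _ _
    have h1 := congrArg Fin.val h
    have h2 := l.isLt
    simp only [Fin.val_castLE] at h1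
    omega
  decP := c.decP
  measurable_decP := c.measurable_decP
  decC := c.decC
  measurable_decC := c.measurable_decC
  direct := (Real.sqrt S : ℂ)
  crossP := (Real.sqrt I : ℂ) * Complex.exp (θp * Complex.I)
  crossC := (Real.sqrt I : ℂ) * Complex.exp (θc * Complex.I)
  feedback := (Real.sqrt C : ℂ)

namespace SymChannel

open CCICOutcome

variable {S I C θp θc : ℝ} {N Mp Mc : ℕ} {c : CCICCode N Mp Mc}

local notation "𝔠" => GCCIC.symmetric S I C θp θc
local notation "𝔪" => symModel S I C θp θc c

theorem yP_eq (ω : CCICOutcome N Mp Mc) :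
    GCCIC.yP 𝔠 c ω = (𝔪).outP (wp ω) (GCCIC.tC 𝔠 c ω) := rfl

theorem yC_eq (ω : CCICOutcome N Mp Mc) :
    GCCIC.yC 𝔠 c ω = (𝔪).outC (wc ω) (GCCIC.tF 𝔠 c ω) (GCCIC.tP 𝔠 c ω) := rfl

theorem measurable_tF : Measurable (GCCIC.tF 𝔠 c) := by
  refine measurable_pi_lambda _ fun i => ?_
  have := GCCIC.measurable_xP c i
  unfold GCCIC.tF; fun_prop

theorem measurable_tP : Measurable (GCCIC.tP 𝔠 c) := by
  refine measurable_pi_lambda _ fun i => ?_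
  have := GCCIC.measurable_xP c i
  unfold GCCIC.tP; fun_prop

theorem measurable_tC : Measurable (GCCIC.tC 𝔠 c) := by
  refine measurable_pi_lambda _ fun i => ?_
  have := GCCIC.measurable_xC 𝔠 c i
  unfold GCCIC.tC; fun_prop

/-- A function of messages and signals as a random variable. -/
noncomputable def eval (S I C θp θc : ℝ) (c : CCICCode N Mp Mc) (F : Signals N Mp Mc)
    (ω : CCICOutcome N Mp Mc) : ℝ :=
  F (wp ω) (wc ω) (GCCIC.tF (GCCIC.symmetric S I C θp θc) c ω)
    (GCCIC.tP (GCCIC.symmetric S I C θp θc) c ω) (GCCIC.tC (GCCIC.symmetric S I C θp θc) c ω)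

theorem measurable_eval {F : Signals N Mp Mc} (hF : F.Meas) :
    Measurable (eval S I C θp θc c F) := by
  refine measurable_of_outcome fun wp wc => ?_
  have h1 := (measurable_tF (S := S) (I := I) (C := C) (θp := θp) (θc := θc) (c := c))
  have h2 := (measurable_tP (S := S) (I := I) (C := C) (θp := θp) (θc := θc) (c := c))
  have h3 := (measurable_tC (S := S) (I := I) (C := C) (θp := θp) (θc := θc) (c := c))
  have hi : Measurable fun z : (Fin N → ℂ) × (Fin N → ℂ) × (Fin N → ℂ) =>
    ((wp, wc, z) : CCICOutcome N Mp Mc) := by fun_prop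
  exact (hF wp wc).comp ((h1.comp hi).prodMk ((h2.comp hi).prodMk (h3.comp hi)))

/-- This joins the two descriptions: expectations over messages and noises become integrals against
the density of the signals. -/
theorem lintegral_eval_eq {F : Signals N Mp Mc} (hF : F.Meas) (hF0 : F.Nonneg) :
    ∫⁻ ω, ENNReal.ofReal (eval S I C θp θc c F ω) ∂(ccicLaw N Mp Mc) = (𝔪).mean F := by
  rw [lintegral_ccicLaw (measurable_eval hF).ennreal_ofReal, CausalModel.mean]
  congr 1
  refine Finset.sum_congr rfl fun wp _ => ?_
  congr 1
  refine Finset.sum_congr rfl fun wc _ => ?_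
  have e1 : ∀ zf zc zp : Fin N → ℂ, eval S I C θp θc c F (wp, wc, zp, zc, zf) =
      F wp wc ((𝔪).feedback • (𝔪).prim wp + zf) ((𝔪).crossP • (𝔪).prim wp + zc)
        ((𝔪).crossC • (𝔪).cog wc ((𝔪).feedback • (𝔪).prim wp + zf) + zp) := fun _ _ _ => rfl
  simp only [e1]
  exact (𝔪).lintegral_noise_dens (hF wp wc) (hF0 wp wc) wp wc

theorem meanLe_eval {F : Signals N Mp Mc} (h : (𝔪).IsTest F) :
    MeanLe (ccicLaw N Mp Mc) (eval S I C θp θc c F) 2 :=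
  meanLe_of_lintegral_le (measurable_eval h.1) (fun ω => h.2.1 _ _ _ _ _) (by norm_num)
    (by rw [lintegral_eval_eq h.1 h.2.1]; simpa using h.2.2)

/-! ### Gaussian terms -/

/-- The counterpart of "a Gaussian maximises entropy": the negative log-density is affine in the
energy, so only a second moment of `v` is needed, and `hle` bounds the energy term by `N`. -/
theorem meanLe_neg_log_vgauss (hMp : 0 < Mp) (hMc : 0 < Mc) (hc : GCCIC.PowerConstraint 𝔠 c)
    {s : ℝ} (hs : 0 < s) {v : CCICOutcome N Mp Mc → Fin N → ℂ} (k h a b d : ℂ)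
    (hv : ∀ ω i, v ω i = k * GCCIC.xP c ω i + h * GCCIC.xC 𝔠 c ω i + a * zp ω i + b * zc ω i +
      d * zf ω i)
    (hle : (‖k‖ + ‖h‖) ^ 2 + ‖a‖ ^ 2 + ‖b‖ ^ 2 + ‖d‖ ^ 2 ≤ s) :
    MeanLe (ccicLaw N Mp Mc) (fun ω => -Real.log (vgauss s (v ω)))
      (N * Real.log s + N * (Real.log Real.pi + 1)) := by
  have := isProbabilityMeasure_ccicLaw (N := N) hMp hMc
  have hve : ∀ ω, v ω = GCCIC.combo 𝔠 c k h a b d ω := fun ω => funext fun i => hv ω i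
  have hi := GCCIC.integrable_energy_combo 𝔠 hMp hMc hc k h a b d
  have hle' := GCCIC.integral_energy_combo_le 𝔠 hMp hMc hc k h a b d
  have e : ∀ ω, -Real.log (vgauss s (v ω)) = N * (Real.log Real.pi + Real.log s) +
      energy (GCCIC.combo 𝔠 c k h a b d ω) / s := fun ω => by
    rw [log_vgauss hs, hve]; ring
  simp_rw [e]
  refine ⟨(integrable_const _).add (hi.div_const s), ?_⟩
  rw [integral_add (integrable_const _) (hi.div_const s), integral_div, integral_const]
  simp only [probReal_univ, one_smul]
  have h1 : (∫ ω, energy (GCCIC.combo 𝔠 c k h a b d ω) ∂(ccicLaw N Mp Mc)) / s ≤ N := by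
    rw [div_le_iff₀ hs]
    exact hle'.trans (mul_le_mul_of_nonneg_left hle (Nat.cast_nonneg N))
  linarith

/-- Minus the entropy of a noise sequence. In every outer bound these terms match the `N (log π +
1)` of the Gaussian test densities one for one. -/
theorem meanLe_log_noise (hMp : 0 < Mp) (hMc : 0 < Mc) {Z : CCICOutcome N Mp Mc → Fin N → ℂ}
    (hZ : Measurable Z)
    (h : ∀ i, ∫⁻ ω, ENNReal.ofReal (‖Z ω i‖ ^ 2) ∂(ccicLaw N Mp Mc) = 1) :
    MeanLe (ccicLaw N Mp Mc) (fun ω => Real.log (vgauss 1 (Z ω)))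
      (-(N * (Real.log Real.pi + 1))) := by
  have := isProbabilityMeasure_ccicLaw (N := N) hMp hMc
  obtain ⟨h1, hi⟩ := GCCIC.integral_energy_noise hZ h
  have e : ∀ ω, Real.log (vgauss 1 (Z ω)) = -(N * Real.log Real.pi) + -energy (Z ω) := fun ω => by
    rw [log_vgauss one_pos]; simp; ring
  simp_rw [e]
  refine ⟨(integrable_const _).add hi.neg, ?_⟩
  rw [integral_add (integrable_const _) (by exact hi.neg), integral_neg, integral_neg, h1,
    integral_const]
  simp only [probReal_univ, one_smul]
  linarith

theorem meanLe_log_kerC (hMp : 0 < Mp) (hMc : 0 < Mc) :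
    MeanLe (ccicLaw N Mp Mc)
      (fun ω => Real.log ((𝔪).kerC (wc ω) (GCCIC.tF 𝔠 c ω) (GCCIC.tC 𝔠 c ω)))
      (-(N * (Real.log Real.pi + 1))) := by
  have e : ∀ ω : CCICOutcome N Mp Mc,
      (𝔪).kerC (wc ω) (GCCIC.tF 𝔠 c ω) (GCCIC.tC 𝔠 c ω) = vgauss 1 (zp ω) := fun ω => by
    rw [CausalModel.kerC]
    congr 1
    exact add_sub_cancel_left (((𝔪).crossC) • (𝔪).cog (wc ω) (GCCIC.tF 𝔠 c ω)) (zp ω)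
  simp_rw [e]
  exact meanLe_log_noise hMp hMc measurable_zp (lintegral_normSq_zp hMp hMc)

theorem meanLe_log_kerP (hMp : 0 < Mp) (hMc : 0 < Mc) :
    MeanLe (ccicLaw N Mp Mc) (fun ω => Real.log ((𝔪).kerP (wp ω) (GCCIC.tP 𝔠 c ω)))
      (-(N * (Real.log Real.pi + 1))) := by
  have e : ∀ ω : CCICOutcome N Mp Mc,
      (𝔪).kerP (wp ω) (GCCIC.tP 𝔠 c ω) = vgauss 1 (zc ω) := fun ω => by
    rw [CausalModel.kerP]
    congr 1
    exact add_sub_cancel_left (((𝔪).crossP) • (𝔪).prim (wp ω)) (zc ω)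
  simp_rw [e]
  exact meanLe_log_noise hMp hMc measurable_zc (lintegral_normSq_zc hMp hMc)

theorem meanLe_log_kerF (hMp : 0 < Mp) (hMc : 0 < Mc) :
    MeanLe (ccicLaw N Mp Mc) (fun ω => Real.log ((𝔪).kerF (wp ω) (GCCIC.tF 𝔠 c ω)))
      (-(N * (Real.log Real.pi + 1))) := by
  have e : ∀ ω : CCICOutcome N Mp Mc,
      (𝔪).kerF (wp ω) (GCCIC.tF 𝔠 c ω) = vgauss 1 (zf ω) := fun ω => by
    rw [CausalModel.kerF]
    congr 1
    exact add_sub_cancel_left (((𝔪).feedback) • (𝔪).prim (wp ω)) (zf ω)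
  simp_rw [e]
  exact meanLe_log_noise hMp hMc measurable_zf (lintegral_normSq_zf hMp hMc)

/-! ### The decoders -/

/-- Logarithm of the number of messages where the primary receiver is right, and `0` elsewhere. -/
noncomputable def gainP (S I C θp θc : ℝ) (c : CCICCode N Mp Mc) (ω : CCICOutcome N Mp Mc) : ℝ :=
  Real.log (guessWeight c.decP (wp ω) (GCCIC.yP (GCCIC.symmetric S I C θp θc) c ω))

/-- Logarithm of the number of messages where the cognitive receiver is right, and `0`
elsewhere. -/
noncomputable def gainC (S I C θp θc : ℝ) (c : CCICCode N Mp Mc) (ω : CCICOutcome N Mp Mc) : ℝ :=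
  Real.log (guessWeight c.decC (wc ω) (GCCIC.yC (GCCIC.symmetric S I C θp θc) c ω))

theorem integral_indicator_compl {Ω : Type*} [MeasurableSpace Ω] {μ : Measure Ω}
    [IsProbabilityMeasure μ] {A : Set Ω} (hA : MeasurableSet A) {f : Ω → ℝ} {r : ℝ}
    (hf : ∀ ω, f ω = Aᶜ.indicator (fun _ => r) ω) :
    Integrable f μ ∧ ∫ ω, f ω ∂μ = (1 - (μ A).toReal) * r := by
  have hf' : f = Aᶜ.indicator fun _ => r := funext hf
  rw [hf']
  refine ⟨(integrable_const r).indicator hA.compl, ?_⟩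
  rw [integral_indicator_const _ hA.compl, probReal_compl_eq_one_sub hA]
  rfl

theorem measurable_wp : Measurable (wp (N := N) (Mp := Mp) (Mc := Mc)) := by unfold wp; fun_prop

theorem measurable_wc : Measurable (wc (N := N) (Mp := Mp) (Mc := Mc)) := by unfold wc; fun_prop

theorem measurable_yP : Measurable (GCCIC.yP 𝔠 c) := by
  refine measurable_pi_lambda _ fun i => ?_
  have h1 := GCCIC.measurable_xP c i
  have h2 := (measurable_tC (S := S) (I := I) (C := C) (θp := θp) (θc := θc) (c := c))
  unfold GCCIC.yP; fun_prop

theorem measurable_yC : Measurable (GCCIC.yC 𝔠 c) := by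
  refine measurable_pi_lambda _ fun i => ?_
  have h1 := GCCIC.measurable_xC 𝔠 c i
  have h2 := (measurable_tP (S := S) (I := I) (C := C) (θp := θp) (θc := θc) (c := c))
  unfold GCCIC.yC; fun_prop

theorem integral_gainP (hMp : 0 < Mp) (hMc : 0 < Mc) :
    Integrable (gainP S I C θp θc c) (ccicLaw N Mp Mc) ∧
    ∫ ω, gainP S I C θp θc c ω ∂(ccicLaw N Mp Mc) =
      (1 - (GCCIC.errP 𝔠 c).toReal) * Real.log Mp := by
  have := isProbabilityMeasure_ccicLaw (N := N) hMp hMc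
  refine integral_indicator_compl (MeasurableSet.compl (measurableSet_eq_fun
    (c.measurable_decP.comp measurable_yP) measurable_wp)) fun ω => ?_
  rw [gainP, log_guessWeight, Set.indicator]
  congr 1
  simp [Function.comp]

theorem integral_gainC (hMp : 0 < Mp) (hMc : 0 < Mc) :
    Integrable (gainC S I C θp θc c) (ccicLaw N Mp Mc) ∧
    ∫ ω, gainC S I C θp θc c ω ∂(ccicLaw N Mp Mc) =
      (1 - (GCCIC.errC 𝔠 c).toReal) * Real.log Mc := by
  have := isProbabilityMeasure_ccicLaw (N := N) hMp hMc
  refine integral_indicator_compl (MeasurableSet.compl (measurableSet_eq_fun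
    (c.measurable_decC.comp measurable_yC) measurable_wc)) fun ω => ?_
  rw [gainC, log_guessWeight, Set.indicator]
  congr 1
  simp [Function.comp]

end SymChannel

/-- `log x ≤ x - 1` at `x = g * q / p`, with the `-1` given away. -/
theorem log_le_ratio {g q p : ℝ} (hg : 0 < g) (hq : 0 < q) (hp : 0 < p) :
    Real.log g ≤ g * q / p - Real.log q + Real.log p := by
  have h := Real.log_le_sub_one_of_pos (show 0 < g * q / p by positivity)
  rw [Real.log_div (by positivity) hp.ne', Real.log_mul hg.ne' hq.ne'] at h
  linarith

/-! ### From codes to the capacity region -/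

/-- Rounding down a number that is at least one loses at most a factor of two, a constant in the
logarithm. -/
theorem log_numMessages_ge (N : ℕ) {R : ℝ} (hR : 0 ≤ R) :
    N * R * Real.log 2 - Real.log 2 ≤ Real.log (GCCIC.numMessages N R) ∧
      0 < GCCIC.numMessages N R := by
  have h1 : (1 : ℝ) ≤ (2 : ℝ) ^ ((N : ℝ) * R) := Real.one_le_rpow (by norm_num) (by positivity)
  have hpos : 0 < GCCIC.numMessages N R := Nat.floor_pos.2 h1
  refine ⟨?_, hpos⟩
  have hlt : (2 : ℝ) ^ ((N : ℝ) * R) < GCCIC.numMessages N R + 1 := Nat.lt_floor_add_one _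
  have h1' : (1 : ℝ) ≤ GCCIC.numMessages N R := by exact_mod_cast hpos
  have h2 : (2 : ℝ) ^ ((N : ℝ) * R) / 2 ≤ GCCIC.numMessages N R := by linarith
  have h3 := Real.log_le_log (by positivity) h2
  rwa [Real.log_div (by positivity) (by norm_num), Real.log_rpow (by norm_num)] at h3

/-- The half-plane is closed and convex, so only achievable pairs matter. For these, after division
by `N`, the error probabilities, the rounding loss and `K` all vanish in the limit. -/
theorem capacityRegion_le (ch : GCCIC) {k l B K : ℝ} (hk : 0 ≤ k) (hl : 0 ≤ l)
    (h : ∀ (N Mp Mc : ℕ) (c : CCICCode N Mp Mc), 0 < Mp → 0 < Mc → ch.PowerConstraint c →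
      k * ((1 - (ch.errP c).toReal) * Real.log Mp) + l * ((1 - (ch.errC c).toReal) * Real.log Mc) ≤
        N * B + K) {R : ℝ × ℝ} (hR : R ∈ ch.capacityRegion) :
    k * R.1 + l * R.2 ≤ B / Real.log 2 := by
  have hlog : 0 < Real.log 2 := Real.log_pos (by norm_num)
  have hclosed : IsClosed {R : ℝ × ℝ | k * R.1 + l * R.2 ≤ B / Real.log 2} :=
    isClosed_le (by fun_prop) continuous_const
  have hconv : Convex ℝ {R : ℝ × ℝ | k * R.1 + l * R.2 ≤ B / Real.log 2} := by
    intro x hx y hy a b ha hb hab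
    simp only [Set.mem_ofPred_eq, Prod.fst_add, Prod.snd_add, Prod.smul_fst, Prod.smul_snd,
      smul_eq_mul] at *
    have h1 := mul_le_mul_of_nonneg_left hx ha
    have h2 := mul_le_mul_of_nonneg_left hy hb
    have h3 : a * (B / Real.log 2) + b * (B / Real.log 2) = B / Real.log 2 := by
      rw [← add_mul, hab, one_mul]
    linarith
  refine closure_minimal (convexHull_min ?_ hconv) hclosed hR
  rintro R ⟨h1, h2, code, hpow, herr⟩
  have hP : Tendsto (fun N => (ch.errP (code N)).toReal) atTop (𝓝 0) := by
    have := tendsto_of_tendsto_of_tendsto_of_le_of_le tendsto_const_nhds herr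
      (fun N => zero_le) (fun N => le_max_left (ch.errP (code N)) (ch.errC (code N)))
    exact (ENNReal.tendsto_toReal ENNReal.zero_ne_top).comp this
  have hC : Tendsto (fun N => (ch.errC (code N)).toReal) atTop (𝓝 0) := by
    have := tendsto_of_tendsto_of_tendsto_of_le_of_le tendsto_const_nhds herr
      (fun N => zero_le) (fun N => le_max_right (ch.errP (code N)) (ch.errC (code N)))
    exact (ENNReal.tendsto_toReal ENNReal.zero_ne_top).comp this
  have hinv : Tendsto (fun N : ℕ => ((N : ℝ))⁻¹) atTop (𝓝 0) := tendsto_inv_atTop_nhds_zero_nat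
  have hL : Tendsto (fun N : ℕ =>
      k * ((1 - (ch.errP (code N)).toReal) * (R.1 * Real.log 2 - Real.log 2 * ((N : ℝ))⁻¹)) +
      l * ((1 - (ch.errC (code N)).toReal) * (R.2 * Real.log 2 - Real.log 2 * ((N : ℝ))⁻¹)))
      atTop (𝓝 (k * ((1 - 0) * (R.1 * Real.log 2 - Real.log 2 * 0)) +
        l * ((1 - 0) * (R.2 * Real.log 2 - Real.log 2 * 0)))) :=
    (((hP.const_sub 1).mul ((hinv.const_mul _).const_sub _)).const_mul k).add
      (((hC.const_sub 1).mul ((hinv.const_mul _).const_sub _)).const_mul l)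
  have hRt : Tendsto (fun N : ℕ => B + K * ((N : ℝ))⁻¹) atTop (𝓝 (B + K * 0)) :=
    (hinv.const_mul K).const_add B
  have hle := le_of_tendsto_of_tendsto hL hRt (by
    filter_upwards [eventually_gt_atTop 0] with N hN
    obtain ⟨l1, p1⟩ := log_numMessages_ge N h1
    obtain ⟨l2, p2⟩ := log_numMessages_ge N h2
    have hb := h N _ _ (code N) p1 p2 (hpow N)
    have := isProbabilityMeasure_ccicLaw (N := N) p1 p2
    have e1 : 0 ≤ 1 - (ch.errP (code N)).toReal :=
      sub_nonneg.2 (ENNReal.toReal_le_of_le_ofReal zero_le_one (by rw [ENNReal.ofReal_one]; exact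
        prob_le_one))
    have e2 : 0 ≤ 1 - (ch.errC (code N)).toReal :=
      sub_nonneg.2 (ENNReal.toReal_le_of_le_ofReal zero_le_one (by rw [ENNReal.ofReal_one]; exact
        prob_le_one))
    have hN' : (0 : ℝ) < N := by exact_mod_cast hN
    have b1 := mul_le_mul_of_nonneg_left (mul_le_mul_of_nonneg_left l1 e1) hk
    have b2 := mul_le_mul_of_nonneg_left (mul_le_mul_of_nonneg_left l2 e2) hl
    have hfin := (add_le_add b1 b2).trans hb
    refine le_of_mul_le_mul_left (le_of_eq_of_le ?_ (hfin.trans_eq ?_)) hN'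
    · field_simp
    · field_simp)
  simp only [sub_zero, mul_zero, one_mul, add_zero] at hle
  rw [Set.mem_ofPred_eq, le_div_iff₀ hlog]
  linarith

/-! ### Linear estimation errors and their second moments -/

namespace SymChannel

open CCICOutcome

/-- Complex gain of an interfering link. -/
noncomputable def crossGain (I θ : ℝ) : ℂ := (Real.sqrt I : ℂ) * Complex.exp (θ * Complex.I)

theorem norm_crossGain (I θ : ℝ) : ‖crossGain I θ‖ = Real.sqrt I := by
  rw [crossGain, norm_mul, Complex.norm_exp_ofReal_mul_I, mul_one,
    Complex.norm_of_nonneg (Real.sqrt_nonneg _)]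

theorem crossGain_mul_conj {I : ℝ} (hI : 0 ≤ I) (θ : ℝ) :
    crossGain I θ * starRingEnd ℂ (crossGain I θ) = (I : ℂ) := by
  rw [Complex.mul_conj, Complex.normSq_eq_norm_sq, norm_crossGain, Real.sq_sqrt hI]

variable {S I C θp θc : ℝ} {N Mp Mc : ℕ} {c : CCICCode N Mp Mc}

local notation "𝔠" => GCCIC.symmetric S I C θp θc
local notation "𝔪" => symModel S I C θp θc c
local notation "yp" => fun ω => CausalModel.outP 𝔪 (wp ω) (GCCIC.tC 𝔠 c ω)
local notation "yc" => fun ω => CausalModel.outC 𝔪 (wc ω) (GCCIC.tF 𝔠 c ω) (GCCIC.tP 𝔠 c ω)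
local notation "xp" => fun ω => CausalModel.prim 𝔪 (wp ω)
local notation "xc" => fun ω => CausalModel.cog 𝔪 (wc ω) (GCCIC.tF 𝔠 c ω)

/-- Coefficient of the interference in the estimate of the direct signal. -/
noncomputable def coefI (S I θ D : ℝ) : ℂ :=
  ((Real.sqrt S / D : ℝ) : ℂ) * starRingEnd ℂ (crossGain I θ)

/-- Coefficient of the feedback in the estimate of the direct signal. -/
noncomputable def coefF (S C D : ℝ) : ℂ := ((Real.sqrt S * Real.sqrt C / D : ℝ) : ℂ)

theorem norm_coefI {D : ℝ} (hD : 0 < D) (S I θ : ℝ) :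
    ‖coefI S I θ D‖ = Real.sqrt S / D * Real.sqrt I := by
  rw [coefI, norm_mul, Complex.norm_of_nonneg (by positivity), RCLike.norm_conj, norm_crossGain]

theorem norm_coefF {D : ℝ} (hD : 0 < D) (S C : ℝ) :
    ‖coefF S C D‖ = Real.sqrt S * Real.sqrt C / D := by
  rw [coefF, Complex.norm_of_nonneg (by positivity)]

/-- The conjugate in the coefficient cancels the phase of the link; this is why no bound depends on
the phases. -/
theorem coefI_mul {I : ℝ} (hI : 0 ≤ I) (S θ D : ℝ) :
    coefI S I θ D * crossGain I θ = ((Real.sqrt S / D * I : ℝ) : ℂ) := by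
  have := crossGain_mul_conj hI θ
  rw [coefI]
  push_cast
  linear_combination ((Real.sqrt S : ℂ) / D) * this

theorem coefF_mul {C : ℝ} (hC : 0 ≤ C) (S D : ℝ) :
    coefF S C D * (Real.sqrt C : ℂ) = ((Real.sqrt S / D * C : ℝ) : ℂ) := by
  rw [coefF, ← Complex.ofReal_mul]
  congr 1
  have := Real.mul_self_sqrt hC
  linear_combination (Real.sqrt S / D) * this

theorem meanLe_yP (hMp : 0 < Mp) (hMc : 0 < Mc) (hc : GCCIC.PowerConstraint 𝔠 c) :
    MeanLe (ccicLaw N Mp Mc)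
      (fun ω => -Real.log (vgauss (1 + (Real.sqrt S + Real.sqrt I) ^ 2) ((yp) ω)))
      (N * Real.log (1 + (Real.sqrt S + Real.sqrt I) ^ 2) + N * (Real.log Real.pi + 1)) := by
  refine meanLe_neg_log_vgauss hMp hMc hc (by positivity) (Real.sqrt S : ℂ) (crossGain I θc) 1 0 0
    (fun ω i => ?_) ?_
  · change (Real.sqrt S : ℂ) * GCCIC.xP c ω i + (crossGain I θc * GCCIC.xC 𝔠 c ω i + zp ω i) = _
    ring
  · rw [norm_crossGain, Complex.norm_of_nonneg (Real.sqrt_nonneg _)]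
    simp [add_comm]

theorem meanLe_yC (hMp : 0 < Mp) (hMc : 0 < Mc) (hc : GCCIC.PowerConstraint 𝔠 c) :
    MeanLe (ccicLaw N Mp Mc)
      (fun ω => -Real.log (vgauss (1 + (Real.sqrt S + Real.sqrt I) ^ 2) ((yc) ω)))
      (N * Real.log (1 + (Real.sqrt S + Real.sqrt I) ^ 2) + N * (Real.log Real.pi + 1)) := by
  refine meanLe_neg_log_vgauss hMp hMc hc (by positivity) (crossGain I θp) (Real.sqrt S : ℂ) 0 1 0
    (fun ω i => ?_) ?_
  · change (crossGain I θp * GCCIC.xP c ω i + zc ω i) + (Real.sqrt S : ℂ) * GCCIC.xC 𝔠 c ω i = _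
    ring
  · rw [norm_crossGain, Complex.norm_of_nonneg (Real.sqrt_nonneg _)]
    simp [add_comm]

theorem meanLe_yC_sub_prim (hMp : 0 < Mp) (hMc : 0 < Mc) (hc : GCCIC.PowerConstraint 𝔠 c)
    (hS : 0 ≤ S) :
    MeanLe (ccicLaw N Mp Mc)
      (fun ω => -Real.log (vgauss (1 + S) ((yc) ω - crossGain I θp • (xp) ω)))
      (N * Real.log (1 + S) + N * (Real.log Real.pi + 1)) := by
  refine meanLe_neg_log_vgauss hMp hMc hc (by positivity) 0 (Real.sqrt S : ℂ) 0 1 0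
    (fun ω i => ?_) ?_
  · change (crossGain I θp * GCCIC.xP c ω i + zc ω i) + (Real.sqrt S : ℂ) * GCCIC.xC 𝔠 c ω i -
      crossGain I θp * GCCIC.xP c ω i = _
    ring
  · rw [Complex.norm_of_nonneg (Real.sqrt_nonneg _)]
    simp [Real.sq_sqrt hS, add_comm]

theorem meanLe_tF (hMp : 0 < Mp) (hMc : 0 < Mc) (hc : GCCIC.PowerConstraint 𝔠 c)
    (hC : 0 ≤ C) :
    MeanLe (ccicLaw N Mp Mc) (fun ω => -Real.log (vgauss (1 + C) (GCCIC.tF 𝔠 c ω)))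
      (N * Real.log (1 + C) + N * (Real.log Real.pi + 1)) := by
  refine meanLe_neg_log_vgauss hMp hMc hc (by positivity) (Real.sqrt C : ℂ) 0 0 0 1
    (fun ω i => ?_) ?_
  · change (Real.sqrt C : ℂ) * GCCIC.xP c ω i + zf ω i = _
    ring
  · rw [Complex.norm_of_nonneg (Real.sqrt_nonneg _)]
    simp [Real.sq_sqrt hC, add_comm]

/-- The coefficient is that of linear minimum mean square estimation at full power. The error keeps
`√C / (1 + I)` of the input, and together with the noise of the observation this contributes `C / (1
+ I)`. The estimates below follow the same pattern. -/
theorem meanLe_tF_sub (hMp : 0 < Mp) (hMc : 0 < Mc) (hc : GCCIC.PowerConstraint 𝔠 c)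
    (hI : 0 ≤ I) (hC : 0 ≤ C) :
    MeanLe (ccicLaw N Mp Mc) (fun ω => -Real.log (vgauss (1 + C / (1 + I))
        (GCCIC.tF 𝔠 c ω - coefI C I θp (1 + I) • GCCIC.tP 𝔠 c ω)))
      (N * Real.log (1 + C / (1 + I)) + N * (Real.log Real.pi + 1)) := by
  have hD : 0 < 1 + I := by positivity
  refine meanLe_neg_log_vgauss hMp hMc hc (by positivity)
    ((Real.sqrt C / (1 + I) : ℝ) : ℂ) 0 0 (-coefI C I θp (1 + I)) 1
    (fun ω i => ?_) ?_
  · change (Real.sqrt C : ℂ) * GCCIC.xP c ω i + zf ω i -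
      coefI C I θp (1 + I) * (crossGain I θp * GCCIC.xP c ω i + zc ω i) = _
    have h1 := coefI_mul hI C θp (1 + I)
    have h2 : Real.sqrt C - Real.sqrt C / (1 + I) * I = Real.sqrt C / (1 + I) := by
      field_simp; ring
    have h3 := congrArg (fun x : ℝ => (x : ℂ)) h2
    simp only [Complex.ofReal_sub] at h3
    linear_combination GCCIC.xP c ω i * h3 - GCCIC.xP c ω i * h1
  · rw [Complex.norm_of_nonneg (by positivity), norm_neg, norm_coefI hD]
    simp only [norm_zero, norm_one, add_zero, mul_pow, div_pow, Real.sq_sqrt hI, Real.sq_sqrt hC]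
    refine le_of_eq ?_
    field_simp; ring

theorem meanLe_yP_sub_feedback (hMp : 0 < Mp) (hMc : 0 < Mc) (hc : GCCIC.PowerConstraint 𝔠 c)
    (hS : 0 ≤ S) (hC : 0 ≤ C) :
    MeanLe (ccicLaw N Mp Mc) (fun ω => -Real.log (vgauss (1 + S / (1 + C))
        ((yp) ω - crossGain I θc • (xc) ω - coefF S C (1 + C) • GCCIC.tF 𝔠 c ω)))
      (N * Real.log (1 + S / (1 + C)) + N * (Real.log Real.pi + 1)) := by
  have hD : 0 < 1 + C := by positivity
  refine meanLe_neg_log_vgauss hMp hMc hc (by positivity)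
    ((Real.sqrt S / (1 + C) : ℝ) : ℂ) 0 1 0 (-coefF S C (1 + C))
    (fun ω i => ?_) ?_
  · change (Real.sqrt S : ℂ) * GCCIC.xP c ω i + (crossGain I θc * GCCIC.xC 𝔠 c ω i + zp ω i) -
      crossGain I θc * GCCIC.xC 𝔠 c ω i -
      coefF S C (1 + C) * ((Real.sqrt C : ℂ) * GCCIC.xP c ω i + zf ω i) = _
    have h1 := coefF_mul hC S (1 + C)
    have h2 : Real.sqrt S - Real.sqrt S / (1 + C) * C = Real.sqrt S / (1 + C) := by
      field_simp; ring
    have h3 := congrArg (fun x : ℝ => (x : ℂ)) h2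
    simp only [Complex.ofReal_sub] at h3
    linear_combination GCCIC.xP c ω i * h3 - GCCIC.xP c ω i * h1
  · rw [Complex.norm_of_nonneg (by positivity), norm_neg, norm_coefF hD]
    simp only [norm_zero, norm_one, add_zero, mul_pow, div_pow, Real.sq_sqrt hS, Real.sq_sqrt hC]
    refine le_of_eq ?_
    field_simp; ring

theorem meanLe_yC_sub_side (hMp : 0 < Mp) (hMc : 0 < Mc) (hc : GCCIC.PowerConstraint 𝔠 c)
    (hS : 0 ≤ S) (hI : 0 ≤ I) :
    MeanLe (ccicLaw N Mp Mc) (fun ω => -Real.log (vgauss (1 + S / (1 + I))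
        ((yc) ω - crossGain I θp • (xp) ω - coefI S I θc (1 + I) • GCCIC.tC 𝔠 c ω)))
      (N * Real.log (1 + S / (1 + I)) + N * (Real.log Real.pi + 1)) := by
  have hD : 0 < 1 + I := by positivity
  refine meanLe_neg_log_vgauss hMp hMc hc (by positivity)
    0 ((Real.sqrt S / (1 + I) : ℝ) : ℂ) (-coefI S I θc (1 + I)) 1 0
    (fun ω i => ?_) ?_
  · change (crossGain I θp * GCCIC.xP c ω i + zc ω i) + (Real.sqrt S : ℂ) * GCCIC.xC 𝔠 c ω i -
      crossGain I θp * GCCIC.xP c ω i -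
      coefI S I θc (1 + I) * (crossGain I θc * GCCIC.xC 𝔠 c ω i + zp ω i) = _
    have h1 := coefI_mul hI S θc (1 + I)
    have h2 : Real.sqrt S - Real.sqrt S / (1 + I) * I = Real.sqrt S / (1 + I) := by
      field_simp; ring
    have h3 := congrArg (fun x : ℝ => (x : ℂ)) h2
    simp only [Complex.ofReal_sub] at h3
    linear_combination GCCIC.xC 𝔠 c ω i * h3 - GCCIC.xC 𝔠 c ω i * h1
  · rw [Complex.norm_of_nonneg (by positivity), norm_neg, norm_coefI hD]
    simp only [norm_zero, norm_one, zero_add, mul_pow, div_pow, Real.sq_sqrt hS,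
      Real.sq_sqrt hI]
    refine le_of_eq ?_
    field_simp; ring

/-- Two observations of the primary input, of strengths `C` and `I`, act as one of strength `C + I`,
whence the common denominator. -/
theorem meanLe_yP_sub_given (hMp : 0 < Mp) (hMc : 0 < Mc) (hc : GCCIC.PowerConstraint 𝔠 c)
    (hS : 0 ≤ S) (hI : 0 ≤ I) (hC : 0 ≤ C) :
    MeanLe (ccicLaw N Mp Mc) (fun ω => -Real.log (vgauss (1 + S / (1 + C + I))
        ((yp) ω - crossGain I θc • (xc) ω - coefI S I θp (1 + C + I) • GCCIC.tP 𝔠 c ω -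
          coefF S C (1 + C + I) • GCCIC.tF 𝔠 c ω)))
      (N * Real.log (1 + S / (1 + C + I)) + N * (Real.log Real.pi + 1)) := by
  have hD : 0 < 1 + C + I := by positivity
  refine meanLe_neg_log_vgauss hMp hMc hc (by positivity)
    ((Real.sqrt S / (1 + C + I) : ℝ) : ℂ) 0 1 (-coefI S I θp (1 + C + I)) (-coefF S C (1 + C + I))
    (fun ω i => ?_) ?_
  · change (Real.sqrt S : ℂ) * GCCIC.xP c ω i + (crossGain I θc * GCCIC.xC 𝔠 c ω i + zp ω i) -
      crossGain I θc * GCCIC.xC 𝔠 c ω i -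
      coefI S I θp (1 + C + I) * (crossGain I θp * GCCIC.xP c ω i + zc ω i) -
      coefF S C (1 + C + I) * ((Real.sqrt C : ℂ) * GCCIC.xP c ω i + zf ω i) = _
    have h0 := coefF_mul hC S (1 + C + I)
    have h1 := coefI_mul hI S θp (1 + C + I)
    have h2 : Real.sqrt S - Real.sqrt S / (1 + C + I) * C - Real.sqrt S / (1 + C + I) * I =
        Real.sqrt S / (1 + C + I) := by
      field_simp; ring
    have h3 := congrArg (fun x : ℝ => (x : ℂ)) h2
    simp only [Complex.ofReal_sub] at h3
    linear_combination GCCIC.xP c ω i * h3 - GCCIC.xP c ω i * h1 - GCCIC.xP c ω i * h0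
  · rw [Complex.norm_of_nonneg (by positivity), norm_neg, norm_neg, norm_coefF hD, norm_coefI hD]
    simp only [norm_zero, norm_one, add_zero, mul_pow, div_pow, Real.sq_sqrt hS, Real.sq_sqrt hC,
      Real.sq_sqrt hI]
    refine le_of_eq ?_
    field_simp; ring

theorem meanLe_yP_sub_joint (hMp : 0 < Mp) (hMc : 0 < Mc) (hc : GCCIC.PowerConstraint 𝔠 c)
    (hS : 0 ≤ S) (hI : 0 ≤ I) (hC : 0 ≤ C) :
    MeanLe (ccicLaw N Mp Mc) (fun ω => -Real.log (vgauss (2 * (1 + I + S / (1 + C + I)))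
        ((yp) ω - coefI S I θp (1 + C + I) • GCCIC.tP 𝔠 c ω -
          coefF S C (1 + C + I) • GCCIC.tF 𝔠 c ω)))
      (N * Real.log (2 * (1 + I + S / (1 + C + I))) + N * (Real.log Real.pi + 1)) := by
  have hD : 0 < 1 + C + I := by positivity
  refine meanLe_neg_log_vgauss hMp hMc hc (by positivity)
    ((Real.sqrt S / (1 + C + I) : ℝ) : ℂ) (crossGain I θc) 1 (-coefI S I θp (1 + C + I))
    (-coefF S C (1 + C + I)) (fun ω i => ?_) ?_
  · change (Real.sqrt S : ℂ) * GCCIC.xP c ω i + (crossGain I θc * GCCIC.xC 𝔠 c ω i + zp ω i) -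
      coefI S I θp (1 + C + I) * (crossGain I θp * GCCIC.xP c ω i + zc ω i) -
      coefF S C (1 + C + I) * ((Real.sqrt C : ℂ) * GCCIC.xP c ω i + zf ω i) = _
    have h0 := coefF_mul hC S (1 + C + I)
    have h1 := coefI_mul hI S θp (1 + C + I)
    have h2 : Real.sqrt S - Real.sqrt S / (1 + C + I) * C - Real.sqrt S / (1 + C + I) * I =
        Real.sqrt S / (1 + C + I) := by
      field_simp; ring
    have h3 := congrArg (fun x : ℝ => (x : ℂ)) h2
    simp only [Complex.ofReal_sub] at h3
    linear_combination GCCIC.xP c ω i * h3 - GCCIC.xP c ω i * h1 - GCCIC.xP c ω i * h0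
  · rw [Complex.norm_of_nonneg (by positivity), norm_neg, norm_neg, norm_coefF hD, norm_coefI hD,
      norm_crossGain]
    -- The cognitive input is not subtracted here and may be correlated with the primary one.
    -- Bounding the cross term this way is the origin of the factor `2` in the variance, and so of
    -- an additive `log 2`.
    have h1 : (Real.sqrt S / (1 + C + I) + Real.sqrt I) ^ 2 ≤
        2 * ((Real.sqrt S / (1 + C + I)) ^ 2 + Real.sqrt I ^ 2) := by
      nlinarith [sq_nonneg (Real.sqrt S / (1 + C + I) - Real.sqrt I)]
    have h2 : 0 ≤ (Real.sqrt S / (1 + C + I) * Real.sqrt I) ^ 2 := by positivity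
    have h3 : 0 ≤ (Real.sqrt S * Real.sqrt C / (1 + C + I)) ^ 2 := by positivity
    have h4 : (Real.sqrt S / (1 + C + I)) ^ 2 + (Real.sqrt S / (1 + C + I) * Real.sqrt I) ^ 2 +
        (Real.sqrt S * Real.sqrt C / (1 + C + I)) ^ 2 = S / (1 + C + I) := by
      simp only [mul_pow, div_pow, Real.sq_sqrt hS, Real.sq_sqrt hC, Real.sq_sqrt hI]
      field_simp; ring
    rw [Real.sq_sqrt hI] at h1
    rw [norm_one]
    linarith

/-- The primary contribution is estimated from the feedback and the cognitive one from `tc`, leaving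
`I / (1 + C)` and `S / (1 + I)`. Correlation of the inputs again costs a factor of two. -/
theorem meanLe_yC_sub_joint (hMp : 0 < Mp) (hMc : 0 < Mc) (hc : GCCIC.PowerConstraint 𝔠 c)
    (hS : 0 ≤ S) (hI : 0 ≤ I) (hC : 0 ≤ C) :
    MeanLe (ccicLaw N Mp Mc) (fun ω => -Real.log (vgauss (2 * (1 + I / (1 + C) + S / (1 + I)))
        ((yc) ω - coefI S I θc (1 + I) • GCCIC.tC 𝔠 c ω -
          (crossGain I θp * ((Real.sqrt C / (1 + C) : ℝ) : ℂ)) • GCCIC.tF 𝔠 c ω)))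
      (N * Real.log (2 * (1 + I / (1 + C) + S / (1 + I))) + N * (Real.log Real.pi + 1)) := by
  have hD : 0 < 1 + I := by positivity
  refine meanLe_neg_log_vgauss hMp hMc hc (by positivity)
    (crossGain I θp * ((1 / (1 + C) : ℝ) : ℂ)) ((Real.sqrt S / (1 + I) : ℝ) : ℂ)
    (-coefI S I θc (1 + I)) 1 (-(crossGain I θp * ((Real.sqrt C / (1 + C) : ℝ) : ℂ)))
    (fun ω i => ?_) ?_
  · change (crossGain I θp * GCCIC.xP c ω i + zc ω i) + (Real.sqrt S : ℂ) * GCCIC.xC 𝔠 c ω i -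
      coefI S I θc (1 + I) * (crossGain I θc * GCCIC.xC 𝔠 c ω i + zp ω i) -
      (crossGain I θp * ((Real.sqrt C / (1 + C) : ℝ) : ℂ)) *
        ((Real.sqrt C : ℂ) * GCCIC.xP c ω i + zf ω i) = _
    have h1 := coefI_mul hI S θc (1 + I)
    have h2 : Real.sqrt S - Real.sqrt S / (1 + I) * I = Real.sqrt S / (1 + I) := by
      field_simp; ring
    have h3 := congrArg (fun x : ℝ => (x : ℂ)) h2
    have h4 : 1 - Real.sqrt C / (1 + C) * Real.sqrt C = 1 / (1 + C) := by
      have := Real.mul_self_sqrt hC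
      field_simp
      linarith
    have h5 := congrArg (fun x : ℝ => (x : ℂ)) h4
    simp only [Complex.ofReal_sub] at h3
    rw [Complex.ofReal_sub, Complex.ofReal_mul, Complex.ofReal_one] at h5
    linear_combination GCCIC.xC 𝔠 c ω i * h3 - GCCIC.xC 𝔠 c ω i * h1 +
      crossGain I θp * GCCIC.xP c ω i * h5
  · rw [norm_neg, norm_neg, norm_coefI hD, norm_mul, norm_mul, norm_crossGain,
      Complex.norm_of_nonneg (by positivity), Complex.norm_of_nonneg (by positivity),
      Complex.norm_of_nonneg (by positivity)]
    have h1 : (Real.sqrt I * (1 / (1 + C)) + Real.sqrt S / (1 + I)) ^ 2 ≤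
        2 * ((Real.sqrt I * (1 / (1 + C))) ^ 2 + (Real.sqrt S / (1 + I)) ^ 2) := by
      nlinarith [sq_nonneg (Real.sqrt I * (1 / (1 + C)) - Real.sqrt S / (1 + I))]
    have h2 : 0 ≤ (Real.sqrt S / (1 + I) * Real.sqrt I) ^ 2 := by positivity
    have h3 : 0 ≤ (Real.sqrt I * (Real.sqrt C / (1 + C))) ^ 2 := by positivity
    have h4 : (Real.sqrt S / (1 + I)) ^ 2 + (Real.sqrt S / (1 + I) * Real.sqrt I) ^ 2
        = S / (1 + I) := by
      simp only [mul_pow, div_pow, Real.sq_sqrt hS, Real.sq_sqrt hI]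
      field_simp
    have h5 : (Real.sqrt I * (1 / (1 + C))) ^ 2 + (Real.sqrt I * (Real.sqrt C / (1 + C))) ^ 2
        = I / (1 + C) := by
      simp only [mul_pow, div_pow, Real.sq_sqrt hI, Real.sq_sqrt hC]
      field_simp
    rw [norm_one]
    linarith

local notation "kF" => fun ω => CausalModel.kerF 𝔪 (wp ω) (GCCIC.tF 𝔠 c ω)
local notation "kP" => fun ω => CausalModel.kerP 𝔪 (wp ω) (GCCIC.tP 𝔠 c ω)
local notation "kC" => fun ω => CausalModel.kerC 𝔪 (wc ω) (GCCIC.tF 𝔠 c ω) (GCCIC.tC 𝔠 c ω)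
local notation "mC" => fun ω => CausalModel.mixC 𝔪 (GCCIC.tF 𝔠 c ω) (GCCIC.tC 𝔠 c ω)

/-! ### Decoding gains against likelihood ratios -/

theorem gainP_le_ratioPF {s t : ℝ} (hs : 0 < s) (ht : 0 < t) (β : ℂ) (ω : CCICOutcome N Mp Mc) :
    gainP S I C θp θc c ω ≤ eval S I C θp θc c ((𝔪).ratioPF s t β) ω +
      -Real.log (vgauss s (GCCIC.tF 𝔠 c ω)) +
      -Real.log (vgauss t ((yp) ω - crossGain I θc • (xc) ω - β • GCCIC.tF 𝔠 c ω)) +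
      Real.log ((kF) ω) + Real.log ((kC) ω) := by
  have h1 := (𝔪).kerF_pos (wp ω) (GCCIC.tF 𝔠 c ω)
  have h2 := (𝔪).kerC_pos (wc ω) (GCCIC.tF 𝔠 c ω) (GCCIC.tC 𝔠 c ω)
  have h3 := vgauss_pos hs (GCCIC.tF 𝔠 c ω)
  have h4 := vgauss_pos ht ((yp) ω - crossGain I θc • (xc) ω - β • GCCIC.tF 𝔠 c ω)
  have h := log_le_ratio (guessWeight_pos c.decP (wp ω) (GCCIC.yP 𝔠 c ω)) (mul_pos h3 h4)
    (mul_pos h1 h2)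
  rw [Real.log_mul h3.ne' h4.ne', Real.log_mul h1.ne' h2.ne'] at h
  refine h.trans (le_of_eq ?_)
  simp only [eval, CausalModel.ratioPF, yP_eq]
  simp only [show (𝔪).decP = c.decP from rfl, show (𝔪).crossC = crossGain I θc from rfl]
  ring

theorem gainP_le_ratioPNoise {s : ℝ} (hs : 0 < s) (ω : CCICOutcome N Mp Mc) :
    gainP S I C θp θc c ω ≤ eval S I C θp θc c ((𝔪).ratioPNoise s) ω +
      -Real.log (vgauss s ((yp) ω)) + Real.log ((kC) ω) :=
  log_le_ratio (guessWeight_pos c.decP (wp ω) (GCCIC.yP 𝔠 c ω)) (vgauss_pos hs _)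
    ((𝔪).kerC_pos (wc ω) (GCCIC.tF 𝔠 c ω) (GCCIC.tC 𝔠 c ω))

theorem gainP_le_ratioPMix (hMc : 0 < Mc) {s : ℝ} (hs : 0 < s) (ω : CCICOutcome N Mp Mc) :
    gainP S I C θp θc c ω ≤ eval S I C θp θc c ((𝔪).ratioPMix s) ω +
      -Real.log (vgauss s ((yp) ω)) + Real.log ((mC) ω) :=
  log_le_ratio (guessWeight_pos c.decP (wp ω) (GCCIC.yP 𝔠 c ω)) (vgauss_pos hs _)
    ((𝔪).mixC_pos hMc (GCCIC.tF 𝔠 c ω) (GCCIC.tC 𝔠 c ω))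

theorem gainP_le_ratioPGiven {D : (Fin N → ℂ) → (Fin N → ℂ) → ℝ} (hD : ∀ tf tp, 0 < D tf tp)
    {s : ℝ} (hs : 0 < s) (α β : ℂ) (ω : CCICOutcome N Mp Mc) :
    gainP S I C θp θc c ω ≤ eval S I C θp θc c ((𝔪).ratioPGiven D s α β) ω +
      -Real.log (D (GCCIC.tF 𝔠 c ω) (GCCIC.tP 𝔠 c ω)) +
      -Real.log (vgauss s ((yp) ω - crossGain I θc • (xc) ω - α • GCCIC.tP 𝔠 c ω -
        β • GCCIC.tF 𝔠 c ω)) +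
      Real.log ((kF) ω) + Real.log ((kP) ω) + Real.log ((kC) ω) := by
  have h1 := (𝔪).kerF_pos (wp ω) (GCCIC.tF 𝔠 c ω)
  have h2 := (𝔪).kerC_pos (wc ω) (GCCIC.tF 𝔠 c ω) (GCCIC.tC 𝔠 c ω)
  have h5 := (𝔪).kerP_pos (wp ω) (GCCIC.tP 𝔠 c ω)
  have h3 := hD (GCCIC.tF 𝔠 c ω) (GCCIC.tP 𝔠 c ω)
  have h4 := vgauss_pos hs ((yp) ω - crossGain I θc • (xc) ω - α • GCCIC.tP 𝔠 c ω -
        β • GCCIC.tF 𝔠 c ω)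
  have h := log_le_ratio (guessWeight_pos c.decP (wp ω) (GCCIC.yP 𝔠 c ω)) (mul_pos h3 h4)
    (mul_pos (mul_pos h1 h5) h2)
  rw [Real.log_mul h3.ne' h4.ne', Real.log_mul (mul_pos h1 h5).ne' h2.ne',
    Real.log_mul h1.ne' h5.ne'] at h
  refine h.trans (le_of_eq ?_)
  simp only [eval, CausalModel.ratioPGiven, yP_eq]
  simp only [show (𝔪).decP = c.decP from rfl, show (𝔪).crossC = crossGain I θc from rfl]
  ring

theorem gainP_le_ratioPJoint (hMc : 0 < Mc) {D : (Fin N → ℂ) → (Fin N → ℂ) → ℝ}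
    (hD : ∀ tf tp, 0 < D tf tp)
    {s : ℝ} (hs : 0 < s) (α β : ℂ) (ω : CCICOutcome N Mp Mc) :
    gainP S I C θp θc c ω ≤ eval S I C θp θc c ((𝔪).ratioPJoint D s α β) ω +
      -Real.log (D (GCCIC.tF 𝔠 c ω) (GCCIC.tP 𝔠 c ω)) +
      -Real.log (vgauss s ((yp) ω - α • GCCIC.tP 𝔠 c ω - β • GCCIC.tF 𝔠 c ω)) +
      Real.log ((kF) ω) + Real.log ((kP) ω) + Real.log ((mC) ω) := by
  have h1 := (𝔪).kerF_pos (wp ω) (GCCIC.tF 𝔠 c ω)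
  have h2 := (𝔪).mixC_pos hMc (GCCIC.tF 𝔠 c ω) (GCCIC.tC 𝔠 c ω)
  have h5 := (𝔪).kerP_pos (wp ω) (GCCIC.tP 𝔠 c ω)
  have h3 := hD (GCCIC.tF 𝔠 c ω) (GCCIC.tP 𝔠 c ω)
  have h4 := vgauss_pos hs ((yp) ω - α • GCCIC.tP 𝔠 c ω - β • GCCIC.tF 𝔠 c ω)
  have h := log_le_ratio (guessWeight_pos c.decP (wp ω) (GCCIC.yP 𝔠 c ω)) (mul_pos h3 h4)
    (mul_pos (mul_pos h1 h5) h2)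
  rw [Real.log_mul h3.ne' h4.ne', Real.log_mul (mul_pos h1 h5).ne' h2.ne',
    Real.log_mul h1.ne' h5.ne'] at h
  refine h.trans (le_of_eq ?_)
  simp only [eval, CausalModel.ratioPJoint, yP_eq]
  simp only [show (𝔪).decP = c.decP from rfl]
  ring

theorem gainC_le_ratioCGiven {s : ℝ} (hs : 0 < s) (ω : CCICOutcome N Mp Mc) :
    gainC S I C θp θc c ω ≤ eval S I C θp θc c ((𝔪).ratioCGiven s) ω +
      -Real.log (vgauss s ((yc) ω - crossGain I θp • (xp) ω)) + Real.log ((kP) ω) :=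
  log_le_ratio (guessWeight_pos c.decC (wc ω) (GCCIC.yC 𝔠 c ω)) (vgauss_pos hs _)
    ((𝔪).kerP_pos (wp ω) (GCCIC.tP 𝔠 c ω))

theorem gainC_le_ratioCCausal (hMp : 0 < Mp) {s : ℝ} (hs : 0 < s) (ω : CCICOutcome N Mp Mc) :
    gainC S I C θp θc c ω ≤ eval S I C θp θc c ((𝔪).ratioCCausal s) ω +
      -Real.log (vgauss s ((yc) ω)) +
      Real.log ((𝔪).causalP (GCCIC.tF 𝔠 c ω) (GCCIC.tP 𝔠 c ω)) :=
  log_le_ratio (guessWeight_pos c.decC (wc ω) (GCCIC.yC 𝔠 c ω)) (vgauss_pos hs _)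
    ((𝔪).causalP_pos hMp (GCCIC.tF 𝔠 c ω) (GCCIC.tP 𝔠 c ω))

theorem gainC_le_ratioCSide (hMc : 0 < Mc) {s : ℝ} (hs : 0 < s) (α : ℂ)
    (ω : CCICOutcome N Mp Mc) :
    gainC S I C θp θc c ω ≤ eval S I C θp θc c ((𝔪).ratioCSide s α) ω +
      -Real.log ((mC) ω) +
      -Real.log (vgauss s ((yc) ω - crossGain I θp • (xp) ω - α • GCCIC.tC 𝔠 c ω)) +
      Real.log ((kP) ω) + Real.log ((kC) ω) := by
  have h1 := (𝔪).kerP_pos (wp ω) (GCCIC.tP 𝔠 c ω)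
  have h2 := (𝔪).kerC_pos (wc ω) (GCCIC.tF 𝔠 c ω) (GCCIC.tC 𝔠 c ω)
  have h3 := (𝔪).mixC_pos hMc (GCCIC.tF 𝔠 c ω) (GCCIC.tC 𝔠 c ω)
  have h4 := vgauss_pos hs ((yc) ω - crossGain I θp • (xp) ω - α • GCCIC.tC 𝔠 c ω)
  have h := log_le_ratio (guessWeight_pos c.decC (wc ω) (GCCIC.yC 𝔠 c ω)) (mul_pos h3 h4)
    (mul_pos h1 h2)
  rw [Real.log_mul h3.ne' h4.ne', Real.log_mul h1.ne' h2.ne'] at h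
  refine h.trans (le_of_eq ?_)
  simp only [eval, CausalModel.ratioCSide, yC_eq]
  simp only [show (𝔪).decC = c.decC from rfl, show (𝔪).crossP = crossGain I θp from rfl]
  ring

theorem gainC_le_ratioCJoint (hMp : 0 < Mp) (hMc : 0 < Mc) {s : ℝ} (hs : 0 < s) (α β : ℂ)
    (ω : CCICOutcome N Mp Mc) :
    gainC S I C θp θc c ω ≤ eval S I C θp θc c ((𝔪).ratioCJoint s α β) ω +
      -Real.log ((mC) ω) +
      -Real.log (vgauss s ((yc) ω - α • GCCIC.tC 𝔠 c ω - β • GCCIC.tF 𝔠 c ω)) +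
      Real.log ((𝔪).condP (GCCIC.tF 𝔠 c ω) (GCCIC.tP 𝔠 c ω)) + Real.log ((kC) ω) := by
  have h1 := (𝔪).condP_pos hMp (GCCIC.tF 𝔠 c ω) (GCCIC.tP 𝔠 c ω)
  have h2 := (𝔪).kerC_pos (wc ω) (GCCIC.tF 𝔠 c ω) (GCCIC.tC 𝔠 c ω)
  have h3 := (𝔪).mixC_pos hMc (GCCIC.tF 𝔠 c ω) (GCCIC.tC 𝔠 c ω)
  have h4 := vgauss_pos hs ((yc) ω - α • GCCIC.tC 𝔠 c ω - β • GCCIC.tF 𝔠 c ω)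
  have h := log_le_ratio (guessWeight_pos c.decC (wc ω) (GCCIC.yC 𝔠 c ω)) (mul_pos h3 h4)
    (mul_pos h1 h2)
  rw [Real.log_mul h3.ne' h4.ne', Real.log_mul h1.ne' h2.ne'] at h
  refine h.trans (le_of_eq ?_)
  simp only [eval, CausalModel.ratioCJoint, yC_eq]
  simp only [show (𝔪).decC = c.decC from rfl]
  ring

/-! ### Outer bounds for codes -/

theorem weighted_gain_le (hMp : 0 < Mp) (hMc : 0 < Mc) {k l a : ℝ} {g : CCICOutcome N Mp Mc → ℝ}
    (hg : MeanLe (ccicLaw N Mp Mc) g a)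
    (h : ∀ ω, k * gainP S I C θp θc c ω + l * gainC S I C θp θc c ω ≤ g ω) :
    k * ((1 - (GCCIC.errP 𝔠 c).toReal) * Real.log Mp) +
      l * ((1 - (GCCIC.errC 𝔠 c).toReal) * Real.log Mc) ≤ a := by
  obtain ⟨i1, e1⟩ := integral_gainP (S := S) (I := I) (C := C) (θp := θp) (θc := θc) (c := c)
    hMp hMc
  obtain ⟨i2, e2⟩ := integral_gainC (S := S) (I := I) (C := C) (θp := θp) (θc := θc) (c := c)
    hMp hMc
  have := hg.integral_le ((i1.const_mul k).add (i2.const_mul l)) h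
  simp only [Pi.add_apply] at this
  rwa [integral_add (i1.const_mul k) (i2.const_mul l), integral_const_mul, integral_const_mul,
    e1, e2] at this

/-- The feedback and the cognitive message are given to the primary receiver; the two logarithms are
the chain rule over feedback and output. -/
theorem primary_le_cutset (hS : 0 ≤ S) (hC : 0 ≤ C) (hMp : 0 < Mp) (hMc : 0 < Mc)
    (hc : GCCIC.PowerConstraint 𝔠 c) :
    1 * ((1 - (GCCIC.errP 𝔠 c).toReal) * Real.log Mp) +
      0 * ((1 - (GCCIC.errC 𝔠 c).toReal) * Real.log Mc) ≤
      N * (Real.log (1 + C) + Real.log (1 + S / (1 + C))) + 2 := by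
  have p1 : 0 < 1 + C := by positivity
  have p2 : 0 < 1 + S / (1 + C) := by positivity
  have h := weighted_gain_le (S := S) (I := I) (C := C) (θp := θp) (θc := θc) (c := c)
    (k := 1) (l := 0) hMp hMc
    (((((meanLe_eval ((𝔪).isTest_ratioPF p1 p2 (coefF S C (1 + C)) hMc)).add
      (meanLe_tF hMp hMc hc hC)).add (meanLe_yP_sub_feedback hMp hMc hc hS hC)).add
      (meanLe_log_kerF (S := S) (I := I) (C := C) (θp := θp) (θc := θc) (c := c) hMp hMc)).add
      (meanLe_log_kerC (S := S) (I := I) (C := C) (θp := θp) (θc := θc) (c := c)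
        hMp hMc)) fun ω => by
    have := gainP_le_ratioPF (S := S) (I := I) (C := C) (θp := θp) (θc := θc) (c := c)
      p1 p2 (coefF S C (1 + C)) ω
    linarith
  linarith

theorem primary_le_miso (hMp : 0 < Mp) (hMc : 0 < Mc) (hc : GCCIC.PowerConstraint 𝔠 c) :
    1 * ((1 - (GCCIC.errP 𝔠 c).toReal) * Real.log Mp) +
      0 * ((1 - (GCCIC.errC 𝔠 c).toReal) * Real.log Mc) ≤
      N * Real.log (1 + (Real.sqrt S + Real.sqrt I) ^ 2) + 2 := by
  have p1 : 0 < 1 + (Real.sqrt S + Real.sqrt I) ^ 2 := by positivity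
  have h := weighted_gain_le (S := S) (I := I) (C := C) (θp := θp) (θc := θc) (c := c)
    (k := 1) (l := 0) hMp hMc
    (((meanLe_eval ((𝔪).isTest_ratioPNoise p1 hMc)).add (meanLe_yP hMp hMc hc)).add
      (meanLe_log_kerC (S := S) (I := I) (C := C) (θp := θp) (θc := θc) (c := c)
        hMp hMc)) fun ω => by
    have := gainP_le_ratioPNoise (S := S) (I := I) (C := C) (θp := θp) (θc := θc) (c := c) p1 ω
    linarith
  linarith

theorem cognitive_le (hS : 0 ≤ S) (hMp : 0 < Mp) (hMc : 0 < Mc)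
    (hc : GCCIC.PowerConstraint 𝔠 c) :
    0 * ((1 - (GCCIC.errP 𝔠 c).toReal) * Real.log Mp) +
      1 * ((1 - (GCCIC.errC 𝔠 c).toReal) * Real.log Mc) ≤ N * Real.log (1 + S) + 2 := by
  have p1 : 0 < 1 + S := by positivity
  have h := weighted_gain_le (S := S) (I := I) (C := C) (θp := θp) (θc := θc) (c := c)
    (k := 0) (l := 1) hMp hMc
    (((meanLe_eval ((𝔪).isTest_ratioCGiven p1 hMp)).add (meanLe_yC_sub_prim hMp hMc hc hS)).add
      (meanLe_log_kerP (S := S) (I := I) (C := C) (θp := θp) (θc := θc) (c := c)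
        hMp hMc)) fun ω => by
    have := gainC_le_ratioCGiven (S := S) (I := I) (C := C) (θp := θp) (θc := θc) (c := c) p1 ω
    linarith
  linarith

/-- The primary receiver loses the entropy of its interference given the feedback, and the cognitive
receiver, given that interference, gains the same amount: `log mixC` cancels. -/
theorem sum_le (hS : 0 ≤ S) (hI : 0 ≤ I) (hMp : 0 < Mp) (hMc : 0 < Mc)
    (hc : GCCIC.PowerConstraint 𝔠 c) :
    1 * ((1 - (GCCIC.errP 𝔠 c).toReal) * Real.log Mp) +
      1 * ((1 - (GCCIC.errC 𝔠 c).toReal) * Real.log Mc) ≤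
      N * (Real.log (1 + S / (1 + I)) + Real.log (1 + (Real.sqrt S + Real.sqrt I) ^ 2)) + 4 := by
  have p1 : 0 < 1 + (Real.sqrt S + Real.sqrt I) ^ 2 := by positivity
  have p2 : 0 < 1 + S / (1 + I) := by positivity
  have h := weighted_gain_le (S := S) (I := I) (C := C) (θp := θp) (θc := θc) (c := c)
    (k := 1) (l := 1) hMp hMc
    ((((((meanLe_eval ((𝔪).isTest_ratioPMix p1 hMc)).add
      (meanLe_eval ((𝔪).isTest_ratioCSide p2 (coefI S I θc (1 + I)) hMp hMc))).add
      (meanLe_yP hMp hMc hc)).add (meanLe_yC_sub_side hMp hMc hc hS hI)).add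
      (meanLe_log_kerP (S := S) (I := I) (C := C) (θp := θp) (θc := θc) (c := c) hMp hMc)).add
      (meanLe_log_kerC (S := S) (I := I) (C := C) (θp := θp) (θc := θc) (c := c)
        hMp hMc)) fun ω => by
    have h1 := gainP_le_ratioPMix (S := S) (I := I) (C := C) (θp := θp) (θc := θc) (c := c)
      hMc p1 ω
    have h2 := gainC_le_ratioCSide (S := S) (I := I) (C := C) (θp := θp) (θc := θc) (c := c) hMc p2
      (coefI S I θc (1 + I)) ω
    linarith
  linarith

/-- Here `log causalP` cancels. The primary receiver gets both feedback and interference, and the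
feedback is tested against its estimate from the interference. -/
theorem sum_le_coop (hS : 0 ≤ S) (hI : 0 ≤ I) (hC : 0 ≤ C) (hMp : 0 < Mp) (hMc : 0 < Mc)
    (hc : GCCIC.PowerConstraint 𝔠 c) :
    1 * ((1 - (GCCIC.errP 𝔠 c).toReal) * Real.log Mp) +
      1 * ((1 - (GCCIC.errC 𝔠 c).toReal) * Real.log Mc) ≤
      N * (Real.log (1 + C / (1 + I)) + Real.log (1 + S / (1 + C + I)) +
        Real.log (1 + (Real.sqrt S + Real.sqrt I) ^ 2)) + 4 := by
  have p1 : 0 < 1 + (Real.sqrt S + Real.sqrt I) ^ 2 := by positivity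
  have p2 : 0 < 1 + S / (1 + C + I) := by positivity
  have p3 : 0 < 1 + C / (1 + I) := by positivity
  have hD0 : ∀ tf tp : Fin N → ℂ, 0 < (𝔪).causalP tf tp *
      vgauss (1 + C / (1 + I)) (tf - coefI C I θp (1 + I) • tp) := fun tf tp =>
    mul_pos ((𝔪).causalP_pos hMp _ _) (vgauss_pos p3 _)
  have h := weighted_gain_le (S := S) (I := I) (C := C) (θp := θp) (θc := θc) (c := c)
    (k := 1) (l := 1) hMp hMc
    ((((((((meanLe_eval ((𝔪).isTest_ratioCCausal p1 hMp)).add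
      (meanLe_eval ((𝔪).isTest_ratioPGiven (by fun_prop) hD0
        ((𝔪).lintegral_causalP_mul_vgauss hMp p3 (coefI C I θp (1 + I))).le p2
        (coefI S I θp (1 + C + I)) (coefF S C (1 + C + I)) hMc))).add
      (meanLe_yC hMp hMc hc)).add (meanLe_tF_sub hMp hMc hc hI hC)).add
      (meanLe_yP_sub_given hMp hMc hc hS hI hC)).add
      (meanLe_log_kerF (S := S) (I := I) (C := C) (θp := θp) (θc := θc) (c := c) hMp hMc)).add
      (meanLe_log_kerP (S := S) (I := I) (C := C) (θp := θp) (θc := θc) (c := c) hMp hMc)).add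
      (meanLe_log_kerC (S := S) (I := I) (C := C) (θp := θp) (θc := θc) (c := c)
        hMp hMc)) fun ω => by
    have h1 := gainC_le_ratioCCausal (S := S) (I := I) (C := C) (θp := θp) (θc := θc) (c := c)
      hMp p1 ω
    have h2 := gainP_le_ratioPGiven (S := S) (I := I) (C := C) (θp := θp) (θc := θc) (c := c)
      hD0 p2 (coefI S I θp (1 + C + I)) (coefF S C (1 + C + I)) ω
    rw [Real.log_mul ((𝔪).causalP_pos hMp _ _).ne' (vgauss_pos p3 _).ne'] at h2
    linarith
  linarith

/-- Each receiver is given the feedback and the interference that it causes; `log mixC` and `log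
condP` both cancel. Two errors contain both inputs, hence two factors of `2`. -/
theorem sum_le_isd (hS : 0 ≤ S) (hI : 0 ≤ I) (hC : 0 ≤ C) (hMp : 0 < Mp) (hMc : 0 < Mc)
    (hc : GCCIC.PowerConstraint 𝔠 c) :
    1 * ((1 - (GCCIC.errP 𝔠 c).toReal) * Real.log Mp) +
      1 * ((1 - (GCCIC.errC 𝔠 c).toReal) * Real.log Mc) ≤
      N * (Real.log (1 + C) + Real.log (2 * (1 + I + S / (1 + C + I))) +
        Real.log (2 * (1 + I / (1 + C) + S / (1 + I)))) + 4 := by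
  have p1 : 0 < 1 + C := by positivity
  have p2 : 0 < 2 * (1 + I + S / (1 + C + I)) := by positivity
  have p3 : 0 < 2 * (1 + I / (1 + C) + S / (1 + I)) := by positivity
  have hD0 : ∀ tf tp : Fin N → ℂ, 0 < vgauss (1 + C) tf * (𝔪).condP tf tp := fun tf tp =>
    mul_pos (vgauss_pos p1 _) ((𝔪).condP_pos hMp _ _)
  have h := weighted_gain_le (S := S) (I := I) (C := C) (θp := θp) (θc := θc) (c := c)
    (k := 1) (l := 1) hMp hMc
    ((((((((meanLe_eval ((𝔪).isTest_ratioPJoint (by fun_prop) hD0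
        ((𝔪).lintegral_vgauss_mul_condP hMp p1).le p2
        (coefI S I θp (1 + C + I)) (coefF S C (1 + C + I)) hMc)).add
      (meanLe_eval ((𝔪).isTest_ratioCJoint p3 (coefI S I θc (1 + I))
        (crossGain I θp * ((Real.sqrt C / (1 + C) : ℝ) : ℂ)) hMp hMc))).add
      (meanLe_tF hMp hMc hc hC)).add (meanLe_yP_sub_joint hMp hMc hc hS hI hC)).add
      (meanLe_yC_sub_joint hMp hMc hc hS hI hC)).add
      (meanLe_log_kerF (S := S) (I := I) (C := C) (θp := θp) (θc := θc) (c := c) hMp hMc)).add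
      (meanLe_log_kerP (S := S) (I := I) (C := C) (θp := θp) (θc := θc) (c := c) hMp hMc)).add
      (meanLe_log_kerC (S := S) (I := I) (C := C) (θp := θp) (θc := θc) (c := c)
        hMp hMc)) fun ω => by
    have h1 := gainP_le_ratioPJoint (S := S) (I := I) (C := C) (θp := θp) (θc := θc) (c := c)
      hMc hD0 p2 (coefI S I θp (1 + C + I)) (coefF S C (1 + C + I)) ω
    have h2 := gainC_le_ratioCJoint (S := S) (I := I) (C := C) (θp := θp) (θc := θc) (c := c)
      hMp hMc p3
      (coefI S I θc (1 + I)) (crossGain I θp * ((Real.sqrt C / (1 + C) : ℝ) : ℂ)) ω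
    rw [Real.log_mul (vgauss_pos p1 _).ne' ((𝔪).condP_pos hMp _ _).ne'] at h1
    linarith
  linarith

/-- One copy of the primary bound cancels `log condP` in the cognitive bound, the other cancels `log
mixC`. Only the cognitive error mixes the inputs, so a single factor of `2` is lost. -/
theorem two_primary_add_cognitive_le (hS : 0 ≤ S) (hI : 0 ≤ I) (hC : 0 ≤ C) (hMp : 0 < Mp)
    (hMc : 0 < Mc) (hc : GCCIC.PowerConstraint 𝔠 c) :
    2 * ((1 - (GCCIC.errP 𝔠 c).toReal) * Real.log Mp) +
      1 * ((1 - (GCCIC.errC 𝔠 c).toReal) * Real.log Mc) ≤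
      N * (Real.log (1 + (Real.sqrt S + Real.sqrt I) ^ 2) + Real.log (1 + C) +
        Real.log (1 + S / (1 + C + I)) +
        Real.log (2 * (1 + I / (1 + C) + S / (1 + I)))) + 6 := by
  have p0 : 0 < 1 + (Real.sqrt S + Real.sqrt I) ^ 2 := by positivity
  have p1 : 0 < 1 + C := by positivity
  have p2 : 0 < 1 + S / (1 + C + I) := by positivity
  have p3 : 0 < 2 * (1 + I / (1 + C) + S / (1 + I)) := by positivity
  have hD0 : ∀ tf tp : Fin N → ℂ, 0 < vgauss (1 + C) tf * (𝔪).condP tf tp := fun tf tp =>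
    mul_pos (vgauss_pos p1 _) ((𝔪).condP_pos hMp _ _)
  have h := weighted_gain_le (S := S) (I := I) (C := C) (θp := θp) (θc := θc) (c := c)
    (k := 2) (l := 1) hMp hMc
    (((((((((((meanLe_eval ((𝔪).isTest_ratioPGiven (by fun_prop) hD0
        ((𝔪).lintegral_vgauss_mul_condP hMp p1).le p2
        (coefI S I θp (1 + C + I)) (coefF S C (1 + C + I)) hMc)).add
      (meanLe_eval ((𝔪).isTest_ratioCJoint p3 (coefI S I θc (1 + I))
        (crossGain I θp * ((Real.sqrt C / (1 + C) : ℝ) : ℂ)) hMp hMc))).add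
      (meanLe_eval ((𝔪).isTest_ratioPMix p0 hMc))).add (meanLe_yP hMp hMc hc)).add
      (meanLe_tF hMp hMc hc hC)).add (meanLe_yP_sub_given hMp hMc hc hS hI hC)).add
      (meanLe_yC_sub_joint hMp hMc hc hS hI hC)).add
      (meanLe_log_kerF (S := S) (I := I) (C := C) (θp := θp) (θc := θc) (c := c) hMp hMc)).add
      (meanLe_log_kerP (S := S) (I := I) (C := C) (θp := θp) (θc := θc) (c := c) hMp hMc)).add
      (meanLe_log_kerC (S := S) (I := I) (C := C) (θp := θp) (θc := θc) (c := c) hMp hMc)).add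
      (meanLe_log_kerC (S := S) (I := I) (C := C) (θp := θp) (θc := θc) (c := c)
        hMp hMc)) fun ω => by
    have h0 := gainP_le_ratioPMix (S := S) (I := I) (C := C) (θp := θp) (θc := θc) (c := c)
      hMc p0 ω
    have h1 := gainP_le_ratioPGiven (S := S) (I := I) (C := C) (θp := θp) (θc := θc) (c := c)
      hD0 p2 (coefI S I θp (1 + C + I)) (coefF S C (1 + C + I)) ω
    have h2 := gainC_le_ratioCJoint (S := S) (I := I) (C := C) (θp := θp) (θc := θc) (c := c)
      hMp hMc p3
      (coefI S I θc (1 + I)) (crossGain I θp * ((Real.sqrt C / (1 + C) : ℝ) : ℂ)) ω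
    rw [Real.log_mul (vgauss_pos p1 _).ne' ((𝔪).condP_pos hMp _ _).ne'] at h1
    linarith
  linarith

/-- The roles are reversed: one cognitive bound cancels `log mixC` in the primary bound, the other
cancels `log causalP`. -/
theorem primary_add_two_cognitive_le (hS : 0 ≤ S) (hI : 0 ≤ I) (hC : 0 ≤ C) (hMp : 0 < Mp)
    (hMc : 0 < Mc) (hc : GCCIC.PowerConstraint 𝔠 c) :
    1 * ((1 - (GCCIC.errP 𝔠 c).toReal) * Real.log Mp) +
      2 * ((1 - (GCCIC.errC 𝔠 c).toReal) * Real.log Mc) ≤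
      N * (Real.log (1 + (Real.sqrt S + Real.sqrt I) ^ 2) + Real.log (1 + S / (1 + I)) +
        Real.log (1 + C / (1 + I)) + Real.log (2 * (1 + I + S / (1 + C + I)))) + 6 := by
  have p0 : 0 < 1 + (Real.sqrt S + Real.sqrt I) ^ 2 := by positivity
  have p1 : 0 < 1 + C / (1 + I) := by positivity
  have p2 : 0 < 2 * (1 + I + S / (1 + C + I)) := by positivity
  have p3 : 0 < 1 + S / (1 + I) := by positivity
  have hD0 : ∀ tf tp : Fin N → ℂ, 0 < (𝔪).causalP tf tp *
      vgauss (1 + C / (1 + I)) (tf - coefI C I θp (1 + I) • tp) := fun tf tp =>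
    mul_pos ((𝔪).causalP_pos hMp _ _) (vgauss_pos p1 _)
  have h := weighted_gain_le (S := S) (I := I) (C := C) (θp := θp) (θc := θc) (c := c)
    (k := 1) (l := 2) hMp hMc
    (((((((((((meanLe_eval ((𝔪).isTest_ratioPJoint (by fun_prop) hD0
        ((𝔪).lintegral_causalP_mul_vgauss hMp p1 (coefI C I θp (1 + I))).le p2
        (coefI S I θp (1 + C + I)) (coefF S C (1 + C + I)) hMc)).add
      (meanLe_eval ((𝔪).isTest_ratioCSide p3 (coefI S I θc (1 + I)) hMp hMc))).add
      (meanLe_eval ((𝔪).isTest_ratioCCausal p0 hMp))).add (meanLe_yC hMp hMc hc)).add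
      (meanLe_tF_sub hMp hMc hc hI hC)).add (meanLe_yP_sub_joint hMp hMc hc hS hI hC)).add
      (meanLe_yC_sub_side hMp hMc hc hS hI)).add
      (meanLe_log_kerF (S := S) (I := I) (C := C) (θp := θp) (θc := θc) (c := c) hMp hMc)).add
      (meanLe_log_kerP (S := S) (I := I) (C := C) (θp := θp) (θc := θc) (c := c) hMp hMc)).add
      (meanLe_log_kerP (S := S) (I := I) (C := C) (θp := θp) (θc := θc) (c := c) hMp hMc)).add
      (meanLe_log_kerC (S := S) (I := I) (C := C) (θp := θp) (θc := θc) (c := c)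
        hMp hMc)) fun ω => by
    have h0 := gainC_le_ratioCCausal (S := S) (I := I) (C := C) (θp := θp) (θc := θc) (c := c)
      hMp p0 ω
    have h1 := gainP_le_ratioPJoint (S := S) (I := I) (C := C) (θp := θp) (θc := θc) (c := c)
      hMc hD0 p2 (coefI S I θp (1 + C + I)) (coefF S C (1 + C + I)) ω
    have h2 := gainC_le_ratioCSide (S := S) (I := I) (C := C) (θp := θp) (θc := θc) (c := c) hMc p3
      (coefI S I θc (1 + I)) ω
    rw [Real.log_mul ((𝔪).causalP_pos hMp _ _).ne' (vgauss_pos p1 _).ne'] at h1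
    linarith
  linarith

end SymChannel

/-! ### Regrouping the logarithms, comparison of the bounds, conclusion -/

namespace SymOuter

variable {S I C : ℝ}

/-- With `D = 1 + C + I`, `J = 1 + I`, `K = 1 + C`, up to the common factor four this is `(J +
S/D)(D + SK/J) = (D + S/J)(J + SK/D)`; both sides expand to the same four terms. -/
theorem isd_product_eq (hS : 0 ≤ S) (hI : 0 ≤ I) (hC : 0 ≤ C) :
    (1 + C) * (2 * (1 + I + S / (1 + C + I))) * (2 * (1 + I / (1 + C) + S / (1 + I))) =
      (1 + C + I + S / (1 + I)) * (1 + I + S * ((1 + C) / (1 + C + I))) * (2 * 2) := by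
  field_simp

theorem deltaP_product_eq (hS : 0 ≤ S) (hI : 0 ≤ I) (hC : 0 ≤ C) :
    (1 + C) * (1 + S / (1 + C + I)) * (2 * (1 + I / (1 + C) + S / (1 + I))) =
      (1 + S / (1 + I)) * ((1 + C / (1 + I + S)) * (1 + I + S * ((1 + C) / (1 + I + C)))) * 2 := by
  field_simp
  ring

theorem deltaC_product_eq (hI : 0 ≤ I) (hC : 0 ≤ C) :
    (1 + C / (1 + I)) * (2 * (1 + I + S / (1 + C + I))) = (1 + C + I + S / (1 + I)) * 2 := by
  field_simp
  ring

theorem sumBound_le_sumBoundCoop (hS : 0 ≤ S) (hI : 0 ≤ I) (hC : 0 ≤ C) :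
    sumBound S I ≤ sumBoundCoop S I C := by
  refine add_le_add (Real.logb_le_logb_of_le one_lt_two (by positivity) ?_) le_rfl
  gcongr
  linarith

theorem half_le_ratio (hI : 0 ≤ I) (h : I ≤ C) : 1 / 2 ≤ (1 + C) / (1 + C + I) := by
  rw [div_le_div_iff₀ two_pos (by linarith)]
  linarith

theorem le_sumBoundISD (hS : 0 ≤ S) (hI : 0 ≤ I) (h : I ≤ C) :
    Real.logb 2 (1 + 2 * I + S / (1 + I)) + Real.logb 2 (1 + I + S / 2) ≤ sumBoundISD S I C := by
  have h1 := mul_le_mul_of_nonneg_left (half_le_ratio hI h) hS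
  exact add_le_add
    (Real.logb_le_logb_of_le one_lt_two (by positivity) (by linarith))
    (Real.logb_le_logb_of_le one_lt_two (by positivity) (by linarith))

theorem sumBound_sub_le (hS : 0 ≤ S) (hI : 0 ≤ I) :
    sumBound S I - 2 * Real.logb 2 2 ≤
      Real.logb 2 (1 + 2 * I + S / (1 + I)) + Real.logb 2 (1 + I + S / 2) := by
  have h1 : (Real.sqrt S + Real.sqrt I) ^ 2 ≤ 2 * S + 2 * I := by
    have := sq_nonneg (Real.sqrt S - Real.sqrt I)
    nlinarith [Real.sq_sqrt hS, Real.sq_sqrt hI]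
  have h2 := Real.logb_le_logb_of_le one_lt_two
    (show 0 < 1 + S / (1 + I) by positivity)
    (show 1 + S / (1 + I) ≤ 1 + 2 * I + S / (1 + I) by linarith)
  have h3 := Real.logb_le_logb_of_le one_lt_two
    (show 0 < 1 + (Real.sqrt S + Real.sqrt I) ^ 2 by positivity)
    -- The two bits of slack are this factor of four.
    (show 1 + (Real.sqrt S + Real.sqrt I) ^ 2 ≤ 2 * 2 * (1 + I + S / 2) by linarith)
  rw [Real.logb_mul (by norm_num) (by positivity), Real.logb_mul (by norm_num) (by norm_num)] at h3
  rw [sumBound]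
  linarith

theorem le_deltaP (hS : 0 ≤ S) (hI : 0 ≤ I) (h : I ≤ C) :
    Real.logb 2 (1 + I + S / 2) ≤ deltaP S I C := by
  have hC := hI.trans h
  have h1 : 0 ≤ Real.logb 2 (1 + C / (1 + I + S)) :=
    Real.logb_nonneg one_lt_two (le_add_of_nonneg_right (by positivity))
  have h2 := mul_le_mul_of_nonneg_left (half_le_ratio hI h) hS
  have h3 := Real.logb_le_logb_of_le one_lt_two (show 0 < 1 + I + S / 2 by positivity)
    (show 1 + I + S / 2 ≤ 1 + I + S * ((1 + C) / (1 + I + C)) by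
      rw [add_right_comm 1 I C]; linarith)
  rw [deltaP]
  linarith

theorem le_deltaC (hS : 0 ≤ S) (hI : 0 ≤ I) (h : S ≤ C) :
    Real.logb 2 (1 + S) ≤ deltaC S I C := by
  refine Real.logb_le_logb_of_le one_lt_two (by positivity) ?_
  have : 0 ≤ S / (1 + I) := by positivity
  linarith

theorem capacityRegion_subset {θp θc : ℝ} (hS : 0 ≤ S) (hI : 0 ≤ I) (hC : 0 ≤ C) :
    (GCCIC.symmetric S I C θp θc).capacityRegion ⊆ region S I C := by
  intro R hR
  have q1 : 0 < 1 + (Real.sqrt S + Real.sqrt I) ^ 2 := by positivity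
  have q2 : 0 < 1 + C := by positivity
  have q3 : 0 < 1 + S / (1 + C + I) := by positivity
  have q4 : 0 < 2 * (1 + I + S / (1 + C + I)) := by positivity
  have q5 : 0 < 2 * (1 + I / (1 + C) + S / (1 + I)) := by positivity
  have q6 : 0 < 1 + S / (1 + I) := by positivity
  have q7 : 0 < 1 + C / (1 + I) := by positivity
  have q8 : 0 < 1 + C + I + S / (1 + I) := by positivity
  have q9 : 0 < 1 + I + S * ((1 + C) / (1 + C + I)) := by positivity
  have q10 : 0 < 1 + C / (1 + I + S) := by positivity
  have q11 : 0 < 1 + I + S * ((1 + C) / (1 + I + C)) := by positivity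
  have b1 := capacityRegion_le _ zero_le_one le_rfl (fun _ _ _ _ hMp hMc hc =>
    SymChannel.primary_le_cutset hS hC hMp hMc hc) hR
  have b2 := capacityRegion_le _ zero_le_one le_rfl (fun _ _ _ _ hMp hMc hc =>
    SymChannel.primary_le_miso hMp hMc hc) hR
  have b3 := capacityRegion_le _ le_rfl zero_le_one (fun _ _ _ _ hMp hMc hc =>
    SymChannel.cognitive_le hS hMp hMc hc) hR
  have b4 := capacityRegion_le _ zero_le_one zero_le_one (fun _ _ _ _ hMp hMc hc =>
    SymChannel.sum_le hS hI hMp hMc hc) hR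
  have b5 := capacityRegion_le _ zero_le_one zero_le_one (fun _ _ _ _ hMp hMc hc =>
    SymChannel.sum_le_coop hS hI hC hMp hMc hc) hR
  have b6 := capacityRegion_le _ zero_le_one zero_le_one (fun _ _ _ _ hMp hMc hc =>
    SymChannel.sum_le_isd hS hI hC hMp hMc hc) hR
  have b7 := capacityRegion_le _ zero_le_two zero_le_one (fun _ _ _ _ hMp hMc hc =>
    SymChannel.two_primary_add_cognitive_le hS hI hC hMp hMc hc) hR
  have b8 := capacityRegion_le _ zero_le_one zero_le_two (fun _ _ _ _ hMp hMc hc =>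
    SymChannel.primary_add_two_cognitive_le hS hI hC hMp hMc hc) hR
  simp only [one_mul, zero_mul, add_zero, zero_add, add_div,
    Real.log_div_log] at b1 b2 b3 b4 b5 b6 b7 b8
  -- The bounds for codes carry one logarithm per chain-rule term; the product identities regroup
  -- them into the stated forms.
  have e1 := Real.logb_mul (b := 2) q2.ne' (show 1 + S / (1 + C) ≠ 0 by positivity)
  rw [show (1 + C) * (1 + S / (1 + C)) = 1 + C + S by field_simp] at e1
  have e5 := Real.logb_mul (b := 2) q7.ne' q3.ne'
  rw [show (1 + C / (1 + I)) * (1 + S / (1 + C + I)) = 1 + (S + C) / (1 + I) by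
    field_simp; ring] at e5
  have e6 := congrArg (Real.logb 2) (isd_product_eq hS hI hC)
  rw [Real.logb_mul (mul_pos q2 q4).ne' q5.ne', Real.logb_mul q2.ne' q4.ne',
    Real.logb_mul (mul_pos q8 q9).ne' (mul_pos two_pos two_pos).ne', Real.logb_mul q8.ne' q9.ne',
    Real.logb_mul two_ne_zero two_ne_zero] at e6
  have e7 := congrArg (Real.logb 2) (deltaP_product_eq hS hI hC)
  rw [Real.logb_mul (mul_pos q2 q3).ne' q5.ne', Real.logb_mul q2.ne' q3.ne',
    Real.logb_mul (mul_pos q6 (mul_pos q10 q11)).ne' two_ne_zero,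
    Real.logb_mul q6.ne' (mul_pos q10 q11).ne', Real.logb_mul q10.ne' q11.ne'] at e7
  have e8 := congrArg (Real.logb 2) (deltaC_product_eq (S := S) hI hC)
  rw [Real.logb_mul q7.ne' q4.ne', Real.logb_mul q8.ne' two_ne_zero] at e8
  refine ⟨by linarith, b2, b3, b4, ?_, ?_, ?_, ?_⟩ <;>
    simp only [sumBound, sumBoundCoop, sumBoundISD, deltaP, deltaC] <;> linarith

end SymOuter

theorem mainTheorem5 (S I C θp θc : ℝ) (hS : 0 ≤ S) (hI : 0 ≤ I) (hC : 0 ≤ C) :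
    (GCCIC.symmetric S I C θp θc).capacityRegion ⊆ SymOuter.region S I C ∧
    SymOuter.sumBound S I ≤ SymOuter.sumBoundCoop S I C ∧
    (I ≤ C →
      Real.logb 2 (1 + 2 * I + S / (1 + I)) + Real.logb 2 (1 + I + S / 2) ≤
        SymOuter.sumBoundISD S I C) ∧
    SymOuter.sumBound S I - 2 * Real.logb 2 2 ≤
      Real.logb 2 (1 + 2 * I + S / (1 + I)) + Real.logb 2 (1 + I + S / 2) ∧
    (I ≤ C → Real.logb 2 (1 + I + S / 2) ≤ SymOuter.deltaP S I C) ∧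
    (S ≤ C → Real.logb 2 (1 + S) ≤ SymOuter.deltaC S I C) :=
  ⟨SymOuter.capacityRegion_subset hS hI hC, SymOuter.sumBound_le_sumBoundCoop hS hI hC,
    SymOuter.le_sumBoundISD hS hI, SymOuter.sumBound_sub_le hS hI, SymOuter.le_deltaP hS hI,
    SymOuter.le_deltaC hS hI⟩
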